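/- Let $K$ be a field, $n\ge 2$ an integer not divisible by the characteristic of $K$, and $E/K$ an elliptic curve given by a Weierstrass equation with coordinate functions $x,y$ and origin $O$. Let $\overline K$ be a separable closure of $K$, $G_K=\operatorname{Gal}(\overline K/K)$, and write $E[n]=E(\overline K)[n]$. Let $R=\operatorname{Map}_K(E[n],\overline K)$ be the algebra of $G_K$-equivariant maps, $\overline R=\operatorname{Map}(E[n],\overline K)$, and identify $R\otimes_K R$ with $\operatorname{Map}_K(E[n]\times E[n],\overline K)$. For $\alpha\in\overline R^\times$ put $(\partial\alpha)(T_1,T_2)=\alpha(T_1)\alpha(T_2)/\alpha(T_1+T_2)$, and let $H$ be the group of all $\rho\in(R\otimes_K R)^\times$ with $\rho(T_1,T_2)=\rho(T_2,T_1)$ and $\rho(T_1,T_2)\rho(T_1+T_2,T_3)=\rho(T_1,T_2+T_3)\rho(T_2,T_3)$ for all $T_1,T_2,T_3\in E[n]$. Let $w:E[n]\to\overline R^\times$, $w(S)(T)=e_n(S,T)$, where $e_n$ is the Weil pairing, with the sign for which a function $G_T$ with $\operatorname{div}G_T=[n]^*(T)-[n]^*(O)$ satisfies $G_T(P+S)=e_n(S,T)G_T(P)$.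 Let $\delta:E(K)\to H^1(K,E[n])$ be the Kummer connecting map, $\delta(P)=[\sigma\mapsto\sigma Q-Q]$ with $nQ=P$, and let $w_2:H^1(K,E[n])\to H/\partial R^\times$ be the inverse of the connecting isomorphism of $0\to E[n]\xrightarrow{w}\overline R^\times\xrightarrow{\partial}\overline H\to 0$ (where $\overline H$ is the analogue of $H$ over $\overline K$); thus $w_2([c])=[\partial\gamma]$ whenever $\gamma\in\overline R^\times$ satisfies $\sigma(\gamma)/\gamma=w(c_\sigma)$ for all $\sigma\in G_K$. For $T_1,T_2\in E[n]$ let $r_{T_1,T_2}$ be the rational function $$ r_{T_1,T_2}=\begin{cases}1 & \text{if } T_1=O\text{ or }T_2=O,\\ x-x(T_1) & \text{if } T_1+T_2=O,\ T_1\ne O,\\ \dfrac{y-y(-(T_1+T_2))}{x-x(T_1+T_2)}-\lambda(T_1,T_2) & \text{otherwise,}\end{cases}$$ where $\lambda(T_1,T_2)$ is the slope of the line through $T_1$ and $T_2$ (the tangent line if $T_1=T_2$). For $P\in E(\overline K)\setminus E[n]$ let $r(P)=\bigl((T_1,T_2)\mapsto r_{T_1,T_2}(P)\bigr)$, and for a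 divisor $D=\sum_P n_P(P)$ on $E$ with support in $E(\overline K)\setminus E[n]$ put $r(D)=\prod_P r(P)^{n_P}$. Let $\operatorname{Pic}^0(E/K)$ be the group of $G_K$-invariant divisors of degree $0$ with support in $E(\overline K)$, modulo those of the form $\operatorname{div}(h)$ with $h\in K(E)^\times$. Then: 1. If $P\in E(K)\setminus E[n]$, then $r(P)\in H$ and $w_2(\delta(P))=r(P)\,\partial R^\times$. 2. If $D$ is a $G_K$-invariant divisor supported in $E(\overline K)\setminus E[n]$, then $r(D)\in H$. 3. The map $P\mapsto[(P)-(O)]$ is an isomorphism $E(K)\cong\operatorname{Pic}^0(E/K)$; every class in $\operatorname{Pic}^0(E/K)$ is represented by a divisor supported in $E(\overline K)\setminus E[n]$; and there is a well-defined homomorphism $\widetilde r:\operatorname{Pic}^0(E/K)\to H/\partial R^\times$ with $\widetilde r([D])=r(D)\,\partial R^\times$ for every $G_K$-invariant divisor $D$ of degree $0$ supported in $E(\overline K)\setminus E[n]$. Under the isomorphism $E(K)\cong\operatorname{Pic}^0(E/K)$ one has $w_2\circ\delta=\widetilde r$ on all of $E(K)$. -/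

import Mathlib

open WeierstrassCurve WeierstrassCurve.Affine
open scoped nonZeroDivisors

noncomputable section

namespace EllDescent

/-! ### Functions, divisors and the Weil pairing on a Weierstrass curve over a field -/

section Geometry

variable {F : Type*} [Field F] {V : WeierstrassCurve.Affine F}

/-- The `x`-coordinate of an affine point (and `0` at the point at infinity, never used). -/
def xc : V.Point → F
  | .zero => 0
  | .some x _ _ => x

/-- The `y`-coordinate of an affine point (and `0` at the point at infinity, never used). -/
def yc : V.Point → F
  | .zero => 0
  | .some _ y _ => y

/-- `HasValueAt f P v`: the rational function `f` is regular at the affine point `P`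
and takes the value `v` there. -/
def HasValueAt (f : V.FunctionField) : V.Point → F → Prop
  | .zero, _ => False
  | .some _ _ h, v => ∃ a b : V.CoordinateRing,
      AdjoinRoot.evalEval h.1 b ≠ 0 ∧
      f * algebraMap V.CoordinateRing V.FunctionField b =
        algebraMap V.CoordinateRing V.FunctionField a ∧
      v = AdjoinRoot.evalEval h.1 a / AdjoinRoot.evalEval h.1 b

/-- The fractional ideal of the affine coordinate ring that corresponds to the divisor `(P)`
restricted to the affine part of the curve (it is trivial for the point at infinity). -/
def pointIdeal : V.Point → (FractionalIdeal V.CoordinateRing⁰ V.FunctionField)ˣ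
  | .zero => 1
  | .some _ _ h => CoordinateRing.XYIdeal' h

/-- The degree of a divisor (a formal sum of points). -/
def deg (D : V.Point →₀ ℤ) : ℤ := D.sum fun _ m => m

/-- `IsDivOf f D`: the function `f` is nonzero and `div f = D`. On the affine part this is an
equality of fractional ideals of the coordinate ring; the multiplicity of `div f` at infinity is
then determined by the fact that a principal divisor has degree `0`. -/
def IsDivOf (f : V.FunctionField) (D : V.Point →₀ ℤ) : Prop :=
  deg D = 0 ∧
    FractionalIdeal.spanSingleton V.CoordinateRing⁰ f =
      ((D.prod fun P m => pointIdeal P ^ m :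
        (FractionalIdeal V.CoordinateRing⁰ V.FunctionField)ˣ) :
          FractionalIdeal V.CoordinateRing⁰ V.FunctionField)

variable [DecidableEq F]

/-- `IsWeilValue n S T ζ`: for some degree zero divisors `D_S = (S + A) - (A)` and
`D_T = (T + B) - (B)` with disjoint supports consisting of affine points, and for functions
`f`, `g` with `div f = n D_S` and `div g = n D_T`, one has `ζ = g(D_S) / f(D_T)`. -/
def IsWeilValue (n : ℕ) (S T : V.Point) (ζ : Fˣ) : Prop :=
  ∃ (A B : V.Point) (f g : V.FunctionField) (f₁ f₂ g₁ g₂ : F),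
    (S + A ≠ T + B ∧ S + A ≠ B ∧ A ≠ T + B ∧ A ≠ B) ∧
    IsDivOf f ((n : ℤ) • (Finsupp.single (S + A) 1 - Finsupp.single A 1)) ∧
    IsDivOf g ((n : ℤ) • (Finsupp.single (T + B) 1 - Finsupp.single B 1)) ∧
    HasValueAt g (S + A) g₁ ∧ HasValueAt g A g₂ ∧
    HasValueAt f (T + B) f₁ ∧ HasValueAt f B f₂ ∧
    (ζ : F) = (g₁ / g₂) / (f₁ / f₂)

open Classical in
/-- The Weil pairing `e_n(S, T)` of two `n`-torsion points (for a curve over a separably closed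
field in which `n` is invertible; the value of `IsWeilValue` then exists and is unique).
The sign convention is the one for which a function `G` with
`div G = [n]^* (T) - [n]^* (O)` satisfies `G (P + S) = e_n(S, T) G (P)`. -/
def weilPairing (n : ℕ) (S T : V.Point) : Fˣ :=
  if h : ∃ ζ : Fˣ, IsWeilValue n S T ζ then h.choose else 1

/-- The value at `P` of the rational function `r_{T₁,T₂}`, which is `1` if `T₁ = O` or `T₂ = O`,
is `x - x(T₁)` if `T₁ + T₂ = O` and `T₁ ≠ O`, and otherwise is
`(y - y(-(T₁ + T₂))) / (x - x(T₁ + T₂)) - λ(T₁, T₂)`, with `λ(T₁, T₂)` the slope of the line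
through `T₁` and `T₂` (of the tangent line if `T₁ = T₂`). -/
def rVal (T₁ T₂ P : V.Point) : F :=
  if T₁ = 0 ∨ T₂ = 0 then 1
  else if T₁ + T₂ = 0 then xc P - xc T₁
  else (yc P - yc (-(T₁ + T₂))) / (xc P - xc (T₁ + T₂)) -
    V.slope (xc T₁) (xc T₂) (yc T₁) (yc T₂)

end Geometry

/-! ### Galois cohomology of the `n`-torsion, and the étale algebra of the `n`-torsion -/

section Galois

variable {K : Type*} [Field K] (W : WeierstrassCurve K) (Ω : Type*) [Field Ω] [Algebra K Ω]
  [DecidableEq Ω] (n : ℕ)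

/-- The group `E[n]` of all `n`-torsion points over `Ω` (a separable closure of `K`). -/
abbrev Tors : Type _ := AddSubgroup.torsionBy (W⁄Ω).Point (n : ℤ)

variable {Ω}

/-- The action of `σ ∈ Gal(Ω/K)` on the points over `Ω`. -/
def gal (σ : Ω ≃ₐ[K] Ω) : (W⁄Ω).Point →+ (W⁄Ω).Point :=
  Point.map (W' := W) (σ : Ω →ₐ[K] Ω)

/-- The action of `σ ∈ Gal(Ω/K)` on `E[n]`. -/
def galTors (σ : Ω ≃ₐ[K] Ω) : Tors W Ω n →+ Tors W Ω n :=
  ((gal W σ).comp (AddSubgroup.subtype _)).codRestrict _ fun T => by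
    have h : (n : ℤ) • (T : (W⁄Ω).Point) = 0 := T.2
    change (n : ℤ) • gal W σ (T : (W⁄Ω).Point) = 0
    rw [← map_zsmul, h, map_zero]

variable (Ω)

/-- Continuous (that is, locally constant) `1`-cocycles of `Gal(Ω/K)` with values in `E[n]`. -/
def Z1 : AddSubgroup ((Ω ≃ₐ[K] Ω) → Tors W Ω n) where
  carrier := {c | IsLocallyConstant c ∧ ∀ σ τ, c (σ * τ) = c σ + galTors W n σ (c τ)}
  zero_mem' := ⟨IsLocallyConstant.const 0, fun σ τ => by simp⟩
  add_mem' := by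
    rintro c d ⟨hc, hc2⟩ ⟨hd, hd2⟩
    refine ⟨hc.add hd, fun σ τ => ?_⟩
    simp only [Pi.add_apply, hc2, hd2, map_add]
    abel
  neg_mem' := by
    rintro c ⟨hc, hc2⟩
    refine ⟨hc.neg, fun σ τ => ?_⟩
    simp only [Pi.neg_apply, hc2, map_neg]
    abel

/-- The `1`-coboundaries `σ ↦ σ T - T`. -/
def B1 : AddSubgroup (Z1 W Ω n) where
  carrier := {c | ∃ T : Tors W Ω n, ∀ σ, c.1 σ = galTors W n σ T - T}
  zero_mem' := ⟨0, fun σ => by simp⟩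
  add_mem' := by
    rintro c d ⟨S, hS⟩ ⟨T, hT⟩
    refine ⟨S + T, fun σ => ?_⟩
    simp only [AddSubgroup.coe_add, Pi.add_apply, hS, hT, map_add]
    abel
  neg_mem' := by
    rintro c ⟨S, hS⟩
    refine ⟨-S, fun σ => ?_⟩
    simp only [AddSubgroup.coe_neg, Pi.neg_apply, hS, map_neg]
    abel

/-- The Galois cohomology group `H¹(K, E[n])`. -/
abbrev H1 : Type _ := Z1 W Ω n ⧸ B1 W Ω n

/-- The unit group `R^×` of `R = Map_K(E[n], Ω)`, the algebra of Galois equivariant maps, inside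
the unit group of `Map(E[n], Ω)`. -/
def RUnits : Subgroup (Tors W Ω n → Ωˣ) where
  carrier := {α | ∀ (σ : Ω ≃ₐ[K] Ω) T, (α (galTors W n σ T) : Ω) = σ (α T)}
  one_mem' := fun σ T => by simp
  mul_mem' := by
    intro a b ha hb σ T
    simp [ha σ T, hb σ T]
  inv_mem' := by
    intro a ha σ T
    simp [ha σ T]

/-- The homomorphism `∂`, `(∂α)(T₁, T₂) = α(T₁) α(T₂) / α(T₁ + T₂)`. -/
def bd : (Tors W Ω n → Ωˣ) →* (Tors W Ω n → Tors W Ω n → Ωˣ) where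
  toFun α := fun T₁ T₂ => α T₁ * α T₂ / α (T₁ + T₂)
  map_one' := by ext; simp
  map_mul' α β := by
    funext T₁ T₂
    simp only [Pi.mul_apply]
    rw [div_mul_div_comm, mul_mul_mul_comm]

/-- The group `H`: the units of `R ⊗ R = Map_K(E[n] × E[n], Ω)` that are symmetric and satisfy
`ρ(T₁, T₂) ρ(T₁ + T₂, T₃) = ρ(T₁, T₂ + T₃) ρ(T₂, T₃)`. -/
def HGroup : Subgroup (Tors W Ω n → Tors W Ω n → Ωˣ) where
  carrier := {ρ |
    (∀ (σ : Ω ≃ₐ[K] Ω) T₁ T₂,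
      (ρ (galTors W n σ T₁) (galTors W n σ T₂) : Ω) = σ (ρ T₁ T₂)) ∧
    (∀ T₁ T₂, ρ T₁ T₂ = ρ T₂ T₁) ∧
    (∀ T₁ T₂ T₃, ρ T₁ T₂ * ρ (T₁ + T₂) T₃ = ρ T₁ (T₂ + T₃) * ρ T₂ T₃)}
  one_mem' := ⟨fun σ T₁ T₂ => by simp, fun _ _ => rfl, fun _ _ _ => rfl⟩
  mul_mem' := by
    rintro a b ⟨ha1, ha2, ha3⟩ ⟨hb1, hb2, hb3⟩
    refine ⟨fun σ T₁ T₂ => by simp [ha1, hb1], fun T₁ T₂ => ?_, fun T₁ T₂ T₃ => ?_⟩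
    · simp only [Pi.mul_apply]
      rw [ha2 T₁, hb2 T₁]
    · simp only [Pi.mul_apply]
      rw [mul_mul_mul_comm, ha3, hb3, mul_mul_mul_comm]
  inv_mem' := by
    rintro a ⟨ha1, ha2, ha3⟩
    refine ⟨fun σ T₁ T₂ => by simp [ha1], fun T₁ T₂ => ?_, fun T₁ T₂ T₃ => ?_⟩
    · simp only [Pi.inv_apply]
      rw [ha2 T₁]
    · simp only [Pi.inv_apply]
      rw [← mul_inv, ha3, mul_inv]

/-- The subgroup `∂R^×` of `H`. -/
def bdR : Subgroup (HGroup W Ω n) :=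
  ((RUnits W Ω n).map (bd W Ω n)).subgroupOf (HGroup W Ω n)

/-- The group `H / ∂R^×`. -/
abbrev HQuot : Type _ := HGroup W Ω n ⧸ bdR W Ω n

variable [DecidableEq K]

open Classical in
/-- The connecting homomorphism `δ : E(K) → H¹(K, E[n])` of the Kummer sequence
`0 → E[n] → E(Ω) → E(Ω) → 0`: it maps `P` to the class of `σ ↦ σ Q - Q`, where `n Q = P`. -/
def kummer (P : (W⁄K).Point) : H1 W Ω n :=
  if h : ∃ c : Z1 W Ω n, ∃ Q : (W⁄Ω).Point,
      n • Q = Point.baseChange K Ω P ∧ ∀ σ, (c.1 σ : (W⁄Ω).Point) = gal W σ Q - Q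
  then QuotientAddGroup.mk h.choose else 0

/-- `IsW2Value ξ ρ`: for some cocycle `c` in the class `ξ` and some `γ ∈ Map(E[n], Ω)^×` with
`σ γ / γ = w (c σ)` for all `σ`, where `(σ γ)(T) = σ (γ (σ⁻¹ T))` and `w(S)(T) = e_n(S, T)`,
one has `ρ = ∂γ`. This says that `ξ` is the image of `ρ` under the connecting homomorphism of
`0 → E[n] → Map(E[n], Ω)^× → ∂ (Map(E[n], Ω)^×) → 0`, the maps being `w` and `∂`. -/
def IsW2Value (ξ : H1 W Ω n) (ρ : HGroup W Ω n) : Prop :=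
  ∃ c : Z1 W Ω n, QuotientAddGroup.mk c = ξ ∧ ∃ γ : Tors W Ω n → Ωˣ,
    (∀ (σ : Ω ≃ₐ[K] Ω) (T : Tors W Ω n),
      σ (γ ((galTors W n σ⁻¹) T)) / (γ T : Ω) =
        (weilPairing n (c.1 σ : (W⁄Ω).Point) (T : (W⁄Ω).Point) : Ωˣ)) ∧
    ρ.1 = bd W Ω n γ

open Classical in
/-- The map `w₂ : H¹(K, E[n]) → H / ∂R^×`: the inverse of the connecting isomorphism
`H / ∂R^× → H¹(K, E[n])` of the exact sequence given by `w` and `∂`. -/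
def w2 (ξ : H1 W Ω n) : HQuot W Ω n :=
  if h : ∃ ρ : HGroup W Ω n, IsW2Value W Ω n ξ ρ then QuotientGroup.mk h.choose else 1

/-! ### Rational divisors and the Picard group -/

/-- The group of `K`-rational divisors: Galois invariant formal sums of points over `Ω`. -/
def DivK : AddSubgroup ((W⁄Ω).Point →₀ ℤ) where
  carrier := {D | ∀ (σ : Ω ≃ₐ[K] Ω) P, D (gal W σ P) = D P}
  zero_mem' := fun _ _ => rfl
  add_mem' := by
    intro a b ha hb σ P
    simp [ha σ P, hb σ P]
  neg_mem' := by
    intro a ha σ P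
    simp [ha σ P]

/-- The group of `K`-rational divisors of degree `0`. -/
def Div0K : AddSubgroup ((W⁄Ω).Point →₀ ℤ) where
  carrier := {D | D ∈ DivK W Ω ∧ deg D = 0}
  zero_mem' := ⟨zero_mem _, by simp [deg]⟩
  add_mem' := by
    rintro a b ⟨ha, ha2⟩ ⟨hb, hb2⟩
    refine ⟨add_mem ha hb, ?_⟩
    rw [deg, Finsupp.sum_add_index' (fun _ => rfl) (fun _ _ _ => rfl)]
    simp only [deg] at ha2 hb2
    rw [ha2, hb2, add_zero]
  neg_mem' := by
    rintro a ⟨ha, ha2⟩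
    refine ⟨neg_mem ha, ?_⟩
    rw [deg, Finsupp.sum_neg_index (fun _ => rfl), Finsupp.sum_neg, neg_eq_zero]
    exact ha2

/-- The function `f ∈ Ω(E)` lies in the subfield `K(E)`. -/
def IsRationalOver (f : (W⁄Ω).FunctionField) : Prop :=
  ∃ a b : Affine.CoordinateRing W, b ≠ 0 ∧
    f * algebraMap (W⁄Ω).CoordinateRing (W⁄Ω).FunctionField
        (CoordinateRing.map W (algebraMap K Ω) b) =
      algebraMap (W⁄Ω).CoordinateRing (W⁄Ω).FunctionField
        (CoordinateRing.map W (algebraMap K Ω) a)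

/-- The group of principal divisors `div h`, with `h ∈ K(E)^×`. -/
def PrinK : AddSubgroup (Div0K W Ω) :=
  AddSubgroup.closure {D | ∃ h, IsRationalOver W Ω h ∧ IsDivOf h D.1}

/-- The Picard group `Pic⁰(E/K)`. -/
abbrev Pic0 : Type _ := Div0K W Ω ⧸ PrinK W Ω

/-- The support of the divisor `D` is disjoint from `E[n]`. -/
def AvoidsTors (D : (W⁄Ω).Point →₀ ℤ) : Prop :=
  ∀ P ∈ D.support, n • P ≠ 0

/-- `IsRDiv D ρ`: the element `ρ` of `H` is `r(D) = ∏ r(P) ^ (n_P)` for `D = ∑ n_P (P)`. -/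
def IsRDiv (D : (W⁄Ω).Point →₀ ℤ) (ρ : HGroup W Ω n) : Prop :=
  ∀ T₁ T₂ : Tors W Ω n,
    (ρ.1 T₁ T₂ : Ω) = D.prod fun P m => rVal (T₁ : (W⁄Ω).Point) (T₂ : (W⁄Ω).Point) P ^ m

end Galois

end EllDescent

end

/-!
Everything rests on *monic* functions. The coordinate ring has basis `1`, `Y` over `F[X]`, and as
`x` and `y` behave like `t²` and `t³` at infinity, every element has a multiplicative leading
coefficient. A divisor `D`
of degree `0` whose points sum to `O` is the divisor of a unique function with leading coefficient
`1`; write `ev D P` for its value at `P`. Being unique, these values are additive in `D`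
(`ev_add`) and compatible with the Galois action (`ev_galDiv`), and `r_{A,B}` is the monic function
of `(A) + (B) - (A + B) - (O)` (`ev_rDiv`). In particular `r(D)` satisfies the cocycle identity,
since the two divisors agree.

Weil reciprocity (`weil_reciprocity`) says that `ev D E = ± ev E D`. Every principal divisor is a
sum of divisors `± ((P) + (Z) - (P + Z) - (O))` with `Z` as general as desired, so it is enough to
treat two functions `r_{A,B}` and `r_{C,D}`, and there it comes from the symmetry of `r_{A,B}(-C)`
in the three points, an identity for the slopes of lines.

For an `n`-torsion point `T` let `G_T(Q)` be the quotient, up to sign, of the value at `Q` of the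
monic function with divisor `n(T) - n(O)` by the value at `T` of the monic function with divisor
`n(Q) - (nQ) - (n - 1)(O)`. Reciprocity gives the two facts that matter: `∂G(Q) = r(nQ)`
(`gVal_mul_div`) and `G_T(Q + S) = e_n(S, T) G_T(Q)` (`weilPairing_eq`). Hence, if `q(P)` denotes a
point with `n q(P) = P`, the function `γ(T) = ∏ G_T(q(P)) ^ (n_P)` attached to a rational divisor
`D = ∑ n_P (P)` satisfies `∂γ = r(D)` (`bd_gammaDiv`), while `σ(γ) / γ` is the Weil pairing with
`σQ - Q` for `Q = ∑ n_P q(P)` (`gal_gammaDiv`). As `nQ` is the sum of `D`, this proves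
`w₂(δ(P)) = r(D)` for every rational divisor `D` with sum `P` (`isW2Value_of_isRDiv`); the choices
`D = (P)` and `D` of degree `0` give the two descriptions of `w₂ ∘ δ`.

Three inputs remain. Points are divisible by `n` (`nsmul_surjective`): the invariant differential is
additive, so it is multiplied by `n ≠ 0` under `[n]`; therefore the `x`-coordinate of `n` times the
generic point is a function of `x` with nonzero derivative, and such a function takes all but
finitely many values over a separably closed field. A rational divisor of degree `0` with sum `O` is
the divisor of a function over `K` (`mem_prinK`), because the monic function is Galois invariant.
Finally, there is a rational divisor `Z` of degree `1` away from any finite set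
(`exists_divK_degHom_eq_one`): conjugates of general fibres of `x` and of `y` have degrees that are
powers of `2` and of `3`. The difference of `Z` and its translate by a rational point `P` then
represents the class of `(P) - (O)` and avoids the `n`-torsion.
-/

open WeierstrassCurve WeierstrassCurve.Affine
open scoped nonZeroDivisors

noncomputable section

namespace EllDescent

/-! ### Leading coefficients at infinity -/

section Infinity

open Polynomial

variable {F : Type*} [Field F] {V : WeierstrassCurve.Affine F}

/-- The coefficient `p` of an element `p + qY` of the coordinate ring. -/
def coordP (z : V.CoordinateRing) : F[X] := (CoordinateRing.basis V).repr z 0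

/-- The coefficient `q` of an element `p + qY` of the coordinate ring. -/
def coordQ (z : V.CoordinateRing) : F[X] := (CoordinateRing.basis V).repr z 1

lemma coord_eq (z : V.CoordinateRing) :
    coordP z • (1 : V.CoordinateRing) + coordQ z • CoordinateRing.mk V X = z := by
  have h := (CoordinateRing.basis V).sum_repr z
  rw [Fin.sum_univ_two, CoordinateRing.basis_zero, CoordinateRing.basis_one] at h
  exact h

lemma coordP_smul_add (p q : F[X]) :
    coordP (p • (1 : V.CoordinateRing) + q • CoordinateRing.mk V X) = p := by
  rw [coordP, ← CoordinateRing.basis_zero, ← CoordinateRing.basis_one, map_add, map_smul, map_smul,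
    Module.Basis.repr_self, Module.Basis.repr_self]
  simp

lemma coordQ_smul_add (p q : F[X]) :
    coordQ (p • (1 : V.CoordinateRing) + q • CoordinateRing.mk V X) = q := by
  rw [coordQ, ← CoordinateRing.basis_zero, ← CoordinateRing.basis_one, map_add, map_smul, map_smul,
    Module.Basis.repr_self, Module.Basis.repr_self]
  simp

/-- The polynomial `p(t²) + t³ q(t²)` attached to `p + qY`; the assignment is multiplicative up to
terms of lower degree, as `x` and `y` have poles of order `2` and `3` at infinity. -/
def inftyPoly (z : V.CoordinateRing) : F[X] :=
  expand F 2 (coordP z) + expand F 2 (coordQ z) * X ^ 3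

lemma inftyPoly_smul_add (p q : F[X]) :
    inftyPoly (p • (1 : V.CoordinateRing) + q • CoordinateRing.mk V X) =
      expand F 2 p + expand F 2 q * X ^ 3 := by
  rw [inftyPoly, coordP_smul_add, coordQ_smul_add]

lemma coeff_inftyPoly_even (z : V.CoordinateRing) (i : ℕ) :
    (inftyPoly z).coeff (2 * i) = (coordP z).coeff i := by
  rw [inftyPoly, coeff_add, coeff_mul_X_pow', coeff_expand two_pos, coeff_expand two_pos]
  have h : ¬ (3 ≤ 2 * i ∧ 2 ∣ 2 * i - 3) := by omega
  by_cases h3 : 3 ≤ 2 * i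
  · rw [if_pos (dvd_mul_right _ _), if_pos h3, if_neg (fun h2 => h ⟨h3, h2⟩)]
    simp
  · rw [if_pos (dvd_mul_right _ _), if_neg h3]
    simp

lemma coeff_inftyPoly_odd (z : V.CoordinateRing) (i : ℕ) :
    (inftyPoly z).coeff (2 * i + 3) = (coordQ z).coeff i := by
  rw [inftyPoly, coeff_add, coeff_mul_X_pow', coeff_expand two_pos, coeff_expand two_pos,
    if_neg (by omega), if_pos (by omega), Nat.add_sub_cancel, if_pos (dvd_mul_right _ _)]
  simp

lemma inftyPoly_eq_zero {z : V.CoordinateRing} : inftyPoly z = 0 ↔ z = 0 := by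
  constructor
  · intro h
    have hp : coordP z = 0 := by
      ext i
      rw [← coeff_inftyPoly_even, h]
      simp
    have hq : coordQ z = 0 := by
      ext i
      rw [← coeff_inftyPoly_odd, h]
      simp
    rw [← coord_eq z, hp, hq]
    simp
  · rintro rfl
    simp [inftyPoly, coordP, coordQ]

lemma le_natDegree_inftyPoly {z : V.CoordinateRing} (h : coordQ z ≠ 0) :
    2 * (coordQ z).natDegree + 3 ≤ (inftyPoly z).natDegree := by
  apply le_natDegree_of_ne_zero
  rw [coeff_inftyPoly_odd]
  exact leadingCoeff_ne_zero.mpr h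

/-- At infinity `y²` agrees with `x³` up to terms of lower order, so `inftyPoly` is multiplicative up
to the error term on the right. -/
lemma inftyPoly_mul_eq (z w : V.CoordinateRing) :
    inftyPoly (z * w) = inftyPoly z * inftyPoly w +
      expand F 2 (coordQ z * coordQ w) * (C V.a₂ * X ^ 4 + C V.a₄ * X ^ 2 + C V.a₆
        - (C V.a₁ * X ^ 2 + C V.a₃) * X ^ 3) := by
  have key : z * w = (coordP z * coordP w + coordQ z * coordQ w *
        (X ^ 3 + C V.a₂ * X ^ 2 + C V.a₄ * X + C V.a₆)) • (1 : V.CoordinateRing) +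
      (coordP z * coordQ w + coordQ z * coordP w -
        coordQ z * coordQ w * (C V.a₁ * X + C V.a₃)) • CoordinateRing.mk V X := by
    have h1 := CoordinateRing.smul_basis_mul_Y (W' := V) (coordP z) (coordQ z)
    have h2 := CoordinateRing.smul_basis_mul_C (W' := V) (coordP w) (coordP z) (coordQ z)
    have h3 := CoordinateRing.smul_basis_mul_C (W' := V) (coordQ w)
      (coordQ z * (X ^ 3 + C V.a₂ * X ^ 2 + C V.a₄ * X + C V.a₆))
      (coordP z - coordQ z * (C V.a₁ * X + C V.a₃))
    rw [coord_eq] at h1 h2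
    rw [← h1] at h3
    have h4 : z * w = z * CoordinateRing.mk V (C (coordP w)) +
        z * CoordinateRing.mk V X * CoordinateRing.mk V (C (coordQ w)) := by
      conv_lhs => rw [← coord_eq w]
      simp only [CoordinateRing.smul]
      ring
    rw [h4, h2, h3]
    simp only [CoordinateRing.smul, map_add, map_mul, map_sub]
    ring
  rw [key, inftyPoly_smul_add, inftyPoly, inftyPoly]
  simp only [map_add, map_mul, map_sub, map_pow, expand_C, expand_X]
  ring

lemma degree_err_lt {z w : V.CoordinateRing} (hz : z ≠ 0) (hw : w ≠ 0) :
    (expand F 2 (coordQ z * coordQ w) * (C V.a₂ * X ^ 4 + C V.a₄ * X ^ 2 + C V.a₆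
        - (C V.a₁ * X ^ 2 + C V.a₃) * X ^ 3)).degree < (inftyPoly z * inftyPoly w).degree := by
  have hz' := mt inftyPoly_eq_zero.mp hz
  have hw' := mt inftyPoly_eq_zero.mp hw
  by_cases hq : coordQ z = 0
  · rw [hq, zero_mul, map_zero, zero_mul, degree_zero, bot_lt_iff_ne_bot, ne_eq, degree_eq_bot]
    exact mul_ne_zero hz' hw'
  by_cases hq' : coordQ w = 0
  · rw [hq', mul_zero, map_zero, zero_mul, degree_zero, bot_lt_iff_ne_bot, ne_eq, degree_eq_bot]
    exact mul_ne_zero hz' hw'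
  apply degree_lt_degree
  rw [natDegree_mul hz' hw']
  refine lt_of_le_of_lt (natDegree_mul_le) ?_
  rw [natDegree_expand, natDegree_mul hq hq']
  have h1 := le_natDegree_inftyPoly hq
  have h2 := le_natDegree_inftyPoly hq'
  have h3 : (C V.a₂ * X ^ 4 + C V.a₄ * X ^ 2 + C V.a₆
        - (C V.a₁ * X ^ 2 + C V.a₃) * X ^ 3).natDegree ≤ 5 := by compute_degree
  omega

lemma degree_inftyPoly_mul {z w : V.CoordinateRing} (hz : z ≠ 0) (hw : w ≠ 0) :
    (inftyPoly (z * w)).degree = (inftyPoly z).degree + (inftyPoly w).degree := by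
  rw [inftyPoly_mul_eq, degree_add_eq_left_of_degree_lt (degree_err_lt hz hw), degree_mul]

/-- The leading coefficient of an element of the coordinate ring at infinity, with respect to the
uniformiser for which `x` and `y` both have leading coefficient `1`. -/
def lead (z : V.CoordinateRing) : F := (inftyPoly z).leadingCoeff

lemma lead_ne_zero {z : V.CoordinateRing} (hz : z ≠ 0) : lead z ≠ 0 :=
  leadingCoeff_ne_zero.mpr (mt inftyPoly_eq_zero.mp hz)

lemma lead_mul (z w : V.CoordinateRing) : lead (z * w) = lead z * lead w := by
  by_cases hz : z = 0
  · simp [hz, lead, inftyPoly_eq_zero.mpr]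
  by_cases hw : w = 0
  · simp [hw, lead, inftyPoly_eq_zero.mpr]
  rw [lead, inftyPoly_mul_eq, leadingCoeff_add_of_degree_lt' (degree_err_lt hz hw),
    leadingCoeff_mul, lead, lead]

lemma algebraMap_eq_smul_add (c : F) : algebraMap F V.CoordinateRing c =
    C c • (1 : V.CoordinateRing) + (0 : F[X]) • CoordinateRing.mk V X := by
  rw [zero_smul, add_zero, Algebra.smul_def, mul_one]
  rfl

lemma inftyPoly_algebraMap (c : F) : inftyPoly (algebraMap F V.CoordinateRing c) = C c := by
  rw [algebraMap_eq_smul_add, inftyPoly_smul_add]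
  simp

lemma lead_algebraMap (c : F) : lead (algebraMap F V.CoordinateRing c) = c := by
  rw [lead, inftyPoly_algebraMap, leadingCoeff_C]

lemma lead_one : lead (1 : V.CoordinateRing) = 1 := by
  simpa using lead_algebraMap (V := V) (1 : F)

lemma XClass_eq_smul_add (x : F) : CoordinateRing.XClass V x =
    (X - C x) • (1 : V.CoordinateRing) + (0 : F[X]) • CoordinateRing.mk V X := by
  rw [zero_smul, add_zero, CoordinateRing.smul, mul_one]
  rfl

lemma YClass_eq_smul_add (p : F[X]) : CoordinateRing.YClass V p =
    (-p) • (1 : V.CoordinateRing) + (1 : F[X]) • CoordinateRing.mk V X := by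
  rw [one_smul, CoordinateRing.smul, mul_one, CoordinateRing.YClass, map_sub, C_neg, map_neg]
  ring

lemma lead_XClass (x : F) : lead (CoordinateRing.XClass V x) = 1 := by
  rw [lead, XClass_eq_smul_add, inftyPoly_smul_add]
  simp only [map_sub, expand_X, expand_C, map_zero, zero_mul, add_zero]
  exact monic_X_pow_sub_C x two_ne_zero

lemma lead_YClass_linePolynomial (x y l : F) :
    lead (CoordinateRing.YClass V (linePolynomial x y l)) = 1 := by
  rw [lead, YClass_eq_smul_add, inftyPoly_smul_add, linePolynomial]
  simp only [map_add, map_neg, map_mul, map_sub, expand_X, expand_C, map_one, one_mul]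
  rw [add_comm]
  refine monic_X_pow_add (?_)
  refine lt_of_le_of_lt (b := (2 : WithBot ℕ)) ?_ (by norm_num)
  compute_degree

/-- The units of the coordinate ring are the nonzero constants. -/
lemma exists_algebraMap_of_mul_eq_one {z w : V.CoordinateRing} (h : z * w = 1) :
    ∃ c : F, c ≠ 0 ∧ z = algebraMap F V.CoordinateRing c := by
  have hz : z ≠ 0 := by
    rintro rfl
    simp at h
  have hw : w ≠ 0 := by
    rintro rfl
    simp at h
  have h1 := degree_inftyPoly_mul hz hw
  have h2 : inftyPoly (1 : V.CoordinateRing) = 1 := by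
    simpa using inftyPoly_algebraMap (V := V) (1 : F)
  rw [h, h2, degree_one, degree_eq_natDegree (mt inftyPoly_eq_zero.mp hz),
    degree_eq_natDegree (mt inftyPoly_eq_zero.mp hw)] at h1
  have h3 : (inftyPoly z).natDegree = 0 := by
    have : 0 = (inftyPoly z).natDegree + (inftyPoly w).natDegree := by exact_mod_cast h1
    omega
  have h4 : coordQ z = 0 := by
    by_contra hq
    have := le_natDegree_inftyPoly hq
    omega
  have h5 : coordP z = C ((coordP z).coeff 0) := by
    ext i
    rcases i with _ | i
    · simp
    · rw [← coeff_inftyPoly_even, coeff_C_succ]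
      exact coeff_eq_zero_of_natDegree_lt (by omega)
  have h6 : z = algebraMap F V.CoordinateRing ((coordP z).coeff 0) := by
    rw [algebraMap_eq_smul_add, ← h5]
    conv_lhs => rw [← coord_eq z, h4]
  refine ⟨_, ?_, h6⟩
  intro h0
  rw [h0, map_zero] at h6
  exact hz h6

/-- A rational function is monic if its leading coefficient at infinity is `1`. -/
def IsMonicFn (f : V.FunctionField) : Prop :=
  ∃ a b : V.CoordinateRing, a ≠ 0 ∧ b ≠ 0 ∧
    f * algebraMap V.CoordinateRing V.FunctionField b =
      algebraMap V.CoordinateRing V.FunctionField a ∧ lead a = lead b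

lemma IsMonicFn.mul {f g : V.FunctionField} (hf : IsMonicFn f) (hg : IsMonicFn g) :
    IsMonicFn (f * g) := by
  obtain ⟨a, b, ha, hb, h, hl⟩ := hf
  obtain ⟨a', b', ha', hb', h', hl'⟩ := hg
  refine ⟨a * a', b * b', mul_ne_zero ha ha', mul_ne_zero hb hb', ?_, ?_⟩
  · rw [map_mul, map_mul, ← h, ← h']
    ring
  · rw [lead_mul, lead_mul, hl, hl']

lemma IsMonicFn.ne_zero {f : V.FunctionField} (hf : IsMonicFn f) : f ≠ 0 := by
  rintro rfl
  obtain ⟨a, b, ha, hb, h, hl⟩ := hf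
  rw [zero_mul] at h
  exact ha ((IsFractionRing.injective V.CoordinateRing V.FunctionField) (by rw [← h, map_zero]))

lemma IsMonicFn.inv {f : V.FunctionField} (hf : IsMonicFn f) : IsMonicFn f⁻¹ := by
  have hf0 := hf.ne_zero
  obtain ⟨a, b, ha, hb, h, hl⟩ := hf
  refine ⟨b, a, hb, ha, ?_, hl.symm⟩
  rw [← h, ← mul_assoc, inv_mul_cancel₀ hf0, one_mul]

lemma isMonicFn_algebraMap {a : V.CoordinateRing} (h : lead a = 1) :
    IsMonicFn (algebraMap V.CoordinateRing V.FunctionField a) := by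
  refine ⟨a, 1, ?_, one_ne_zero, by simp, by rw [h, lead_one]⟩
  rintro rfl
  simp [lead, inftyPoly_eq_zero.mpr] at h

lemma isMonicFn_one : IsMonicFn (1 : V.FunctionField) := by
  simpa using isMonicFn_algebraMap (V := V) lead_one

lemma IsMonicFn.eq_one_of_const {f g : V.FunctionField} (hf : IsMonicFn f) (hg : IsMonicFn g)
    {c : F} (h : f = algebraMap V.CoordinateRing V.FunctionField (algebraMap F _ c) * g) :
    f = g := by
  obtain ⟨a, b, ha, hb, h1, hl⟩ := hf
  obtain ⟨a', b', ha', hb', h2, hl'⟩ := hg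
  have h3 : algebraMap F _ c * a' * b = a * b' := by
    apply IsFractionRing.injective V.CoordinateRing V.FunctionField
    rw [map_mul, map_mul, map_mul, ← h1, ← h2, h]
    ring
  have h4 := congrArg lead h3
  rw [lead_mul, lead_mul, lead_mul, lead_algebraMap, hl, hl'] at h4
  have h5 : c = 1 := by
    have := lead_ne_zero hb
    have := lead_ne_zero hb'
    apply mul_right_cancel₀ (mul_ne_zero ‹lead b' ≠ 0› ‹lead b ≠ 0›)
    linear_combination h4
  rw [h, h5]
  simp

lemma exists_const_mul_isMonicFn {f : V.FunctionField} (hf : f ≠ 0) :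
    ∃ c : F, c ≠ 0 ∧
      IsMonicFn (algebraMap V.CoordinateRing V.FunctionField (algebraMap F _ c) * f) := by
  obtain ⟨a, b, hb, hab⟩ := IsFractionRing.div_surjective (A := V.CoordinateRing) f
  have hb0 : b ≠ 0 := nonZeroDivisors.ne_zero hb
  have hb1 : algebraMap V.CoordinateRing V.FunctionField b ≠ 0 :=
    fun h => hb0 (IsFractionRing.injective V.CoordinateRing V.FunctionField (by rw [h, map_zero]))
  have ha0 : a ≠ 0 := by
    rintro rfl
    rw [map_zero, zero_div] at hab
    exact hf hab.symm
  have hc : lead b / lead a ≠ 0 := div_ne_zero (lead_ne_zero hb0) (lead_ne_zero ha0)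
  refine ⟨lead b / lead a, hc, algebraMap F _ (lead b / lead a) * a, b,
    mul_ne_zero ?_ ha0, hb0, ?_, ?_⟩
  · intro h
    have := congrArg lead h
    rw [lead_algebraMap] at this
    exact hc (by simpa [lead, inftyPoly_eq_zero.mpr] using this)
  · rw [map_mul, ← hab]
    field_simp
  · rw [lead_mul, lead_algebraMap, div_mul_cancel₀ _ (lead_ne_zero ha0)]

end Infinity

/-! ### Values of rational functions -/

section Values

variable {F : Type*} [Field F] {V : WeierstrassCurve.Affine F}

lemma hasValueAt_algebraMap {x y : F} (h : V.Nonsingular x y) (a : V.CoordinateRing) :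
    HasValueAt (algebraMap V.CoordinateRing V.FunctionField a) (.some x y h)
      (AdjoinRoot.evalEval h.1 a) :=
  ⟨a, 1, by simp, by simp, by simp⟩

lemma HasValueAt.ne_zero {f : V.FunctionField} {P : V.Point} {v : F} (h : HasValueAt f P v) :
    P ≠ 0 := by
  rintro rfl
  exact h

lemma HasValueAt.unique {f : V.FunctionField} {P : V.Point} {v w : F} (hv : HasValueAt f P v)
    (hw : HasValueAt f P w) : v = w := by
  rcases P with _ | ⟨x, y, h⟩
  · exact hv.elim
  obtain ⟨a, b, hb, hab, rfl⟩ := hv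
  obtain ⟨a', b', hb', hab', rfl⟩ := hw
  have h3 : a * b' = a' * b := by
    apply IsFractionRing.injective V.CoordinateRing V.FunctionField
    rw [map_mul, map_mul, ← hab, ← hab']
    ring
  have h4 := congrArg (AdjoinRoot.evalEval h.1) h3
  rw [map_mul, map_mul] at h4
  rw [div_eq_div_iff hb hb', h4]

lemma HasValueAt.mul {f g : V.FunctionField} {P : V.Point} {v w : F} (hv : HasValueAt f P v)
    (hw : HasValueAt g P w) : HasValueAt (f * g) P (v * w) := by
  rcases P with _ | ⟨x, y, h⟩
  · exact hv.elim
  obtain ⟨a, b, hb, hab, rfl⟩ := hv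
  obtain ⟨a', b', hb', hab', rfl⟩ := hw
  refine ⟨a * a', b * b', ?_, ?_, ?_⟩
  · rw [map_mul]
    exact mul_ne_zero hb hb'
  · rw [map_mul, map_mul, ← hab, ← hab']
    ring
  · rw [map_mul, map_mul, div_mul_div_comm]

lemma HasValueAt.add {f g : V.FunctionField} {P : V.Point} {v w : F} (hv : HasValueAt f P v)
    (hw : HasValueAt g P w) : HasValueAt (f + g) P (v + w) := by
  rcases P with _ | ⟨x, y, h⟩
  · exact hv.elim
  obtain ⟨a, b, hb, hab, rfl⟩ := hv
  obtain ⟨a', b', hb', hab', rfl⟩ := hw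
  refine ⟨a * b' + b * a', b * b', ?_, ?_, ?_⟩
  · rw [map_mul]
    exact mul_ne_zero hb hb'
  · rw [map_mul, map_add, map_mul, map_mul, ← hab, ← hab']
    ring
  · rw [map_mul, map_add, map_mul, map_mul, div_add_div _ _ hb hb']

lemma HasValueAt.inv {f : V.FunctionField} {P : V.Point} {v : F} (hv : HasValueAt f P v)
    (h0 : v ≠ 0) : HasValueAt f⁻¹ P v⁻¹ := by
  rcases P with _ | ⟨x, y, h⟩
  · exact hv.elim
  obtain ⟨a, b, hb, hab, rfl⟩ := hv
  have ha : AdjoinRoot.evalEval h.1 a ≠ 0 := fun h => h0 (by rw [h, zero_div])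
  refine ⟨b, a, ha, ?_, by rw [inv_div]⟩
  have hf : f ≠ 0 := by
    rintro rfl
    rw [zero_mul] at hab
    have : a = 0 :=
      IsFractionRing.injective V.CoordinateRing V.FunctionField (by rw [← hab, map_zero])
    rw [this, map_zero] at ha
    exact ha rfl
  rw [← hab, ← mul_assoc, inv_mul_cancel₀ hf, one_mul]

lemma evalEval_mk {x y : F} (h : V.Equation x y) (g : Polynomial (Polynomial F)) :
    AdjoinRoot.evalEval h (CoordinateRing.mk V g) = g.evalEval x y :=
  AdjoinRoot.evalEval_mk h g

lemma evalEval_algebraMap {x y : F} (h : V.Equation x y) (c : F) :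
    AdjoinRoot.evalEval h (algebraMap F V.CoordinateRing c) = c :=
  (evalEval_mk h (Polynomial.C (Polynomial.C c))).trans (by simp)

lemma hasValueAt_const {P : V.Point} (hP : P ≠ 0) (c : F) :
    HasValueAt (algebraMap V.CoordinateRing V.FunctionField (algebraMap F _ c)) P c := by
  rcases P with _ | ⟨x, y, h⟩
  · exact (hP rfl).elim
  convert hasValueAt_algebraMap h (algebraMap F _ c) using 1
  exact (evalEval_algebraMap h.1 c).symm

lemma hasValueAt_one {P : V.Point} (hP : P ≠ 0) : HasValueAt (1 : V.FunctionField) P 1 := by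
  simpa using hasValueAt_const hP 1

lemma HasValueAt.neg {f : V.FunctionField} {P : V.Point} {v : F} (hv : HasValueAt f P v) :
    HasValueAt (-f) P (-v) := by
  simpa using (hasValueAt_const hv.ne_zero (-1)).mul hv

lemma HasValueAt.sub {f g : V.FunctionField} {P : V.Point} {v w : F} (hv : HasValueAt f P v)
    (hw : HasValueAt g P w) : HasValueAt (f - g) P (v - w) := by
  rw [sub_eq_add_neg, sub_eq_add_neg]
  exact hv.add hw.neg

lemma HasValueAt.div {f g : V.FunctionField} {P : V.Point} {v w : F} (hv : HasValueAt f P v)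
    (hw : HasValueAt g P w) (h0 : w ≠ 0) : HasValueAt (f / g) P (v / w) := by
  rw [div_eq_mul_inv, div_eq_mul_inv]
  exact hv.mul (hw.inv h0)

lemma evalEval_XClass {x y : F} (h : V.Equation x y) (c : F) :
    AdjoinRoot.evalEval h (CoordinateRing.XClass V c) = x - c :=
  (evalEval_mk h _).trans (by simp [Polynomial.evalEval_C])

lemma evalEval_YClass {x y : F} (h : V.Equation x y) (p : Polynomial F) :
    AdjoinRoot.evalEval h (CoordinateRing.YClass V p) = y - p.eval x :=
  (evalEval_mk h _).trans (by simp [Polynomial.evalEval_C])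

end Values

/-! ### Divisors and their functions -/

section Divisors

variable {F : Type*} [Field F] {V : WeierstrassCurve.Affine F}

/-- The degree of a divisor, as a homomorphism. -/
def degHom : (V.Point →₀ ℤ) →+ ℤ := Finsupp.liftAddHom fun _ => AddMonoidHom.id ℤ

lemma deg_eq_degHom (D : V.Point →₀ ℤ) : deg D = degHom D := rfl

@[simp] lemma degHom_single (P : V.Point) (m : ℤ) : degHom (Finsupp.single P m) = m := by
  simp [degHom]

/-- The fractional ideal of a divisor. -/
def divIdeal (D : V.Point →₀ ℤ) : (FractionalIdeal V.CoordinateRing⁰ V.FunctionField)ˣ :=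
  D.prod fun P m => pointIdeal P ^ m

lemma divIdeal_add (D E : V.Point →₀ ℤ) : divIdeal (D + E) = divIdeal D * divIdeal E :=
  Finsupp.prod_add_index' (fun _ => zpow_zero _) (fun _ => zpow_add _)

@[simp] lemma divIdeal_single (P : V.Point) (m : ℤ) :
    divIdeal (Finsupp.single P m) = pointIdeal P ^ m :=
  Finsupp.prod_single_index (zpow_zero _)

@[simp] lemma divIdeal_zero : divIdeal (0 : V.Point →₀ ℤ) = 1 := Finsupp.prod_zero_index

lemma divIdeal_neg (D : V.Point →₀ ℤ) : divIdeal (-D) = (divIdeal D)⁻¹ := by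
  rw [eq_inv_iff_mul_eq_one, ← divIdeal_add, neg_add_cancel, divIdeal_zero]

lemma isDivOf_iff {f : V.FunctionField} {D : V.Point →₀ ℤ} : IsDivOf f D ↔ degHom D = 0 ∧
    FractionalIdeal.spanSingleton V.CoordinateRing⁰ f = (divIdeal D : FractionalIdeal _ _) :=
  Iff.rfl

lemma IsDivOf.mul {f g : V.FunctionField} {D E : V.Point →₀ ℤ} (hf : IsDivOf f D)
    (hg : IsDivOf g E) : IsDivOf (f * g) (D + E) := by
  rw [isDivOf_iff] at *
  refine ⟨by rw [map_add, hf.1, hg.1, add_zero], ?_⟩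
  rw [divIdeal_add, Units.val_mul, ← hf.2, ← hg.2, FractionalIdeal.spanSingleton_mul_spanSingleton]

lemma IsDivOf.ne_zero {f : V.FunctionField} {D : V.Point →₀ ℤ} (hf : IsDivOf f D) : f ≠ 0 := by
  rintro rfl
  have := hf.2
  rw [FractionalIdeal.spanSingleton_zero] at this
  exact (divIdeal D).ne_zero this.symm

lemma isDivOf_one : IsDivOf (1 : V.FunctionField) 0 := by
  rw [isDivOf_iff]
  simp

lemma IsDivOf.inv {f : V.FunctionField} {D : V.Point →₀ ℤ} (hf : IsDivOf f D) :
    IsDivOf f⁻¹ (-D) := by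
  have h0 := hf.ne_zero
  rw [isDivOf_iff] at *
  refine ⟨by rw [map_neg, hf.1, neg_zero], ?_⟩
  rw [divIdeal_neg, ← Units.mul_eq_one_iff_eq_inv, ← hf.2,
    FractionalIdeal.spanSingleton_mul_spanSingleton, inv_mul_cancel₀ h0,
    FractionalIdeal.spanSingleton_one]

/-- Two functions with the same divisor differ by a constant. -/
lemma IsDivOf.eq_const_mul {f g : V.FunctionField} {D : V.Point →₀ ℤ} (hf : IsDivOf f D)
    (hg : IsDivOf g D) :
    ∃ c : F, c ≠ 0 ∧ f = algebraMap V.CoordinateRing V.FunctionField (algebraMap F _ c) * g := by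
  have h : FractionalIdeal.spanSingleton V.CoordinateRing⁰ f =
    FractionalIdeal.spanSingleton V.CoordinateRing⁰ g := hf.2.trans hg.2.symm
  have h1 : f ∈ FractionalIdeal.spanSingleton V.CoordinateRing⁰ g := by
    rw [← h]
    exact FractionalIdeal.mem_spanSingleton_self _ _
  have h2 : g ∈ FractionalIdeal.spanSingleton V.CoordinateRing⁰ f := by
    rw [h]
    exact FractionalIdeal.mem_spanSingleton_self _ _
  obtain ⟨z, hz⟩ := (FractionalIdeal.mem_spanSingleton _).mp h1
  obtain ⟨w, hw⟩ := (FractionalIdeal.mem_spanSingleton _).mp h2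
  have hzw : z * w = 1 := by
    apply IsFractionRing.injective V.CoordinateRing V.FunctionField
    rw [Algebra.smul_def] at hz hw
    apply mul_right_cancel₀ hf.ne_zero
    rw [map_mul, mul_assoc, hw, hz, map_one, one_mul]
  obtain ⟨c, hc, rfl⟩ := exists_algebraMap_of_mul_eq_one hzw
  refine ⟨c, hc, ?_⟩
  rw [← hz, Algebra.smul_def]

lemma IsDivOf.const_mul {f : V.FunctionField} {D : V.Point →₀ ℤ} (hf : IsDivOf f D) {c : F}
    (hc : c ≠ 0) :
    IsDivOf (algebraMap V.CoordinateRing V.FunctionField (algebraMap F _ c) * f) D := by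
  refine ⟨hf.1, ?_⟩
  rw [← hf.2, ← FractionalIdeal.spanSingleton_mul_spanSingleton]
  have : FractionalIdeal.spanSingleton V.CoordinateRing⁰
      (algebraMap V.CoordinateRing V.FunctionField (algebraMap F _ c)) = 1 := by
    rw [← FractionalIdeal.coeIdeal_span_singleton, Ideal.span_singleton_eq_top.mpr,
      FractionalIdeal.coeIdeal_top]
    exact (IsUnit.mk0 c hc).map _
  rw [this, one_mul]

/-- The fractional ideal `I` is integral at the point `(x, y)`. -/
def IntegralAt {x y : F} (h : V.Nonsingular x y)
    (I : FractionalIdeal V.CoordinateRing⁰ V.FunctionField) : Prop :=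
  ∃ b : V.CoordinateRing, AdjoinRoot.evalEval h.1 b ≠ 0 ∧
    FractionalIdeal.spanSingleton V.CoordinateRing⁰
      (algebraMap V.CoordinateRing V.FunctionField b) * I ≤ 1

lemma IntegralAt.mul {x y : F} {h : V.Nonsingular x y}
    {I J : FractionalIdeal V.CoordinateRing⁰ V.FunctionField} (hI : IntegralAt h I)
    (hJ : IntegralAt h J) : IntegralAt h (I * J) := by
  obtain ⟨b, hb, hbI⟩ := hI
  obtain ⟨c, hc, hcJ⟩ := hJ
  refine ⟨b * c, by rw [map_mul]; exact mul_ne_zero hb hc, ?_⟩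
  rw [map_mul, ← FractionalIdeal.spanSingleton_mul_spanSingleton, mul_mul_mul_comm]
  exact mul_le_one' hbI hcJ

lemma integralAt_one {x y : F} (h : V.Nonsingular x y) :
    IntegralAt h (1 : FractionalIdeal V.CoordinateRing⁰ V.FunctionField) :=
  ⟨1, by simp, by simp⟩

lemma integralAt_pointIdeal {x y : F} (h : V.Nonsingular x y) (P : V.Point) :
    IntegralAt h (pointIdeal P : FractionalIdeal V.CoordinateRing⁰ V.FunctionField) := by
  refine ⟨1, by simp, ?_⟩
  rw [map_one, FractionalIdeal.spanSingleton_one, one_mul]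
  rcases P with _ | ⟨x', y', h'⟩
  · exact le_refl _
  · exact FractionalIdeal.coeIdeal_le_one

lemma integralAt_pointIdeal_inv {x y : F} (h : V.Nonsingular x y) {P : V.Point}
    (hP : P ≠ .some x y h) :
    IntegralAt h ((pointIdeal P)⁻¹ : (FractionalIdeal V.CoordinateRing⁰ V.FunctionField)ˣ) := by
  rcases P with _ | ⟨x', y', h'⟩
  · exact integralAt_one h
  -- a function that vanishes at `P` but not at `(x, y)` serves as a denominator
  have key : ∀ b ∈ CoordinateRing.XYIdeal V x' (Polynomial.C y'),
      AdjoinRoot.evalEval h.1 b ≠ 0 → IntegralAt h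
        ((CoordinateRing.XYIdeal' h')⁻¹ :
          (FractionalIdeal V.CoordinateRing⁰ V.FunctionField)ˣ) := by
    intro b hb hb0
    refine ⟨b, hb0, ?_⟩
    have h1 : FractionalIdeal.spanSingleton V.CoordinateRing⁰
        (algebraMap V.CoordinateRing V.FunctionField b) ≤
          (CoordinateRing.XYIdeal' h' : FractionalIdeal _ _) := by
      rw [CoordinateRing.XYIdeal'_eq, ← FractionalIdeal.coeIdeal_span_singleton,
        FractionalIdeal.coeIdeal_le_coeIdeal, Ideal.span_singleton_le_iff_mem]
      exact hb
    calc _ ≤ (CoordinateRing.XYIdeal' h' : FractionalIdeal V.CoordinateRing⁰ V.FunctionField) *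
          ((CoordinateRing.XYIdeal' h')⁻¹ :
            (FractionalIdeal V.CoordinateRing⁰ V.FunctionField)ˣ) := mul_le_mul_left h1 _
      _ ≤ 1 := by rw [Units.mul_inv]
  by_cases hx : x = x'
  · refine key (CoordinateRing.YClass V (Polynomial.C y')) (Ideal.subset_span (by simp)) ?_
    rw [evalEval_YClass, Polynomial.eval_C]
    intro hy
    apply hP
    subst hx
    rw [sub_eq_zero] at hy
    subst hy
    rfl
  · refine key (CoordinateRing.XClass V x') (Ideal.subset_span (by simp)) ?_
    rw [evalEval_XClass]
    exact sub_ne_zero.mpr hx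

lemma integralAt_divIdeal {x y : F} (h : V.Nonsingular x y) (D : V.Point →₀ ℤ)
    (hD : Point.some x y h ∉ D.support) :
    IntegralAt h (divIdeal D : FractionalIdeal V.CoordinateRing⁰ V.FunctionField) := by
  have hpow : ∀ (I : FractionalIdeal V.CoordinateRing⁰ V.FunctionField) (m : ℕ),
      IntegralAt h I → IntegralAt h (I ^ m) := by
    intro I m hI
    induction m with
    | zero => simpa using integralAt_one h
    | succ m ih => rw [pow_succ]; exact ih.mul hI
  rw [divIdeal, Finsupp.prod, Units.coe_prod]
  apply Finset.prod_induction _ (IntegralAt h) (fun _ _ => IntegralAt.mul) (integralAt_one h)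
  intro P hP
  have hP' : P ≠ .some x y h := by
    rintro rfl
    exact hD hP
  obtain ⟨m, hm | hm⟩ := Int.eq_nat_or_neg (D P)
  · rw [hm, zpow_natCast, Units.val_pow_eq_pow_val]
    exact hpow _ _ (integralAt_pointIdeal h P)
  · rw [hm, zpow_neg, zpow_natCast, ← inv_pow, Units.val_pow_eq_pow_val]
    exact hpow _ _ (integralAt_pointIdeal_inv h hP')

/-- A function has a value, different from zero, at every affine point outside its divisor. -/
lemma IsDivOf.exists_hasValueAt {f : V.FunctionField} {D : V.Point →₀ ℤ} (hf : IsDivOf f D)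
    {P : V.Point} (hP0 : P ≠ 0) (hP : P ∉ D.support) : ∃ v : Fˣ, HasValueAt f P v := by
  rcases P with _ | ⟨x, y, h⟩
  · exact (hP0 rfl).elim
  have key : ∀ (g : V.FunctionField) (E : V.Point →₀ ℤ), IsDivOf g E →
      Point.some x y h ∉ E.support → ∃ v : F, HasValueAt g (.some x y h) v := by
    intro g E hg hE
    obtain ⟨b, hb, hbI⟩ := integralAt_divIdeal h E hE
    rw [← (isDivOf_iff.mp hg).2, FractionalIdeal.spanSingleton_mul_spanSingleton] at hbI
    have h1 := hbI (FractionalIdeal.mem_spanSingleton_self _ _)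
    obtain ⟨a, ha⟩ := (FractionalIdeal.mem_one_iff _).mp h1
    exact ⟨_, a, b, hb, by rw [ha, mul_comm], rfl⟩
  obtain ⟨v, hv⟩ := key f D hf hP
  obtain ⟨w, hw⟩ := key f⁻¹ (-D) hf.inv (by rwa [Finsupp.support_neg])
  have hvw : v * w = 1 := by
    have h1 := hv.mul hw
    rw [mul_inv_cancel₀ hf.ne_zero] at h1
    exact h1.unique (hasValueAt_one hP0)
  exact ⟨Units.mkOfMulEqOne v w hvw, hv⟩

/-- `f` is the monic function with divisor `D`. -/
def IsFn (f : V.FunctionField) (D : V.Point →₀ ℤ) : Prop := IsMonicFn f ∧ IsDivOf f D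

lemma IsFn.mul {f g : V.FunctionField} {D E : V.Point →₀ ℤ} (hf : IsFn f D) (hg : IsFn g E) :
    IsFn (f * g) (D + E) := ⟨hf.1.mul hg.1, hf.2.mul hg.2⟩

lemma IsFn.unique {f g : V.FunctionField} {D : V.Point →₀ ℤ} (hf : IsFn f D) (hg : IsFn g D) :
    f = g := by
  obtain ⟨c, -, h⟩ := hf.2.eq_const_mul hg.2
  exact hf.1.eq_one_of_const hg.1 h

open Classical in
/-- The value at `P` of the monic function with divisor `D`, if there is such a function and it
has a value different from zero at `P`; otherwise `1`. In particular `ev D 0 = 1`, which accounts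
for the point at infinity when monic functions are evaluated at divisors. -/
def ev (D : V.Point →₀ ℤ) (P : V.Point) : Fˣ :=
  if h : ∃ v : Fˣ, ∃ f, IsFn f D ∧ HasValueAt f P v then h.choose else 1

lemma IsFn.ev_eq {f : V.FunctionField} {D : V.Point →₀ ℤ} (hf : IsFn f D) {P : V.Point} {v : Fˣ}
    (hv : HasValueAt f P v) : ev D P = v := by
  have h : ∃ v : Fˣ, ∃ f, IsFn f D ∧ HasValueAt f P v := ⟨v, f, hf, hv⟩
  rw [ev, dif_pos h]
  obtain ⟨g, hg, hgv⟩ := h.choose_spec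
  rw [hg.unique hf] at hgv
  exact Units.ext (hgv.unique hv)

@[simp] lemma ev_zero_right (D : V.Point →₀ ℤ) : ev D 0 = 1 := by
  rw [ev, dif_neg]
  rintro ⟨v, f, -, h⟩
  exact h

@[simp] lemma ev_zero_left (P : V.Point) : ev 0 P = 1 := by
  by_cases hP : P = 0
  · rw [hP, ev_zero_right]
  · exact IsFn.ev_eq (f := 1) ⟨isMonicFn_one, isDivOf_one⟩ (by simpa using hasValueAt_one hP)

variable [DecidableEq F]

/-- The sum of a divisor in the group of points. -/
def ptSum : (V.Point →₀ ℤ) →+ V.Point := Finsupp.liftAddHom fun P => zmultiplesHom _ P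

@[simp] lemma ptSum_single (P : V.Point) (m : ℤ) : ptSum (Finsupp.single P m) = m • P := by
  simp [ptSum]

lemma mk_pointIdeal (P : V.Point) :
    ClassGroup.mk V.FunctionField (pointIdeal P) = (Point.toClass P).toMul := by
  rcases P with _ | ⟨x, y, h⟩
  · exact map_one _
  · rfl

lemma mk_divIdeal (D : V.Point →₀ ℤ) :
    ClassGroup.mk V.FunctionField (divIdeal D) = (Point.toClass (ptSum D)).toMul := by
  induction D using Finsupp.induction_linear with
  | zero => simp
  | add D E hD hE => rw [divIdeal_add, map_mul, hD, hE, map_add, map_add, toMul_add]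
  | single P m =>
    rw [divIdeal_single, map_zpow, mk_pointIdeal, ptSum_single, map_zsmul, toMul_zsmul]

/-- The divisor of a function has sum zero. -/
lemma IsDivOf.ptSum_eq_zero {f : V.FunctionField} {D : V.Point →₀ ℤ} (hf : IsDivOf f D) :
    ptSum D = 0 := by
  rw [← Point.toClass_eq_zero]
  apply Additive.toMul.injective
  rw [← mk_divIdeal, toMul_zero, ClassGroup.mk_eq_one_iff, ← (isDivOf_iff.mp hf).2]
  exact ⟨f, FractionalIdeal.coe_spanSingleton _ _⟩

/-- `D` has degree zero and sum zero. -/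
def IsPrin (D : V.Point →₀ ℤ) : Prop := degHom D = 0 ∧ ptSum D = 0

lemma IsPrin.neg {D : V.Point →₀ ℤ} (hD : IsPrin D) : IsPrin (-D) :=
  ⟨by rw [map_neg, hD.1, neg_zero], by rw [map_neg, hD.2, neg_zero]⟩

/-- A divisor of degree zero and sum zero is principal. -/
lemma IsPrin.exists_isFn {D : V.Point →₀ ℤ} (hD : IsPrin D) : ∃ f, IsFn f D := by
  have h1 : ClassGroup.mk V.FunctionField (divIdeal D) = 1 := by
    rw [mk_divIdeal, hD.2, map_zero, toMul_zero]
  rw [ClassGroup.mk_eq_one_iff] at h1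
  obtain ⟨f, hf⟩ := h1
  have hf' : IsDivOf f D := by
    refine isDivOf_iff.mpr ⟨hD.1, ?_⟩
    apply FractionalIdeal.coeToSubmodule_injective
    exact (FractionalIdeal.coe_spanSingleton _ _).trans hf.symm
  obtain ⟨c, hc, hm⟩ := exists_const_mul_isMonicFn hf'.ne_zero
  exact ⟨_, hm, hf'.const_mul hc⟩

lemma IsPrin.exists_ev {D : V.Point →₀ ℤ} (hD : IsPrin D) {P : V.Point} (hP0 : P ≠ 0)
    (hP : P ∉ D.support) : ∃ f, IsFn f D ∧ HasValueAt f P (ev D P) := by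
  obtain ⟨f, hf⟩ := hD.exists_isFn
  obtain ⟨v, hv⟩ := hf.2.exists_hasValueAt hP0 hP
  exact ⟨f, hf, by rwa [hf.ev_eq hv]⟩

lemma ev_add {D E : V.Point →₀ ℤ} (hD : IsPrin D) (hE : IsPrin E) {P : V.Point}
    (hPD : P ∉ D.support) (hPE : P ∉ E.support) : ev (D + E) P = ev D P * ev E P := by
  by_cases hP : P = 0
  · simp [hP]
  obtain ⟨f, hf, hfv⟩ := hD.exists_ev hP hPD
  obtain ⟨g, hg, hgv⟩ := hE.exists_ev hP hPE
  exact (hf.mul hg).ev_eq (by simpa using hfv.mul hgv)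

lemma ev_neg {D : V.Point →₀ ℤ} (hD : IsPrin D) {P : V.Point} (hPD : P ∉ D.support) :
    ev (-D) P = (ev D P)⁻¹ := by
  rw [eq_inv_iff_mul_eq_one, ← ev_add hD.neg hD (by rwa [Finsupp.support_neg]) hPD, neg_add_cancel,
    ev_zero_left]

end Divisors

/-! ### The functions `r_{A,B}` -/

section RFunctions

variable {F : Type*} [Field F] {V : WeierstrassCurve.Affine F}

lemma isDivOf_div {a b : V.CoordinateRing} (hb : b ≠ 0) {D : V.Point →₀ ℤ} (hD : degHom D = 0)
    {I J : (FractionalIdeal V.CoordinateRing⁰ V.FunctionField)ˣ} (hIJ : divIdeal D = J * I⁻¹)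
    (h : FractionalIdeal.spanSingleton V.CoordinateRing⁰
        (algebraMap V.CoordinateRing V.FunctionField b) * (J : FractionalIdeal _ _) =
      FractionalIdeal.spanSingleton V.CoordinateRing⁰
        (algebraMap V.CoordinateRing V.FunctionField a) * (I : FractionalIdeal _ _)) :
    IsDivOf (algebraMap V.CoordinateRing V.FunctionField a /
      algebraMap V.CoordinateRing V.FunctionField b) D := by
  have hb1 : algebraMap V.CoordinateRing V.FunctionField b ≠ 0 :=
    fun h => hb (IsFractionRing.injective V.CoordinateRing V.FunctionField (by rw [h, map_zero]))
  refine isDivOf_iff.mpr ⟨hD, ?_⟩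
  rw [hIJ, Units.val_mul, Units.eq_mul_inv_iff_mul_eq]
  have h1 : FractionalIdeal.spanSingleton V.CoordinateRing⁰
        (algebraMap V.CoordinateRing V.FunctionField b)⁻¹ *
      FractionalIdeal.spanSingleton V.CoordinateRing⁰
        (algebraMap V.CoordinateRing V.FunctionField b) = 1 := by
    rw [FractionalIdeal.spanSingleton_mul_spanSingleton, inv_mul_cancel₀ hb1,
      FractionalIdeal.spanSingleton_one]
  rw [div_eq_inv_mul, ← FractionalIdeal.spanSingleton_mul_spanSingleton, mul_assoc, ← h,
    ← mul_assoc, h1, one_mul]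

variable [DecidableEq F]

/-- The divisor `(A) + (B) - (A + B) - (O)` of the function `r_{A,B}`. -/
def rDiv (A B : V.Point) : V.Point →₀ ℤ :=
  Finsupp.single A 1 + Finsupp.single B 1 - Finsupp.single (A + B) 1 - Finsupp.single 0 1

@[simp] lemma rDiv_zero_left (B : V.Point) : rDiv 0 B = 0 := by
  simp [rDiv]

@[simp] lemma rDiv_zero_right (A : V.Point) : rDiv A 0 = 0 := by
  simp [rDiv]

lemma isPrin_rDiv (A B : V.Point) : IsPrin (rDiv A B) := by
  refine ⟨?_, ?_⟩
  · simp only [rDiv, map_sub, map_add, degHom_single]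
    norm_num
  · simp only [rDiv, map_sub, map_add, ptSum_single]
    simp

lemma notMem_support_rDiv {A B P : V.Point} (h0 : P ≠ 0) (hA : P ≠ A) (hB : P ≠ B)
    (hAB : P ≠ A + B) : P ∉ (rDiv A B).support := by
  simp [rDiv, h0.symm, hA.symm, hB.symm, hAB.symm]

lemma isFn_XClass {x y : F} (h : V.Nonsingular x y) :
    IsFn (algebraMap V.CoordinateRing V.FunctionField (CoordinateRing.XClass V x))
      (rDiv (Point.some x y h) (-Point.some x y h)) := by
  refine ⟨isMonicFn_algebraMap (lead_XClass x), isDivOf_iff.mpr ⟨(isPrin_rDiv _ _).1, ?_⟩⟩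
  rw [rDiv, add_neg_cancel, sub_eq_add_neg, sub_eq_add_neg, divIdeal_add, divIdeal_add,
    divIdeal_add, divIdeal_neg, divIdeal_single, divIdeal_single, divIdeal_single, zpow_one,
    zpow_one, zpow_one]
  have h0 : pointIdeal (0 : V.Point) = 1 := rfl
  rw [h0, inv_one, mul_one, mul_one, Units.val_mul, mul_comm]
  change _ = ((CoordinateRing.XYIdeal V x (Polynomial.C (V.negY x y)) : Ideal V.CoordinateRing) :
      FractionalIdeal V.CoordinateRing⁰ V.FunctionField) *
    ((CoordinateRing.XYIdeal V x (Polynomial.C y) : Ideal V.CoordinateRing) :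
      FractionalIdeal V.CoordinateRing⁰ V.FunctionField)
  rw [← FractionalIdeal.coeIdeal_mul,
    CoordinateRing.XYIdeal_neg_mul h, CoordinateRing.XIdeal, FractionalIdeal.coeIdeal_span_singleton]

/-- The line through two points divided by the vertical line through their sum has the expected
divisor. -/
lemma isFn_line {x₁ y₁ x₂ y₂ : F} (h₁ : V.Nonsingular x₁ y₁) (h₂ : V.Nonsingular x₂ y₂)
    (hxy : ¬(x₁ = x₂ ∧ y₁ = V.negY x₂ y₂)) :
    IsFn (algebraMap V.CoordinateRing V.FunctionField
        (CoordinateRing.YClass V (linePolynomial x₁ y₁ (V.slope x₁ x₂ y₁ y₂))) /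
      algebraMap V.CoordinateRing V.FunctionField
        (CoordinateRing.XClass V (V.addX x₁ x₂ (V.slope x₁ x₂ y₁ y₂))))
      (rDiv (Point.some x₁ y₁ h₁) (Point.some x₂ y₂ h₂)) := by
  constructor
  · rw [div_eq_mul_inv]
    exact (isMonicFn_algebraMap (lead_YClass_linePolynomial _ _ _)).mul
      (isMonicFn_algebraMap (lead_XClass _)).inv
  · apply isDivOf_div (CoordinateRing.XClass_ne_zero _) (isPrin_rDiv _ _).1
      (J := pointIdeal (Point.some x₁ y₁ h₁) * pointIdeal (Point.some x₂ y₂ h₂))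
      (I := pointIdeal (Point.some x₁ y₁ h₁ + Point.some x₂ y₂ h₂))
    · rw [rDiv, sub_eq_add_neg, sub_eq_add_neg, divIdeal_add, divIdeal_add,
        divIdeal_add, divIdeal_neg, divIdeal_neg, divIdeal_single, divIdeal_single,
        divIdeal_single, divIdeal_single, zpow_one, zpow_one, zpow_one, zpow_one]
      have h0 : pointIdeal (0 : V.Point) = 1 := rfl
      rw [h0, inv_one, mul_one]
    · rw [Point.add_some hxy]
      have h := congrArg (fun I : Ideal V.CoordinateRing =>
        (I : FractionalIdeal V.CoordinateRing⁰ V.FunctionField))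
          (CoordinateRing.XYIdeal_mul_XYIdeal h₁.1 h₂.1 hxy)
      simp only [FractionalIdeal.coeIdeal_mul, CoordinateRing.XIdeal, CoordinateRing.YIdeal,
        FractionalIdeal.coeIdeal_span_singleton] at h
      exact h

/-- The value of the monic function with divisor `(A) + (B) - (A + B) - (O)` is given by `rVal`. -/
lemma ev_rDiv {A B P : V.Point} (h0 : P ≠ 0) (hA : P ≠ A) (hB : P ≠ B)
    (hAB : P ≠ A + B) (hAB' : P ≠ -(A + B)) : (ev (rDiv A B) P : F) = rVal A B P := by
  rw [rVal]
  split_ifs with h1 h2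
  · rcases h1 with rfl | rfl <;> simp
  · obtain ⟨f, hf, hv⟩ := (isPrin_rDiv A B).exists_ev h0 (notMem_support_rDiv h0 hA hB hAB)
    rw [not_or] at h1
    obtain rfl : B = -A := (neg_eq_of_add_eq_zero_right h2).symm
    rcases A with _ | ⟨x, y, h⟩
    · exact (h1.1 rfl).elim
    rcases P with _ | ⟨x', y', h'⟩
    · exact (h0 rfl).elim
    rw [hf.unique (isFn_XClass h)] at hv
    refine hv.unique ?_
    convert hasValueAt_algebraMap h' _ using 1
    exact (evalEval_XClass h'.1 x).symm
  · obtain ⟨f, hf, hv⟩ := (isPrin_rDiv A B).exists_ev h0 (notMem_support_rDiv h0 hA hB hAB)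
    rw [not_or] at h1
    rcases A with _ | ⟨x₁, y₁, h₁⟩
    · exact (h1.1 rfl).elim
    rcases B with _ | ⟨x₂, y₂, h₂⟩
    · exact (h1.2 rfl).elim
    rcases P with _ | ⟨x, y, h⟩
    · exact (h0 rfl).elim
    have hxy : ¬(x₁ = x₂ ∧ y₁ = V.negY x₂ y₂) := fun hxy => h2 (Point.add_of_Y_eq hxy.1 hxy.2)
    rw [hf.unique (isFn_line h₁ h₂ hxy)] at hv
    refine hv.unique ?_
    rw [Point.add_some hxy] at hAB hAB' ⊢
    have hx : x - V.addX x₁ x₂ (V.slope x₁ x₂ y₁ y₂) ≠ 0 := by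
      intro hx
      rw [sub_eq_zero] at hx
      rcases Point.X_eq_iff.mp hx with h3 | h3
      · exact hAB h3
      · exact hAB' h3
    have hX := hasValueAt_algebraMap h (CoordinateRing.XClass V
      (V.addX x₁ x₂ (V.slope x₁ x₂ y₁ y₂)))
    have hY := hasValueAt_algebraMap h (CoordinateRing.YClass V
      (linePolynomial x₁ y₁ (V.slope x₁ x₂ y₁ y₂)))
    rw [evalEval_XClass] at hX
    rw [evalEval_YClass] at hY
    convert hY.div hX hx using 1
    rw [Point.neg_some]
    simp only [xc, yc, linePolynomial, addY, negY_negY, negAddY, Polynomial.eval_add,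
      Polynomial.eval_mul, Polynomial.eval_sub, Polynomial.eval_C, Polynomial.eval_X]
    rw [eq_div_iff hx, sub_mul, div_mul_cancel₀ _ hx]
    ring

lemma rDiv_cocycle (A B C : V.Point) :
    rDiv A B + rDiv (A + B) C = rDiv A (B + C) + rDiv B C := by
  simp only [rDiv, add_assoc]
  abel

lemma rVal_ne_zero {A B P : V.Point} (h0 : P ≠ 0) (hA : P ≠ A) (hB : P ≠ B)
    (hAB : P ≠ A + B) (hAB' : P ≠ -(A + B)) : rVal A B P ≠ 0 := by
  rw [← ev_rDiv h0 hA hB hAB hAB']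
  exact Units.ne_zero _

lemma rVal_comm (A B P : V.Point) : rVal A B P = rVal B A P := by
  rw [rVal, rVal, add_comm B A]
  by_cases h1 : A = 0 ∨ B = 0
  · rw [if_pos h1, if_pos (Or.comm.mp h1)]
  rw [if_neg h1, if_neg (fun h => h1 (Or.comm.mp h))]
  by_cases h2 : A + B = 0
  · rw [if_pos h2, if_pos h2]
    obtain rfl : B = -A := (neg_eq_of_add_eq_zero_right h2).symm
    rcases A with _ | ⟨x, y, h⟩ <;> rfl
  rw [if_neg h2, if_neg h2]
  congr 1
  rcases A with _ | ⟨x₁, y₁, h₁⟩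
  · exact (h1 (Or.inl rfl)).elim
  rcases B with _ | ⟨x₂, y₂, h₂⟩
  · exact (h1 (Or.inr rfl)).elim
  have hxy : ¬(x₁ = x₂ ∧ y₁ = V.negY x₂ y₂) := fun hxy => h2 (Point.add_of_Y_eq hxy.1 hxy.2)
  simp only [xc, yc]
  by_cases hx : x₁ = x₂
  · subst hx
    have hy : y₁ = y₂ := Y_eq_of_Y_ne h₁.1 h₂.1 rfl fun h => hxy ⟨rfl, h⟩
    rw [hy]
  · rw [slope_of_X_ne hx, slope_of_X_ne (Ne.symm hx), ← neg_div_neg_eq, neg_sub, neg_sub]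

/-- The cocycle identity, read off from divisors. -/
lemma rVal_cocycle {A B C P : V.Point} (h0 : P ≠ 0) (hA : P ≠ A) (hB : P ≠ B) (hC : P ≠ C)
    (hAB : P ≠ A + B) (hAB' : P ≠ -(A + B)) (hBC : P ≠ B + C) (hBC' : P ≠ -(B + C))
    (hABC : P ≠ A + B + C) (hABC' : P ≠ -(A + B + C)) :
    rVal A B P * rVal (A + B) C P = rVal A (B + C) P * rVal B C P := by
  have h := congrArg (fun D => (ev D P : F)) (rDiv_cocycle A B C)
  have h3 : P ≠ A + (B + C) := by rwa [← add_assoc]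
  have h3' : P ≠ -(A + (B + C)) := by rwa [← add_assoc]
  rw [ev_add (isPrin_rDiv _ _) (isPrin_rDiv _ _) (notMem_support_rDiv h0 hA hB hAB)
      (notMem_support_rDiv h0 hAB hC hABC),
    ev_add (isPrin_rDiv _ _) (isPrin_rDiv _ _) (notMem_support_rDiv h0 hA hBC h3)
      (notMem_support_rDiv h0 hB hC hBC), Units.val_mul, Units.val_mul,
    ev_rDiv h0 hA hB hAB hAB', ev_rDiv h0 hAB hC hABC hABC', ev_rDiv h0 hA hBC h3 h3',
    ev_rDiv h0 hB hC hBC hBC'] at h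
  exact h

end RFunctions

/-! ### The symmetry of `r_{A,B}(-C)` -/

section Symmetry

variable {F : Type*} [Field F] {V : WeierstrassCurve.Affine F} [DecidableEq F]

lemma rVal_some {x₁ y₁ x₂ y₂ x y : F} {h₁ : V.Nonsingular x₁ y₁} {h₂ : V.Nonsingular x₂ y₂}
    {h : V.Nonsingular x y} (hxy : ¬(x₁ = x₂ ∧ y₁ = V.negY x₂ y₂))
    (hx : x ≠ V.addX x₁ x₂ (V.slope x₁ x₂ y₁ y₂)) :
    rVal (Point.some x₁ y₁ h₁) (.some x₂ y₂ h₂) (.some x y h) *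
      (x - V.addX x₁ x₂ (V.slope x₁ x₂ y₁ y₂)) = y - y₁ - V.slope x₁ x₂ y₁ y₂ * (x - x₁) := by
  have h0 : Point.some x₁ y₁ h₁ + Point.some x₂ y₂ h₂ ≠ 0 := by
    rw [Point.add_some hxy]
    exact Point.some_ne_zero _
  rw [rVal, if_neg (by rw [not_or]; exact ⟨Point.some_ne_zero _, Point.some_ne_zero _⟩),
    if_neg h0, Point.add_some hxy, Point.neg_some, sub_mul]
  simp only [xc, yc]
  rw [div_mul_cancel₀ _ (sub_ne_zero.mpr hx), addY, negY_negY, negAddY]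
  ring

lemma rVal_neg_some {x₁ y₁ x₂ y₂ x y : F} {h₁ : V.Nonsingular x₁ y₁} {h₂ : V.Nonsingular x₂ y₂}
    {h : V.Nonsingular x y} (hxy : ¬(x₁ = x₂ ∧ y₁ = V.negY x₂ y₂))
    (hx : x ≠ V.addX x₁ x₂ (V.slope x₁ x₂ y₁ y₂)) :
    rVal (Point.some x₁ y₁ h₁) (.some x₂ y₂ h₂) (-.some x y h) *
      (y - y₁ - V.slope x₁ x₂ y₁ y₂ * (x - x₁)) = -((x - x₁) * (x - x₂)) := by
  have h1 := rVal_some (h₁ := h₁) (h₂ := h₂) (h := (nonsingular_neg ..).mpr h) hxy hx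
  have h2 := congrArg (Polynomial.eval x) (addPolynomial_slope h₁.1 h₂.1 hxy)
  rw [addPolynomial_eq] at h2
  have h3 := (equation_iff ..).mp h.1
  simp only [Cubic.toPoly, Polynomial.eval_neg, Polynomial.eval_add, Polynomial.eval_mul,
    Polynomial.eval_sub, Polynomial.eval_pow, Polynomial.eval_C, Polynomial.eval_X] at h2
  rw [Point.neg_some]
  apply mul_right_cancel₀ (sub_ne_zero.mpr hx)
  rw [mul_right_comm, h1, negY]
  linear_combination h2 - h3

lemma xc_ne_of_ne {x₁ y₁ x₂ y₂ : F} {h₁ : V.Nonsingular x₁ y₁} {h₂ : V.Nonsingular x₂ y₂}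
    (h : Point.some x₁ y₁ h₁ ≠ .some x₂ y₂ h₂) (h' : Point.some x₁ y₁ h₁ + .some x₂ y₂ h₂ ≠ 0) :
    x₁ ≠ x₂ := by
  intro hx
  rcases Point.X_eq_iff.mp hx with h3 | h3
  · exact h h3
  · exact h' (by rw [h3, neg_add_cancel])

/-- The tangent case of the symmetry. -/
lemma rVal_self_neg {A C : V.Point} (hA : A ≠ 0) (hC : C ≠ 0) (hAA : A + A ≠ 0) (hAC : A + C ≠ 0)
    (hAC' : C ≠ A) (hAAC : A + A + C ≠ 0) (hC2 : C ≠ A + A) :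
    rVal A A (-C) = rVal A C (-A) := by
  rcases A with _ | ⟨x₁, y₁, h₁⟩
  · exact (hA rfl).elim
  rcases C with _ | ⟨x, y, h⟩
  · exact (hC rfl).elim
  have hxx : x ≠ x₁ := xc_ne_of_ne hAC' (by rwa [add_comm])
  have hxy : ¬(x₁ = x₁ ∧ y₁ = V.negY x₁ y₁) := fun hxy => hAA (Point.add_of_Y_eq hxy.1 hxy.2)
  have hxy' : ¬(x₁ = x ∧ y₁ = V.negY x y) := fun hxy => hAC (Point.add_of_Y_eq hxy.1 hxy.2)
  have e1 : x ≠ V.addX x₁ x₁ (V.slope x₁ x₁ y₁ y₁) := by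
    rw [Point.add_some hxy] at hC2 hAAC
    exact xc_ne_of_ne hC2 (by rwa [add_comm])
  have e2 : x₁ ≠ V.addX x₁ x (V.slope x₁ x y₁ y) := by
    have e3 : Point.some x₁ y₁ h₁ ≠ Point.some x₁ y₁ h₁ + Point.some x y h :=
      fun e => hC (by simpa using e.symm)
    rw [add_assoc] at hAAC
    rw [Point.add_some hxy'] at hAAC e3
    exact xc_ne_of_ne e3 hAAC
  have h1 := rVal_neg_some (h₁ := h₁) (h₂ := h₁) (h := h) hxy e1
  have h2 := rVal_some (h₁ := h₁) (h₂ := h) (h := (nonsingular_neg ..).mpr h₁) hxy' e2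
  rw [Point.neg_some]
  rw [Point.neg_some] at h1 ⊢
  have q1 := (equation_iff ..).mp h₁.1
  have q2 := (equation_iff ..).mp h.1
  have hη : y₁ - V.negY x₁ y₁ ≠ 0 := sub_ne_zero.mpr fun e => hxy ⟨rfl, e⟩
  have s1 : V.slope x₁ x₁ y₁ y₁ * (y₁ - V.negY x₁ y₁) =
      3 * x₁ ^ 2 + 2 * V.a₂ * x₁ + V.a₄ - V.a₁ * y₁ := by
    rw [slope_of_Y_ne rfl (fun e => hxy ⟨rfl, e⟩), div_mul_cancel₀ _ hη]
  have s2 : V.slope x₁ x y₁ y * (x₁ - x) = y₁ - y := by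
    rw [slope_of_X_ne hxx.symm, div_mul_cancel₀ _ (sub_ne_zero.mpr hxx.symm)]
  set l := V.slope x₁ x₁ y₁ y₁
  set m := V.slope x₁ x y₁ y
  set r := rVal (Point.some x₁ y₁ h₁) (.some x₁ y₁ h₁) (.some x (V.negY x y) _)
  have ht : y - y₁ - l * (x - x₁) ≠ 0 := by
    intro ht
    rw [ht, mul_zero, eq_comm, neg_eq_zero, mul_self_eq_zero] at h1
    exact hxx (sub_eq_zero.mp h1)
  apply mul_right_cancel₀ ht
  rw [h1]
  apply mul_right_cancel₀ (sub_ne_zero.mpr e2)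
  rw [mul_right_comm, h2]
  simp only [addX, negY, sub_self, mul_zero, sub_zero] at s1 ⊢
  linear_combination (-(x - x₁)) * s1 - q1 + q2 +
    (m * (x₁ - x) + (y₁ - y) + V.a₁ * (x₁ - x)) * s2

/-- The quantity `r_{A,B}(-C)` is symmetric in `A`, `B` and `C`. -/
lemma rVal_neg_swap {A B C : V.Point} (hA : A ≠ 0) (hB : B ≠ 0) (hC : C ≠ 0) (hAB : A + B ≠ 0)
    (hAC : A + C ≠ 0) (hBC : B + C ≠ 0) (hABC : A + B + C ≠ 0) (h1 : C ≠ A + B) (h2 : B ≠ A + C) :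
    rVal A B (-C) = rVal A C (-B) := by
  by_cases e1 : B = C
  · rw [e1]
  by_cases e2 : A = B
  · subst e2
    exact rVal_self_neg hA hC hAB hAC (Ne.symm e1) hABC h1
  by_cases e3 : A = C
  · subst e3
    exact (rVal_self_neg hA hB hAC hAB (Ne.symm e2) (by rwa [add_right_comm]) h2).symm
  rcases A with _ | ⟨x₁, y₁, h₁⟩
  · exact (hA rfl).elim
  rcases B with _ | ⟨x₂, y₂, h₂⟩
  · exact (hB rfl).elim
  rcases C with _ | ⟨x, y, h⟩
  · exact (hC rfl).elim
  have n1 : x₁ ≠ x₂ := xc_ne_of_ne e2 hAB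
  have n2 : x₁ ≠ x := xc_ne_of_ne e3 hAC
  have n3 : x₂ ≠ x := xc_ne_of_ne e1 hBC
  have hxy : ¬(x₁ = x₂ ∧ y₁ = V.negY x₂ y₂) := fun h => n1 h.1
  have hxy' : ¬(x₁ = x ∧ y₁ = V.negY x y) := fun h => n2 h.1
  have m1 : x ≠ V.addX x₁ x₂ (V.slope x₁ x₂ y₁ y₂) := by
    rw [Point.add_some hxy] at h1 hABC
    exact xc_ne_of_ne h1 (by rwa [add_comm])
  have m2 : x₂ ≠ V.addX x₁ x (V.slope x₁ x y₁ y) := by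
    rw [add_right_comm] at hABC
    rw [Point.add_some hxy'] at h2 hABC
    exact xc_ne_of_ne h2 (by rwa [add_comm])
  have g1 := rVal_neg_some (h₁ := h₁) (h₂ := h₂) (h := h) hxy m1
  have g2 := rVal_neg_some (h₁ := h₁) (h₂ := h) (h := h₂) hxy' m2
  have s1 : V.slope x₁ x₂ y₁ y₂ * (x₁ - x₂) = y₁ - y₂ := by
    rw [slope_of_X_ne n1, div_mul_cancel₀ _ (sub_ne_zero.mpr n1)]
  have s2 : V.slope x₁ x y₁ y * (x₁ - x) = y₁ - y := by
    rw [slope_of_X_ne n2, div_mul_cancel₀ _ (sub_ne_zero.mpr n2)]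
  set l := V.slope x₁ x₂ y₁ y₂
  set m := V.slope x₁ x y₁ y
  set r := rVal (Point.some x₁ y₁ h₁) (.some x₂ y₂ h₂) (-.some x y h)
  set s := rVal (Point.some x₁ y₁ h₁) (.some x y h) (-.some x₂ y₂ h₂)
  -- `d` is the determinant of `A`, `B`, `C`, which changes sign when `B` and `C` are exchanged
  have d1 : r * ((y - y₁) * (x₂ - x₁) - (y₂ - y₁) * (x - x₁)) =
      -((x - x₁) * (x - x₂) * (x₂ - x₁)) := by
    linear_combination (x₂ - x₁) * g1 - r * (x - x₁) * s1
  have d2 : s * ((y - y₁) * (x₂ - x₁) - (y₂ - y₁) * (x - x₁)) =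
      -((x - x₁) * (x - x₂) * (x₂ - x₁)) := by
    linear_combination -(x - x₁) * g2 + s * (x₂ - x₁) * s2
  have hd : (y - y₁) * (x₂ - x₁) - (y₂ - y₁) * (x - x₁) ≠ 0 := by
    intro hd
    rw [hd, mul_zero, eq_comm, neg_eq_zero] at d1
    exact mul_ne_zero (mul_ne_zero (sub_ne_zero.mpr n2.symm) (sub_ne_zero.mpr n3.symm))
      (sub_ne_zero.mpr n1.symm) d1
  exact mul_right_cancel₀ hd (d1.trans d2.symm)

lemma rVal_neg_rotate {A B C : V.Point} (hA : A ≠ 0) (hB : B ≠ 0) (hC : C ≠ 0) (hAB : A + B ≠ 0)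
    (hAC : A + C ≠ 0) (hBC : B + C ≠ 0) (hABC : A + B + C ≠ 0) (h1 : C ≠ A + B) (h2 : A ≠ B + C) :
    rVal A B (-C) = rVal B C (-A) := by
  rw [rVal_comm]
  exact rVal_neg_swap hB hA hC (by rwa [add_comm]) hBC hAC (by rwa [add_comm B]) (by rwa [add_comm])
    h2

lemma slope_neg {x₁ y₁ x₂ y₂ : F} (h₁ : V.Nonsingular x₁ y₁) (h₂ : V.Nonsingular x₂ y₂)
    (hxy : ¬(x₁ = x₂ ∧ y₁ = V.negY x₂ y₂)) :
    V.slope x₁ x₂ (V.negY x₁ y₁) (V.negY x₂ y₂) = -V.slope x₁ x₂ y₁ y₂ - V.a₁ := by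
  by_cases hx : x₁ = x₂
  · subst hx
    obtain rfl : y₁ = y₂ := Y_eq_of_Y_ne h₁.1 h₂.1 rfl fun h => hxy ⟨rfl, h⟩
    have hy : y₁ ≠ V.negY x₁ y₁ := fun h => hxy ⟨rfl, h⟩
    rw [slope_of_Y_ne rfl hy, slope_of_Y_ne rfl (by rw [negY_negY]; exact hy.symm), negY_negY]
    have hη := sub_ne_zero.mpr hy
    have hη' := sub_ne_zero.mpr hy.symm
    rw [div_eq_iff hη', sub_mul, neg_mul, ← neg_sub y₁ (V.negY x₁ y₁), mul_neg,
      div_mul_cancel₀ _ hη, negY]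
    ring
  · rw [slope_of_X_ne hx, slope_of_X_ne hx, div_eq_iff (sub_ne_zero.mpr hx), sub_mul, neg_mul,
      div_mul_cancel₀ _ (sub_ne_zero.mpr hx), negY, negY]
    ring

/-- Composition with negation turns `r_{-A,-B}` into the function with the divisor of `r_{A,B}`, and
reverses the sign of the leading coefficient. -/
lemma rVal_neg_neg {A B P : V.Point} (hA : A ≠ 0) (hB : B ≠ 0) (hAB : A + B ≠ 0) (hP : P ≠ 0)
    (h1 : P ≠ A + B) (h2 : P + (A + B) ≠ 0) : rVal (-A) (-B) (-P) = -rVal A B P := by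
  rcases A with _ | ⟨x₁, y₁, h₁⟩
  · exact (hA rfl).elim
  rcases B with _ | ⟨x₂, y₂, h₂⟩
  · exact (hB rfl).elim
  rcases P with _ | ⟨x, y, h⟩
  · exact (hP rfl).elim
  have hxy : ¬(x₁ = x₂ ∧ y₁ = V.negY x₂ y₂) := fun hxy => hAB (Point.add_of_Y_eq hxy.1 hxy.2)
  have hxy' : ¬(x₁ = x₂ ∧ V.negY x₁ y₁ = V.negY x₂ (V.negY x₂ y₂)) := by
    rintro ⟨rfl, hy⟩
    rw [negY_negY] at hy
    exact hxy ⟨rfl, by rw [← hy, negY_negY]⟩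
  rw [Point.add_some hxy] at h1 h2
  have hx := xc_ne_of_ne h1 h2
  have hs := slope_neg h₁ h₂ hxy
  have hX : V.addX x₁ x₂ (V.slope x₁ x₂ (V.negY x₁ y₁) (V.negY x₂ y₂)) =
      V.addX x₁ x₂ (V.slope x₁ x₂ y₁ y₂) := by
    rw [hs, addX, addX]
    ring
  have g1 := rVal_some (h₁ := h₁) (h₂ := h₂) (h := h) hxy hx
  have g2 := rVal_some (h₁ := (nonsingular_neg ..).mpr h₁) (h₂ := (nonsingular_neg ..).mpr h₂)
    (h := (nonsingular_neg ..).mpr h) hxy' (by rwa [hX])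
  rw [hX, hs] at g2
  rw [Point.neg_some, Point.neg_some, Point.neg_some]
  apply mul_right_cancel₀ (sub_ne_zero.mpr hx)
  rw [g2, neg_mul, g1, negY, negY]
  ring

end Symmetry

/-! ### Reciprocity for two functions `r_{A,B}` in general position -/

section GenericReciprocity

variable {F : Type*} [Field F] {V : WeierstrassCurve.Affine F} [DecidableEq F]

/-- `Y` is no combination of `R`, `P`, `Z` with coefficients `-1`, `0` and `1`. -/
def Generic (Y R P Z : V.Point) : Prop :=
  ∀ i ∈ ({-1, 0, 1} : Finset ℤ), ∀ j ∈ ({-1, 0, 1} : Finset ℤ), ∀ k ∈ ({-1, 0, 1} : Finset ℤ),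
    Y ≠ i • R + j • P + k • Z

lemma eventually_generic (R P Z : V.Point) : ∀ᶠ Y in Filter.cofinite, Generic Y R P Z := by
  simp only [Generic, Filter.eventually_all_finset]
  intro i _ j _ k _
  exact Filter.eventually_cofinite_ne _

lemma Generic.eq_imp {Y R P Z : V.Point} (h : Generic Y R P Z) (i j k : ℤ)
    (h0 : Y + i • R + j • P + k • Z = 0) (hi : i ∈ ({-1, 0, 1} : Finset ℤ) := by decide)
    (hj : j ∈ ({-1, 0, 1} : Finset ℤ) := by decide)
    (hk : k ∈ ({-1, 0, 1} : Finset ℤ) := by decide) : False := by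
  have hneg : ∀ i ∈ ({-1, 0, 1} : Finset ℤ), -i ∈ ({-1, 0, 1} : Finset ℤ) := by decide
  refine h _ (hneg i hi) _ (hneg j hj) _ (hneg k hk) ?_
  exact sub_eq_zero.mp (.trans (by module) h0)

/-- The biextension identity: with `ρ(A, B, C) = r_{A,B}(-C)`, the quotient
`ρ(A, B, X) ρ(A, B, W) / ρ(A, B, X + W)` does not change when the pairs `A, B` and `X, W` are
exchanged. It follows from the cocycle identity by means of the symmetry of `ρ`. -/
lemma rVal_neg_exchange {A B X W : V.Point} (hA : A ≠ 0) (hX : X ≠ 0) (hAX : A + X ≠ 0)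
    (hW : Generic W A X 0) (hB : Generic B A X W) :
    rVal A B (-X) * rVal A B (-W) * rVal X W (-(A + B)) =
      rVal X W (-A) * rVal X W (-B) * rVal A B (-(X + W)) := by
  -- instances of the symmetry of `ρ`
  have r1 := rVal_neg_rotate (A := A) (B := B) (C := X)
      hA
      (fun h => hB.eq_imp (0) (0) (0) (.trans (by module) (sub_eq_zero.mpr h)))
      hX
      (fun h => hB.eq_imp (1) (0) (0) (.trans (by module) (sub_eq_zero.mpr h)))
      hAX
      (fun h => hB.eq_imp (0) (1) (0) (.trans (by module) (sub_eq_zero.mpr h)))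
      (fun h => hB.eq_imp (1) (1) (0) (.trans (by module) (sub_eq_zero.mpr h)))
      (fun h => hB.eq_imp (1) (-1) (0) (.trans (by module) (sub_eq_zero.mpr h.symm)))
      (fun h => hB.eq_imp (-1) (1) (0) (.trans (by module) (sub_eq_zero.mpr h.symm)))
  have r2 := rVal_neg_rotate (A := A) (B := B+X) (C := W)
      hA
      (fun h => hB.eq_imp (0) (1) (0) (.trans (by module) (sub_eq_zero.mpr h)))
      (fun h => hW.eq_imp (0) (0) 0 (.trans (by module) (sub_eq_zero.mpr h)))
      (fun h => hB.eq_imp (1) (1) (0) (.trans (by module) (sub_eq_zero.mpr h)))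
      (fun h => hW.eq_imp (1) (0) 0 (.trans (by module) (sub_eq_zero.mpr h)))
      (fun h => hB.eq_imp (0) (1) (1) (.trans (by module) (sub_eq_zero.mpr h)))
      (fun h => hB.eq_imp (1) (1) (1) (.trans (by module) (sub_eq_zero.mpr h)))
      (fun h => hB.eq_imp (1) (1) (-1) (.trans (by module) (sub_eq_zero.mpr h.symm)))
      (fun h => hB.eq_imp (-1) (1) (1) (.trans (by module) (sub_eq_zero.mpr h.symm)))
  have r3 := rVal_neg_rotate (A := A) (B := B) (C := X+W)
      hA
      (fun h => hB.eq_imp (0) (0) (0) (.trans (by module) (sub_eq_zero.mpr h)))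
      (fun h => hW.eq_imp (0) (1) 0 (.trans (by module) (sub_eq_zero.mpr h)))
      (fun h => hB.eq_imp (1) (0) (0) (.trans (by module) (sub_eq_zero.mpr h)))
      (fun h => hW.eq_imp (1) (1) 0 (.trans (by module) (sub_eq_zero.mpr h)))
      (fun h => hB.eq_imp (0) (1) (1) (.trans (by module) (sub_eq_zero.mpr h)))
      (fun h => hB.eq_imp (1) (1) (1) (.trans (by module) (sub_eq_zero.mpr h)))
      (fun h => hB.eq_imp (1) (-1) (-1) (.trans (by module) (sub_eq_zero.mpr h.symm)))
      (fun h => hB.eq_imp (-1) (1) (1) (.trans (by module) (sub_eq_zero.mpr h.symm)))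
  have r4 := rVal_neg_rotate (A := A+B) (B := X) (C := W)
      (fun h => hB.eq_imp (1) (0) (0) (.trans (by module) (sub_eq_zero.mpr h)))
      hX
      (fun h => hW.eq_imp (0) (0) 0 (.trans (by module) (sub_eq_zero.mpr h)))
      (fun h => hB.eq_imp (1) (1) (0) (.trans (by module) (sub_eq_zero.mpr h)))
      (fun h => hB.eq_imp (1) (0) (1) (.trans (by module) (sub_eq_zero.mpr h)))
      (fun h => hW.eq_imp (0) (1) 0 (.trans (by module) (sub_eq_zero.mpr h)))
      (fun h => hB.eq_imp (1) (1) (1) (.trans (by module) (sub_eq_zero.mpr h)))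
      (fun h => hB.eq_imp (1) (1) (-1) (.trans (by module) (sub_eq_zero.mpr h.symm)))
      (fun h => hB.eq_imp (1) (-1) (-1) (.trans (by module) (sub_eq_zero.mpr h)))
  have r5 := rVal_neg_rotate (A := B) (B := X) (C := W)
      (fun h => hB.eq_imp (0) (0) (0) (.trans (by module) (sub_eq_zero.mpr h)))
      hX
      (fun h => hW.eq_imp (0) (0) 0 (.trans (by module) (sub_eq_zero.mpr h)))
      (fun h => hB.eq_imp (0) (1) (0) (.trans (by module) (sub_eq_zero.mpr h)))
      (fun h => hB.eq_imp (0) (0) (1) (.trans (by module) (sub_eq_zero.mpr h)))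
      (fun h => hW.eq_imp (0) (1) 0 (.trans (by module) (sub_eq_zero.mpr h)))
      (fun h => hB.eq_imp (0) (1) (1) (.trans (by module) (sub_eq_zero.mpr h)))
      (fun h => hB.eq_imp (0) (1) (-1) (.trans (by module) (sub_eq_zero.mpr h.symm)))
      (fun h => hB.eq_imp (0) (-1) (-1) (.trans (by module) (sub_eq_zero.mpr h)))
  -- instances of the cocycle identity for `r`
  have c1 := rVal_cocycle (A := B) (B := X) (C := W) (P := -A)
      (neg_ne_zero.mpr hA)
      (fun h => hB.eq_imp (1) (0) (0) (.trans (by module) (sub_eq_zero.mpr h.symm)))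
      (fun h => hAX (by rw [← h, add_neg_cancel]))
      (fun h => hW.eq_imp (1) (0) 0 (.trans (by module) (sub_eq_zero.mpr h.symm)))
      (fun h => hB.eq_imp (1) (1) (0) (.trans (by module) (sub_eq_zero.mpr h.symm)))
      (fun h => hB.eq_imp (-1) (1) (0) (.trans (by module) (sub_eq_zero.mpr h)))
      (fun h => hW.eq_imp (1) (1) 0 (.trans (by module) (sub_eq_zero.mpr h.symm)))
      (fun h => hW.eq_imp (-1) (1) 0 (.trans (by module) (sub_eq_zero.mpr h)))
      (fun h => hB.eq_imp (1) (1) (1) (.trans (by module) (sub_eq_zero.mpr h.symm)))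
      (fun h => hB.eq_imp (-1) (1) (1) (.trans (by module) (sub_eq_zero.mpr h)))
  have c2 := rVal_cocycle (A := A) (B := B) (C := X) (P := -W)
      (fun h => hW.eq_imp (0) (0) 0 (.trans (by module) (sub_eq_zero.mpr h.symm)))
      (fun h => hW.eq_imp (1) (0) 0 (.trans (by module) (sub_eq_zero.mpr h.symm)))
      (fun h => hB.eq_imp (0) (0) (1) (.trans (by module) (sub_eq_zero.mpr h.symm)))
      (fun h => hW.eq_imp (0) (1) 0 (.trans (by module) (sub_eq_zero.mpr h.symm)))
      (fun h => hB.eq_imp (1) (0) (1) (.trans (by module) (sub_eq_zero.mpr h.symm)))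
      (fun h => hB.eq_imp (1) (0) (-1) (.trans (by module) (sub_eq_zero.mpr h)))
      (fun h => hB.eq_imp (0) (1) (1) (.trans (by module) (sub_eq_zero.mpr h.symm)))
      (fun h => hB.eq_imp (0) (1) (-1) (.trans (by module) (sub_eq_zero.mpr h)))
      (fun h => hB.eq_imp (1) (1) (1) (.trans (by module) (sub_eq_zero.mpr h.symm)))
      (fun h => hB.eq_imp (1) (1) (-1) (.trans (by module) (sub_eq_zero.mpr h)))
  have n0 := rVal_ne_zero (A := A) (B := B + X) (P := -W)
      (fun h => hW.eq_imp (0) (0) 0 (.trans (by module) (sub_eq_zero.mpr h.symm)))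
      (fun h => hW.eq_imp (1) (0) 0 (.trans (by module) (sub_eq_zero.mpr h.symm)))
      (fun h => hB.eq_imp (0) (1) (1) (.trans (by module) (sub_eq_zero.mpr h.symm)))
      (fun h => hB.eq_imp (1) (1) (1) (.trans (by module) (sub_eq_zero.mpr h.symm)))
      (fun h => hB.eq_imp (1) (1) (-1) (.trans (by module) (sub_eq_zero.mpr h)))
  apply mul_right_cancel₀ n0
  rw [r1, r3, ← r4, ← r5]
  rw [r2] at c2 ⊢
  linear_combination rVal A B (-W) * rVal (A + B) X (-W) * c1 + rVal B (X + W) (-A) * rVal X W (-A) * c2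

/-- The exchange identity for the pairs `R, Y` and `-P, -Z`, rewritten by means of `rVal_neg_neg`; the
sign is the contribution of the common pole at infinity. -/
lemma rVal_reciprocity {R P Y Z : V.Point} (hR : R ≠ 0) (hP : P ≠ 0) (hRP : R ≠ P)
    (hZ : Generic (-Z) R (-P) 0) (hY : Generic Y R (-P) (-Z)) :
    rVal R Y P * rVal R Y Z * rVal P Z (R + Y) =
      -(rVal P Z R * rVal P Z Y * rVal R Y (P + Z)) := by
  have h1 := rVal_neg_exchange hR (neg_ne_zero.mpr hP) (by rwa [← sub_eq_add_neg, sub_ne_zero])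
    hZ hY
  have hZ0 : Z ≠ 0 := fun h => hZ.eq_imp 0 0 0 (.trans (by module) (sub_eq_zero.mpr h.symm))
  have hPZ : P + Z ≠ 0 := fun h => hZ.eq_imp 0 1 0 (.trans (by module) (sub_eq_zero.mpr h.symm))
  rw [← neg_add, neg_neg, neg_neg, neg_neg,
    rVal_neg_neg hP hZ0 hPZ (P := R + Y)
      (fun h => hY.eq_imp 1 0 0 (.trans (by module) (sub_eq_zero.mpr h)))
      (fun h => hY.eq_imp 1 1 1 (.trans (by module) (sub_eq_zero.mpr h)))
      (fun h => hY.eq_imp 1 (-1) (-1) (.trans (by module) (sub_eq_zero.mpr h))),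
    rVal_neg_neg hP hZ0 hPZ (P := R) hR
      (fun h => hZ.eq_imp 1 1 0 (.trans (by module) (sub_eq_zero.mpr h)))
      (fun h => hZ.eq_imp (-1) 1 0 (.trans (by module) (sub_eq_zero.mpr h.symm))),
    rVal_neg_neg hP hZ0 hPZ (P := Y)
      (fun h => hY.eq_imp 0 0 0 (.trans (by module) (sub_eq_zero.mpr h)))
      (fun h => hY.eq_imp 0 1 1 (.trans (by module) (sub_eq_zero.mpr h)))
      (fun h => hY.eq_imp 0 (-1) (-1) (.trans (by module) (sub_eq_zero.mpr h)))] at h1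
  linear_combination -h1

end GenericReciprocity

/-! ### Weil reciprocity -/

section WeilReciprocity

variable {F : Type*} [Field F] {V : WeierstrassCurve.Affine F}

/-- The value of the monic function with divisor `D` at the divisor `E`. -/
def evDiv (D E : V.Point →₀ ℤ) : Fˣ := E.prod fun P m => ev D P ^ m

@[simp] lemma evDiv_single (D : V.Point →₀ ℤ) (P : V.Point) (m : ℤ) :
    evDiv D (Finsupp.single P m) = ev D P ^ m :=
  Finsupp.prod_single_index (zpow_zero _)

@[simp] lemma evDiv_zero_right (D : V.Point →₀ ℤ) : evDiv D 0 = 1 := Finsupp.prod_zero_index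

lemma evDiv_add_right (D E E' : V.Point →₀ ℤ) : evDiv D (E + E') = evDiv D E * evDiv D E' :=
  Finsupp.prod_add_index' (fun _ => zpow_zero _) (fun _ => zpow_add _)

lemma evDiv_neg_right (D E : V.Point →₀ ℤ) : evDiv D (-E) = (evDiv D E)⁻¹ := by
  rw [eq_inv_iff_mul_eq_one, ← evDiv_add_right, neg_add_cancel, evDiv_zero_right]

lemma evDiv_sub_right (D E E' : V.Point →₀ ℤ) : evDiv D (E - E') = evDiv D E / evDiv D E' := by
  rw [sub_eq_add_neg, evDiv_add_right, evDiv_neg_right, div_eq_mul_inv]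

lemma evDiv_nsmul_right (D E : V.Point →₀ ℤ) (n : ℕ) : evDiv D (n • E) = evDiv D E ^ n := by
  induction n with
  | zero => simp
  | succ n ih => rw [succ_nsmul, evDiv_add_right, ih, pow_succ]

@[simp] lemma evDiv_zero_left (E : V.Point →₀ ℤ) : evDiv 0 E = 1 := by
  simp [evDiv, Finsupp.prod]

/-- The supports of `D` and `E` have no affine point in common. -/
def Disj (D E : V.Point →₀ ℤ) : Prop := ∀ P ≠ 0, P ∈ D.support → P ∉ E.support

lemma Disj.symm {D E : V.Point →₀ ℤ} (h : Disj D E) : Disj E D :=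
  fun P hP hE hD => h P hP hD hE

lemma Disj.add_left {D D' E : V.Point →₀ ℤ} (h : Disj D E) (h' : Disj D' E) :
    Disj (D + D') E := by
  classical
  intro P hP hD
  rcases Finset.mem_union.mp (Finsupp.support_add hD) with hD | hD
  · exact h P hP hD
  · exact h' P hP hD

lemma Disj.neg_left {D E : V.Point →₀ ℤ} (h : Disj D E) : Disj (-D) E := by
  intro P hP hD
  rw [Finsupp.support_neg] at hD
  exact h P hP hD

lemma Disj.sub_left {D D' E : V.Point →₀ ℤ} (h : Disj D E) (h' : Disj D' E) :
    Disj (D - D') E := by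
  rw [sub_eq_add_neg]
  exact h.add_left h'.neg_left

lemma disj_zero_left (E : V.Point →₀ ℤ) : Disj 0 E := by
  intro P _ h
  simp at h

lemma disj_zsmul_left {D E : V.Point →₀ ℤ} (h : Disj D E) (m : ℤ) : Disj (m • D) E :=
  fun P hP hD => h P hP (Finsupp.support_smul hD)

lemma disj_single_left {P : V.Point} {E : V.Point →₀ ℤ} (h : P = 0 ∨ P ∉ E.support) (m : ℤ) :
    Disj (Finsupp.single P m) E := by
  intro Q hQ hQ'
  obtain rfl := Finset.mem_singleton.mp (Finsupp.support_single_subset hQ')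
  exact h.resolve_left hQ

/-- An additive predicate holds for a divisor if it holds for the points of the support. -/
lemma div_induction {p : (V.Point →₀ ℤ) → Prop} (D : V.Point →₀ ℤ) (h0 : p 0)
    (hadd : ∀ D E, p D → p E → p (D + E)) (hneg : ∀ D, p D → p (-D))
    (hs : ∀ P ∈ D.support, p (Finsupp.single P 1)) : p D := by
  let S : AddSubgroup (V.Point →₀ ℤ) :=
    { carrier := {D | p D}, zero_mem' := h0, add_mem' := hadd _ _, neg_mem' := hneg _ }
  change D ∈ S
  rw [← Finsupp.sum_single D]
  refine S.sum_mem fun P hP => ?_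
  rw [← mul_one (D P), ← smul_eq_mul, ← Finsupp.smul_single]
  exact S.zsmul_mem (hs P hP) _

variable [DecidableEq F]

lemma evDiv_add_left {D D' E : V.Point →₀ ℤ} (hD : IsPrin D) (hD' : IsPrin D') (h : Disj D E)
    (h' : Disj D' E) : evDiv (D + D') E = evDiv D E * evDiv D' E := by
  rw [evDiv, evDiv, evDiv, Finsupp.prod, Finsupp.prod, Finsupp.prod, ← Finset.prod_mul_distrib]
  refine Finset.prod_congr rfl fun P hP => ?_
  rw [← mul_zpow]
  congr 1
  by_cases hP0 : P = 0
  · simp [hP0]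
  · exact ev_add hD hD' (h.symm P hP0 hP) (h'.symm P hP0 hP)

lemma evDiv_neg_left {D E : V.Point →₀ ℤ} (hD : IsPrin D) (h : Disj D E) :
    evDiv (-D) E = (evDiv D E)⁻¹ := by
  rw [eq_inv_iff_mul_eq_one, ← evDiv_add_left hD.neg hD h.neg_left h, neg_add_cancel,
    evDiv_zero_left]

lemma evDiv_sub_left {D D' E : V.Point →₀ ℤ} (hD : IsPrin D) (hD' : IsPrin D') (h : Disj D E)
    (h' : Disj D' E) : evDiv (D - D') E = evDiv D E / evDiv D' E := by
  rw [sub_eq_add_neg, evDiv_add_left hD hD'.neg h h'.neg_left, evDiv_neg_left hD' h',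
    div_eq_mul_inv]

lemma IsPrin.zsmul {D : V.Point →₀ ℤ} (hD : IsPrin D) (m : ℤ) : IsPrin (m • D) :=
  ⟨by rw [map_zsmul, hD.1, smul_zero], by rw [map_zsmul, hD.2, smul_zero]⟩

lemma evDiv_nsmul_left {D E : V.Point →₀ ℤ} (hD : IsPrin D) (h : Disj D E) (n : ℕ) :
    evDiv ((n : ℤ) • D) E = evDiv D E ^ n := by
  induction n with
  | zero => simp
  | succ n ih =>
    rw [Nat.cast_succ, add_smul, one_smul, evDiv_add_left (hD.zsmul _) hD (disj_zsmul_left h _) h,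
      ih, pow_succ]

omit [DecidableEq F] in
/-- Weil reciprocity for the monic functions with divisors `D` and `E`; the sign is the
contribution of the tame symbol at infinity. -/
def Recip (D E : V.Point →₀ ℤ) : Prop := evDiv D E = (-1) ^ (D 0 * E 0) * evDiv E D

omit [DecidableEq F] in
lemma neg_one_zpow_mul_self (m : ℤ) : ((-1 : Fˣ) ^ m) * (-1) ^ m = 1 := by
  rw [← mul_zpow]
  simp

omit [DecidableEq F] in
lemma Recip.symm {D E : V.Point →₀ ℤ} (h : Recip D E) : Recip E D := by
  rw [Recip] at *
  rw [h, ← mul_assoc, mul_comm (E 0), neg_one_zpow_mul_self, one_mul]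

lemma Recip.add_left {D D' E : V.Point →₀ ℤ} (hD : IsPrin D) (hD' : IsPrin D') (hd : Disj D E)
    (hd' : Disj D' E) (h : Recip D E) (h' : Recip D' E) : Recip (D + D') E := by
  rw [Recip] at *
  rw [evDiv_add_left hD hD' hd hd', h, h', evDiv_add_right, Finsupp.add_apply, add_mul, zpow_add,
    mul_mul_mul_comm]

lemma Recip.neg_left {D E : V.Point →₀ ℤ} (hD : IsPrin D) (hd : Disj D E) (h : Recip D E) :
    Recip (-D) E := by
  rw [Recip] at *
  rw [evDiv_neg_left hD hd, h, evDiv_neg_right, Finsupp.neg_apply, neg_mul, zpow_neg, mul_inv]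

omit [DecidableEq F] in
lemma recip_zero_left (E : V.Point →₀ ℤ) : Recip 0 E := by
  simp [Recip]

lemma rDiv_apply_zero {A B : V.Point} (hA : A ≠ 0) (hB : B ≠ 0) (hAB : A + B ≠ 0) :
    rDiv A B 0 = -1 := by
  simp [rDiv, hA, hB, hAB]

/-- Weil reciprocity for two functions `r_{R,Y}` and `r_{P,Z}` in general position. -/
lemma recip_rDiv {R P Y Z : V.Point} (hR : R ≠ 0) (hP : P ≠ 0) (hRP : R ≠ P)
    (hZ : Generic (-Z) R (-P) 0) (hY : Generic Y R (-P) (-Z)) :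
    Disj (rDiv R Y) (rDiv P Z) ∧ Recip (rDiv R Y) (rDiv P Z) := by
  have z0 : Z ≠ 0 := fun h => hZ.eq_imp 0 0 0 (.trans (by module) (sub_eq_zero.mpr h.symm))
  have zP : P + Z ≠ 0 := fun h => hZ.eq_imp 0 1 0 (.trans (by module) (sub_eq_zero.mpr h.symm))
  have y0 : Y ≠ 0 := fun h => hY.eq_imp 0 0 0 (.trans (by module) (sub_eq_zero.mpr h))
  have yR : R + Y ≠ 0 := fun h => hY.eq_imp 1 0 0 (.trans (by module) (sub_eq_zero.mpr h))
  have p2 : P ≠ Y := fun h => hY.eq_imp 0 1 0 (.trans (by module) (sub_eq_zero.mpr h.symm))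
  have p3 : P ≠ R + Y := fun h => hY.eq_imp 1 1 0 (.trans (by module) (sub_eq_zero.mpr h.symm))
  have p4 : P ≠ -(R + Y) := fun h => hY.eq_imp 1 (-1) 0 (.trans (by module) (sub_eq_zero.mpr h))
  have q1 : Z ≠ R := fun h => hZ.eq_imp 1 0 0 (.trans (by module) (sub_eq_zero.mpr h.symm))
  have q2 : Z ≠ Y := fun h => hY.eq_imp 0 0 1 (.trans (by module) (sub_eq_zero.mpr h.symm))
  have q3 : Z ≠ R + Y := fun h => hY.eq_imp 1 0 1 (.trans (by module) (sub_eq_zero.mpr h.symm))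
  have q4 : Z ≠ -(R + Y) := fun h => hY.eq_imp 1 0 (-1) (.trans (by module) (sub_eq_zero.mpr h))
  have s1 : P + Z ≠ R := fun h => hZ.eq_imp 1 1 0 (.trans (by module) (sub_eq_zero.mpr h.symm))
  have s2 : P + Z ≠ Y := fun h => hY.eq_imp 0 1 1 (.trans (by module) (sub_eq_zero.mpr h.symm))
  have s3 : P + Z ≠ R + Y := fun h => hY.eq_imp 1 1 1 (.trans (by module) (sub_eq_zero.mpr h.symm))
  have s4 : P + Z ≠ -(R + Y) :=
    fun h => hY.eq_imp 1 (-1) (-1) (.trans (by module) (sub_eq_zero.mpr h))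
  have t1 : R ≠ -(P + Z) := fun h => hZ.eq_imp (-1) 1 0 (.trans (by module) (sub_eq_zero.mpr h.symm))
  have t2 : Y ≠ -(P + Z) := fun h => hY.eq_imp 0 (-1) (-1) (.trans (by module) (sub_eq_zero.mpr h))
  have t3 : R + Y ≠ -(P + Z) :=
    fun h => hY.eq_imp 1 (-1) (-1) (.trans (by module) (sub_eq_zero.mpr h))
  have hd : Disj (rDiv R Y) (rDiv P Z) := by
    rw [rDiv]
    refine ((Disj.add_left ?_ ?_).sub_left ?_).sub_left ?_
    · exact disj_single_left (Or.inr (notMem_support_rDiv hR hRP q1.symm s1.symm)) _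
    · exact disj_single_left (Or.inr (notMem_support_rDiv y0 p2.symm q2.symm s2.symm)) _
    · exact disj_single_left (Or.inr (notMem_support_rDiv yR p3.symm q3.symm s3.symm)) _
    · exact disj_single_left (Or.inl rfl) _
  refine ⟨hd, ?_⟩
  rw [Recip, rDiv_apply_zero hR y0 yR, rDiv_apply_zero hP z0 zP]
  conv_lhs => rw [rDiv.eq_def P Z]
  conv_rhs => rw [rDiv.eq_def R Y]
  simp only [evDiv_sub_right, evDiv_add_right, evDiv_single, zpow_one, ev_zero_right, div_one,
    mul_neg, mul_one, neg_neg]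
  rw [mul_div_assoc', div_eq_div_iff_mul_eq_mul]
  apply Units.ext
  simp only [Units.val_mul, Units.val_neg, Units.val_one]
  rw [ev_rDiv hP hRP.symm p2 p3 p4, ev_rDiv z0 q1 q2 q3 q4, ev_rDiv zP s1 s2 s3 s4,
    ev_rDiv hR hRP q1.symm s1.symm t1, ev_rDiv y0 p2.symm q2.symm s2.symm t2,
    ev_rDiv yR p3.symm q3.symm s3.symm t3]
  linear_combination rVal_reciprocity hR hP hRP hZ hY

/-- The divisor `D + (Z) - (Z + ∑ D) - (deg D) (O)`, which has degree zero and sum zero. -/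
def chain (D : V.Point →₀ ℤ) (Z : V.Point) : V.Point →₀ ℤ :=
  D + Finsupp.single Z 1 - Finsupp.single (Z + ptSum D) 1 - Finsupp.single 0 (degHom D)

lemma isPrin_chain (D : V.Point →₀ ℤ) (Z : V.Point) : IsPrin (chain D Z) := by
  refine ⟨?_, ?_⟩
  · simp only [chain, map_sub, map_add, degHom_single]
    ring
  · simp only [chain, map_sub, map_add, ptSum_single]
    module

lemma chain_add (D E : V.Point →₀ ℤ) (Z : V.Point) :
    chain (D + E) Z = chain D Z + chain E (Z + ptSum D) := by
  simp only [chain, map_add, Finsupp.single_add, add_assoc]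
  abel

lemma chain_neg (D : V.Point →₀ ℤ) (Z : V.Point) : chain (-D) Z = -chain D (Z - ptSum D) := by
  simp only [chain, map_neg, Finsupp.single_neg, sub_add_cancel, ← sub_eq_add_neg]
  abel

lemma chain_zero (Z : V.Point) : chain 0 Z = 0 := by
  simp [chain]

lemma chain_single (P Z : V.Point) : chain (Finsupp.single P 1) Z = rDiv P Z := by
  simp [chain, rDiv, add_comm Z]

lemma IsPrin.chain_eq {D : V.Point →₀ ℤ} (hD : IsPrin D) (Z : V.Point) : chain D Z = D := by
  rw [chain, hD.1, hD.2]
  simp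

lemma eventually_add_right {p : V.Point → Prop} (h : ∀ᶠ Z in Filter.cofinite, p Z) (C : V.Point) :
    ∀ᶠ Z in Filter.cofinite, p (Z + C) :=
  (add_left_injective C).tendsto_cofinite.eventually h

/-- Reciprocity between a function with divisor `chain D Y` and a function `r_{P,Z}`, for general `Y`
and `Z`. The free point `Y` makes the statement additive in `D`, which reduces it to the case of one
point. -/
lemma recip_chain_rDiv (D : V.Point →₀ ℤ) {P : V.Point} (hP0 : P ≠ 0) (hP : P ∉ D.support) :
    ∀ᶠ Z in Filter.cofinite, ∀ᶠ Y in Filter.cofinite,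
      Disj (chain D Y) (rDiv P Z) ∧ Recip (chain D Y) (rDiv P Z) := by
  refine div_induction (p := fun D => ∀ᶠ Z in Filter.cofinite, ∀ᶠ Y in Filter.cofinite,
      Disj (chain D Y) (rDiv P Z) ∧ Recip (chain D Y) (rDiv P Z)) D ?_ ?_ ?_ ?_
  · simp only [chain_zero]
    exact .of_forall fun Z => .of_forall fun Y => ⟨disj_zero_left _, recip_zero_left _⟩
  · intro D E hD hE
    filter_upwards [hD, hE] with Z hDZ hEZ
    filter_upwards [hDZ, eventually_add_right hEZ (ptSum D)] with Y h1 h2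
    rw [chain_add]
    exact ⟨h1.1.add_left h2.1,
      Recip.add_left (isPrin_chain _ _) (isPrin_chain _ _) h1.1 h2.1 h1.2 h2.2⟩
  · intro D hD
    filter_upwards [hD] with Z hDZ
    filter_upwards [eventually_add_right hDZ (-ptSum D)] with Y h1
    rw [chain_neg, sub_eq_add_neg]
    exact ⟨h1.1.neg_left, Recip.neg_left (isPrin_chain _ _) h1.1 h1.2⟩
  · intro R hR
    by_cases hR0 : R = 0
    · simp only [chain_single, hR0, rDiv_zero_left]
      exact .of_forall fun Z => .of_forall fun Y => ⟨disj_zero_left _, recip_zero_left _⟩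
    · have hRP : R ≠ P := by
        rintro rfl
        exact hP hR
      filter_upwards [neg_injective.tendsto_cofinite.eventually (eventually_generic R (-P) 0)]
        with Z hZ
      filter_upwards [eventually_generic R (-P) (-Z)] with Y hY
      rw [chain_single]
      exact recip_rDiv hR0 hP0 hRP hZ hY

lemma recip_prin_rDiv [Infinite V.Point] {D : V.Point →₀ ℤ} (hD : IsPrin D) {P : V.Point}
    (hP0 : P ≠ 0) (hP : P ∉ D.support) :
    ∀ᶠ Z in Filter.cofinite, Disj D (rDiv P Z) ∧ Recip D (rDiv P Z) := by
  filter_upwards [recip_chain_rDiv D hP0 hP] with Z hZ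
  simp only [hD.chain_eq] at hZ
  exact Filter.eventually_const.mp hZ

/-- Weil reciprocity for functions on the curve. Both divisors are decomposed into divisors
`(A) + (B) - (A + B) - (O)`, with `B` in general position. -/
theorem weil_reciprocity [Infinite V.Point] {D E : V.Point →₀ ℤ} (hD : IsPrin D) (hE : IsPrin E)
    (hDE : Disj D E) : Recip D E := by
  have key : ∀ᶠ Z in Filter.cofinite, Disj (chain E Z) D ∧ Recip (chain E Z) D := by
    refine div_induction (p := fun E => ∀ᶠ Z in Filter.cofinite,
      Disj (chain E Z) D ∧ Recip (chain E Z) D) E ?_ ?_ ?_ ?_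
    · simp only [chain_zero]
      exact .of_forall fun Z => ⟨disj_zero_left _, recip_zero_left _⟩
    · intro E E' h h'
      filter_upwards [h, eventually_add_right h' (ptSum E)] with Z h1 h2
      rw [chain_add]
      exact ⟨h1.1.add_left h2.1,
        Recip.add_left (isPrin_chain _ _) (isPrin_chain _ _) h1.1 h2.1 h1.2 h2.2⟩
    · intro E h
      filter_upwards [eventually_add_right h (-ptSum E)] with Z h1
      rw [chain_neg, sub_eq_add_neg]
      exact ⟨h1.1.neg_left, Recip.neg_left (isPrin_chain _ _) h1.1 h1.2⟩
    · intro P hP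
      by_cases hP0 : P = 0
      · simp only [chain_single, hP0, rDiv_zero_left]
        exact .of_forall fun Z => ⟨disj_zero_left _, recip_zero_left _⟩
      · filter_upwards [recip_prin_rDiv hD hP0 (hDE.symm P hP0 hP)] with Z hZ
        rw [chain_single]
        exact ⟨hZ.1.symm, hZ.2.symm⟩
  simp only [hE.chain_eq] at key
  exact (Filter.eventually_const.mp key).2.symm

end WeilReciprocity

/-! ### The functions `G_T` and the Weil pairing -/

section WeilPairing

variable {F : Type*} [Field F] {V : WeierstrassCurve.Affine F} [DecidableEq F]

/-- The divisor `n (T) - n (O)`. -/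
def tDiv (n : ℕ) (T : V.Point) : V.Point →₀ ℤ := Finsupp.single T (n : ℤ) - Finsupp.single 0 (n : ℤ)

/-- The divisor `n (Q) - (nQ) - (n - 1) (O)`. -/
def qDiv (n : ℕ) (Q : V.Point) : V.Point →₀ ℤ :=
  Finsupp.single Q (n : ℤ) - Finsupp.single (n • Q) 1 - Finsupp.single 0 ((n : ℤ) - 1)

lemma isPrin_tDiv {n : ℕ} {T : V.Point} (hT : n • T = 0) : IsPrin (tDiv n T) := by
  refine ⟨?_, ?_⟩
  · simp [tDiv]
  · simp [tDiv, hT]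

lemma isPrin_qDiv (n : ℕ) (Q : V.Point) : IsPrin (qDiv n Q) := by
  refine ⟨?_, ?_⟩
  · simp [qDiv]
  · simp [qDiv]

omit [DecidableEq F] in
lemma notMem_support_tDiv {n : ℕ} {T P : V.Point} (h0 : P ≠ 0) (hT : P ≠ T) :
    P ∉ (tDiv n T).support := by
  simp [tDiv, h0.symm, hT.symm]

lemma notMem_support_qDiv {n : ℕ} {Q P : V.Point} (h0 : P ≠ 0) (hQ : P ≠ Q) (hnQ : P ≠ n • Q) :
    P ∉ (qDiv n Q).support := by
  simp [qDiv, h0.symm, hQ.symm, hnQ.symm]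

/-- The value at `Q` of the function `G_T` with divisor `[n]^* (T) - [n]^* (O)`, for an `n`-torsion
point `T`. By Weil reciprocity it is `± f_T(Q) / h_Q(T)`, where `f_T` and `h_Q` are the monic
functions with divisors `n (T) - n (O)` and `n (Q) - (nQ) - (n - 1) (O)`; this formula is taken as
the definition. -/
def gVal (n : ℕ) (Q T : V.Point) : Fˣ :=
  (if T = 0 then 1 else (-1) ^ ((n : ℤ) - 1)) * ev (tDiv n T) Q / ev (qDiv n Q) T

omit [DecidableEq F] in
lemma ne_of_nsmul_ne_zero' {G : Type*} [AddCommGroup G] {n : ℕ} {Q T : G} (hQ : n • Q ≠ 0)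
    (hT : n • T = 0) : Q ≠ T := by
  rintro rfl
  exact hQ hT

lemma tDiv_add {n : ℕ} (T₁ T₂ : V.Point) :
    tDiv n T₁ + tDiv n T₂ = tDiv n (T₁ + T₂) + (n : ℤ) • rDiv T₁ T₂ := by
  simp only [tDiv, rDiv, smul_sub, smul_add, Finsupp.smul_single, smul_eq_mul, mul_one]
  abel

lemma rDiv_sign (n : ℕ) (T₁ T₂ : V.Point) :
    (if T₁ = 0 then (1 : Fˣ) else (-1) ^ ((n : ℤ) - 1)) *
      (if T₂ = 0 then 1 else (-1) ^ ((n : ℤ) - 1)) =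
    (-1) ^ (rDiv T₁ T₂ 0 * ((n : ℤ) - 1)) *
      (if T₁ + T₂ = 0 then 1 else (-1) ^ ((n : ℤ) - 1)) := by
  by_cases h1 : T₁ = 0
  · subst h1
    simp
  by_cases h2 : T₂ = 0
  · subst h2
    simp
  rw [if_neg h1, if_neg h2, neg_one_zpow_mul_self]
  by_cases h3 : T₁ + T₂ = 0
  · have : rDiv T₁ T₂ 0 = -2 := by simp [rDiv, h1, h2, h3]
    rw [if_pos h3, this, mul_one, zpow_mul]
    simp
  · rw [if_neg h3, rDiv_apply_zero h1 h2 h3, neg_one_mul, zpow_neg, inv_mul_cancel]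

variable [Infinite V.Point]

/-- The relation `G_{T₁} G_{T₂} / G_{T₁ + T₂} = r_{T₁,T₂} ∘ [n]`. -/
lemma gVal_mul_div {n : ℕ} {Q T₁ T₂ : V.Point} (hQ : n • n • Q ≠ 0) (h₁ : n • T₁ = 0)
    (h₂ : n • T₂ = 0) :
    ((gVal n Q T₁ * gVal n Q T₂ / gVal n Q (T₁ + T₂) : Fˣ) : F) = rVal T₁ T₂ (n • Q) := by
  have hnQ : n • Q ≠ 0 := by
    intro h
    rw [h, smul_zero] at hQ
    exact hQ rfl
  have hQ0 : Q ≠ 0 := by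
    rintro rfl
    simp at hQ
  have h12 : n • (T₁ + T₂) = 0 := by rw [smul_add, h₁, h₂, add_zero]
  have ne {A B : V.Point} (hA : n • A ≠ 0) (hB : n • B = 0) : A ≠ B := ne_of_nsmul_ne_zero' hA hB
  have hn0 : n • (0 : V.Point) = 0 := smul_zero n
  -- the divisors `n(T) - n(O)` are additive in `T` up to `n` times the divisor of `r_{T₁,T₂}`
  have a1 : ev (tDiv n T₁) Q * ev (tDiv n T₂) Q =
      ev (tDiv n (T₁ + T₂)) Q * ev (rDiv T₁ T₂) Q ^ n := by
    have hr := notMem_support_rDiv hQ0 (ne hnQ h₁) (ne hnQ h₂) (ne hnQ h12)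
    have h := congrArg (fun D => evDiv D (Finsupp.single Q 1)) (tDiv_add (n := n) T₁ T₂)
    have hd : Disj (rDiv T₁ T₂) (Finsupp.single Q 1) := (disj_single_left (Or.inr hr) 1).symm
    have hd' (T : V.Point) (hT : n • T = 0) : Disj (tDiv n T) (Finsupp.single Q 1) :=
      (disj_single_left (Or.inr (notMem_support_tDiv hQ0 (ne hnQ hT))) 1).symm
    rw [evDiv_add_left (isPrin_tDiv h₁) (isPrin_tDiv h₂) (hd' _ h₁) (hd' _ h₂),
      evDiv_add_left (isPrin_tDiv h12) ((isPrin_rDiv _ _).zsmul _) (hd' _ h12)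
        (disj_zsmul_left hd _), evDiv_nsmul_left (isPrin_rDiv _ _) hd] at h
    simpa using h
  have hd : Disj (rDiv T₁ T₂) (qDiv n Q) := by
    refine ((Disj.sub_left ?_ ?_).sub_left ?_).symm
    · exact disj_single_left
        (Or.inr (notMem_support_rDiv hQ0 (ne hnQ h₁) (ne hnQ h₂) (ne hnQ h12))) _
    · exact disj_single_left
        (Or.inr (notMem_support_rDiv hnQ (ne hQ h₁) (ne hQ h₂) (ne hQ h12))) _
    · exact disj_single_left (Or.inl rfl) _
  -- reciprocity trades the `n`-th power of `r_{T₁,T₂}(Q)` for `r_{T₁,T₂}(nQ)`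
  have a2 := weil_reciprocity (isPrin_rDiv T₁ T₂) (isPrin_qDiv n Q) hd
  have hq0 : qDiv n Q 0 = -((n : ℤ) - 1) := by
    simp [qDiv, hQ0, hnQ]
  rw [Recip, hq0, mul_neg, zpow_neg] at a2
  have hr : evDiv (qDiv n Q) (rDiv T₁ T₂) =
      ev (qDiv n Q) T₁ * ev (qDiv n Q) T₂ / ev (qDiv n Q) (T₁ + T₂) := by
    simp only [rDiv, evDiv_sub_right, evDiv_add_right, evDiv_single, zpow_one, ev_zero_right,
      div_one]
  rw [hr] at a2
  conv_lhs at a2 => rw [qDiv]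
  simp only [evDiv_sub_right, evDiv_single, zpow_one, ev_zero_right, div_one, one_zpow,
    zpow_natCast] at a2
  rw [← ev_rDiv hnQ (ne hQ h₁) (ne hQ h₂) (ne hQ h12) (ne hQ (by rw [smul_neg, h12, neg_zero]))]
  congr 1
  -- the signs in the definition of `G_T` cancel the sign in the reciprocity law
  have a3 := rDiv_sign (F := F) n T₁ T₂
  rw [gVal, gVal, gVal]
  generalize (if T₁ = 0 then (1 : Fˣ) else (-1) ^ ((n : ℤ) - 1)) = e₁ at *
  generalize (if T₂ = 0 then (1 : Fˣ) else (-1) ^ ((n : ℤ) - 1)) = e₂ at *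
  generalize (if T₁ + T₂ = 0 then (1 : Fˣ) else (-1) ^ ((n : ℤ) - 1)) = e₃ at *
  have a4 : e₁ * e₂ = (e₁ * e₂ / e₃) * e₃ := by rw [div_mul_cancel]
  rw [eq_comm, ← eq_div_iff_mul_eq'] at a3
  have a5 : (ev (rDiv T₁ T₂) Q) ^ n =
      ev (rDiv T₁ T₂) (n • Q) * ((e₁ * e₂ / e₃)⁻¹ * (ev (qDiv n Q) T₁ * ev (qDiv n Q) T₂ /
        ev (qDiv n Q) (T₁ + T₂))) := by
    rw [← a3, ← a2, mul_div_cancel]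
  calc e₁ * ev (tDiv n T₁) Q / ev (qDiv n Q) T₁ * (e₂ * ev (tDiv n T₂) Q / ev (qDiv n Q) T₂) /
        (e₃ * ev (tDiv n (T₁ + T₂)) Q / ev (qDiv n Q) (T₁ + T₂))
      = (e₁ * e₂ / e₃) * (ev (tDiv n T₁) Q * ev (tDiv n T₂) Q / ev (tDiv n (T₁ + T₂)) Q) /
          (ev (qDiv n Q) T₁ * ev (qDiv n Q) T₂ / ev (qDiv n Q) (T₁ + T₂)) := by
        apply Units.ext
        push_cast
        field_simp
    _ = ev (rDiv T₁ T₂) (n • Q) := by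
        rw [a1, mul_div_cancel_left, a5]
        apply Units.ext
        push_cast
        field_simp

/-- The divisor `(S + A) - (A)`. -/
def dDiv (S A : V.Point) : V.Point →₀ ℤ := Finsupp.single (S + A) 1 - Finsupp.single A 1

omit [Infinite V.Point] in
lemma isPrin_nsmul_dDiv {n : ℕ} {S : V.Point} (hS : n • S = 0) (A : V.Point) :
    IsPrin ((n : ℤ) • dDiv S A) := by
  refine ⟨?_, ?_⟩
  · simp [dDiv]
  · simp [dDiv, hS]

omit [Infinite V.Point] in
lemma isPrin_dDiv_sub (S A A' : V.Point) : IsPrin (dDiv S A - dDiv S A') := by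
  refine ⟨?_, ?_⟩
  · simp [dDiv]
  · simp [dDiv]

omit [Infinite V.Point] in
lemma disj_dDiv {S A : V.Point} {E : V.Point →₀ ℤ} (h1 : S + A ∉ E.support)
    (h2 : A ∉ E.support) : Disj (dDiv S A) E :=
  (disj_single_left (Or.inr h1) _).sub_left (disj_single_left (Or.inr h2) _)

omit [Infinite V.Point] in
lemma notMem_support_dDiv {S A P : V.Point} (h1 : P ≠ S + A) (h2 : P ≠ A) :
    P ∉ (dDiv S A).support := by
  simp [dDiv, h1.symm, h2.symm]

/-- The value `g(D_S) / f(D_T)` of the Weil pairing computed with `D_S = (S + A) - (A)`,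
`D_T = (T + B) - (B)` and the monic functions `f`, `g` with divisors `n D_S`, `n D_T`. -/
def pairVal (n : ℕ) (S T A B : V.Point) : Fˣ :=
  evDiv ((n : ℤ) • dDiv T B) (dDiv S A) / evDiv ((n : ℤ) • dDiv S A) (dDiv T B)

omit [Infinite V.Point] in
lemma pairVal_swap (n : ℕ) (S T A B : V.Point) : pairVal n S T A B = (pairVal n T S B A)⁻¹ := by
  rw [pairVal, pairVal, inv_div]

/-- By Weil reciprocity the value of the pairing does not depend on the auxiliary point `A`. -/
lemma pairVal_eq_left {n : ℕ} {S T A A' B : V.Point} (hS : n • S = 0) (hT : n • T = 0)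
    (h : Disj (dDiv S A) (dDiv T B)) (h' : Disj (dDiv S A') (dDiv T B))
    (h0 : (dDiv S A - dDiv S A') 0 * ((n : ℤ) • dDiv T B) 0 = 0) :
    pairVal n S T A B = pairVal n S T A' B := by
  have hU := isPrin_dDiv_sub S A A'
  have hE := isPrin_nsmul_dDiv hT B
  have hUE' : Disj (dDiv S A - dDiv S A') (dDiv T B) := h.sub_left h'
  have hUE : Disj (dDiv S A - dDiv S A') ((n : ℤ) • dDiv T B) :=
    (disj_zsmul_left hUE'.symm _).symm
  have key := weil_reciprocity hU hE hUE
  rw [Recip, h0, zpow_zero, one_mul, evDiv_sub_right, natCast_zsmul, evDiv_nsmul_right,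
    ← evDiv_nsmul_left hU hUE', smul_sub,
    evDiv_sub_left (isPrin_nsmul_dDiv hS A) (isPrin_nsmul_dDiv hS A') (disj_zsmul_left h _)
      (disj_zsmul_left h' _)] at key
  rw [← natCast_zsmul, div_eq_div_iff_mul_eq_mul] at key
  rw [pairVal, pairVal, div_eq_div_iff_mul_eq_mul, ← key, mul_comm]

lemma pairVal_eq_right {n : ℕ} {S T A B B' : V.Point} (hS : n • S = 0) (hT : n • T = 0)
    (h : Disj (dDiv S A) (dDiv T B)) (h' : Disj (dDiv S A) (dDiv T B'))
    (h0 : (dDiv T B - dDiv T B') 0 * ((n : ℤ) • dDiv S A) 0 = 0) :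
    pairVal n S T A B = pairVal n S T A B' := by
  rw [pairVal_swap, pairVal_swap n S T A B', pairVal_eq_left hT hS h.symm h'.symm h0]

omit [Infinite V.Point] in
lemma disj_dDiv_dDiv {S T A B : V.Point} (h1 : S + A ≠ T + B) (h2 : S + A ≠ B) (h3 : A ≠ T + B)
    (h4 : A ≠ B) : Disj (dDiv S A) (dDiv T B) :=
  disj_dDiv (notMem_support_dDiv h1 h2) (notMem_support_dDiv h3 h4)

omit [Infinite V.Point] in
lemma dDiv_apply_zero {S A : V.Point} (h1 : S + A ≠ 0) (h2 : A ≠ 0) : dDiv S A 0 = 0 := by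
  simp [dDiv, h1, h2]

omit [Infinite V.Point] in
lemma eventually_add_ne (S c : V.Point) : ∀ᶠ Z in Filter.cofinite, S + Z ≠ c :=
  (add_right_injective S).tendsto_cofinite.eventually (Filter.eventually_cofinite_ne c)

/-- The pairing computed with the functions `G_T`. -/
lemma pairVal_eq_gVal {n : ℕ} {S T A B Q : V.Point} (hS : n • S = 0) (hT : n • T = 0)
    (hQ : n • n • Q ≠ 0) (hA : A ≠ 0) (hSA : S + A ≠ 0)
    (h1 : S + A ≠ T + B) (h2 : S + A ≠ B) (h3 : A ≠ T + B) (h4 : A ≠ B) :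
    pairVal n S T A B = gVal n (Q + S) T / gVal n Q T := by
  have hnQ : n • Q ≠ 0 := by
    intro h
    rw [h, smul_zero] at hQ
    exact hQ rfl
  have hnSQ : n • (S + Q) = n • Q := by rw [smul_add, hS, zero_add]
  have ne {A B : V.Point} (hA : n • A ≠ 0) (hB : n • B = 0) : A ≠ B := ne_of_nsmul_ne_zero' hA hB
  have hn0 : n • (0 : V.Point) = 0 := smul_zero n
  have hn1 : n • (T + 0) = 0 := by rw [add_zero, hT]
  -- the base points `A, B` are replaced by `Q, O` one at a time, through a general point `Z`,
  -- so that the supports stay disjoint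
  obtain ⟨Z, hZ⟩ := ((Filter.eventually_cofinite_ne (0 : V.Point)).and <|
    (Filter.eventually_cofinite_ne B).and <| (Filter.eventually_cofinite_ne (T + B)).and <|
    (Filter.eventually_cofinite_ne (T + 0)).and <|
    (eventually_add_ne S 0).and <| (eventually_add_ne S B).and <| (eventually_add_ne S (T + B)).and
    (eventually_add_ne S (T + 0))).exists
  obtain ⟨z1, z2, z3, z4, z5, z6, z7, z8⟩ := hZ
  have d1 : Disj (dDiv S A) (dDiv T B) := disj_dDiv_dDiv h1 h2 h3 h4
  have d2 : Disj (dDiv S Z) (dDiv T B) := disj_dDiv_dDiv z7 z6 z3 z2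
  have d3 : Disj (dDiv S Z) (dDiv T 0) := disj_dDiv_dDiv z8 z5 z4 z1
  have d4 : Disj (dDiv S Q) (dDiv T 0) :=
    disj_dDiv_dDiv (ne (by rwa [hnSQ]) hn1) (ne (by rwa [hnSQ]) hn0) (ne hnQ hn1) (ne hnQ hn0)
  have o1 := dDiv_apply_zero hSA hA
  have o2 := dDiv_apply_zero z5 z1
  have o3 : dDiv S Q 0 = 0 := dDiv_apply_zero (ne (by rwa [hnSQ]) hn0) (ne hnQ hn0)
  rw [pairVal_eq_left hS hT d1 d2 (by simp [o1, o2]),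
    pairVal_eq_right hS hT d2 d3 (by simp [o2]),
    pairVal_eq_left hS hT d3 d4 (by simp [o2, o3])]
  have e1 : (n : ℤ) • dDiv T 0 = tDiv n T := by
    simp [dDiv, tDiv, smul_sub]
  have e2 : (n : ℤ) • dDiv S Q = qDiv n (S + Q) - qDiv n Q := by
    rw [dDiv, qDiv, qDiv, hnSQ]
    simp [smul_sub]
  have e3 : ev (qDiv n (S + Q) - qDiv n Q) T = ev (qDiv n (S + Q)) T / ev (qDiv n Q) T := by
    by_cases hT0 : T = 0
    · simp [hT0]
    have m1 : T ∉ (qDiv n (S + Q)).support :=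
      notMem_support_qDiv hT0 (ne (by rwa [hnSQ]) hT).symm (by rw [hnSQ]; exact (ne hQ hT).symm)
    have m2 : T ∉ (qDiv n Q).support :=
      notMem_support_qDiv hT0 (ne hnQ hT).symm (ne hQ hT).symm
    rw [sub_eq_add_neg, ev_add (isPrin_qDiv _ _) (isPrin_qDiv _ _).neg m1
      (by rwa [Finsupp.support_neg]), ev_neg (isPrin_qDiv _ _) m2, div_eq_mul_inv]
  rw [pairVal, e1, e2, dDiv, dDiv, evDiv_sub_right, evDiv_sub_right, evDiv_single, evDiv_single,
    evDiv_single, evDiv_single, ev_zero_right, zpow_one, zpow_one, zpow_one, one_zpow, div_one,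
    add_zero, e3, gVal, gVal, add_comm Q S]
  apply Units.ext
  push_cast
  field_simp

omit [Infinite V.Point] in
lemma IsDivOf.div_eq_ev {f : V.FunctionField} {D : V.Point →₀ ℤ} (hf : IsDivOf f D)
    {P P' : V.Point} (hP : P ∉ D.support) (hP' : P' ∉ D.support) {v v' : F}
    (hv : HasValueAt f P v) (hv' : HasValueAt f P' v') :
    v / v' = ((ev D P / ev D P' : Fˣ) : F) := by
  have hD : IsPrin D := ⟨hf.1, hf.ptSum_eq_zero⟩
  obtain ⟨g, hg, hgv⟩ := hD.exists_ev hv.ne_zero hP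
  obtain ⟨g', hg', hgv'⟩ := hD.exists_ev hv'.ne_zero hP'
  obtain rfl := hg.unique hg'
  obtain ⟨c, hc, rfl⟩ := hf.eq_const_mul hg.2
  rw [hv.unique ((hasValueAt_const hv.ne_zero c).mul hgv),
    hv'.unique ((hasValueAt_const hv'.ne_zero c).mul hgv'), mul_div_mul_left _ _ hc,
    Units.val_div_eq_div_val]

omit [Infinite V.Point] in
lemma evDiv_dDiv (D : V.Point →₀ ℤ) (S A : V.Point) :
    evDiv D (dDiv S A) = ev D (S + A) / ev D A := by
  rw [dDiv, evDiv_sub_right, evDiv_single, evDiv_single, zpow_one, zpow_one]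

omit [Infinite V.Point] in
lemma notMem_zsmul_dDiv {S A P : V.Point} (m : ℤ) (h1 : P ≠ S + A) (h2 : P ≠ A) :
    P ∉ (m • dDiv S A).support :=
  fun h => notMem_support_dDiv h1 h2 (Finsupp.support_smul h)

lemma IsWeilValue.eq_gVal {n : ℕ} {S T Q : V.Point} {ζ : Fˣ} (hζ : IsWeilValue n S T ζ)
    (hS : n • S = 0) (hT : n • T = 0) (hQ : n • n • Q ≠ 0) :
    ζ = gVal n (Q + S) T / gVal n Q T := by
  obtain ⟨A, B, f, g, f₁, f₂, g₁, g₂, ⟨h1, h2, h3, h4⟩, hf, hg, hg₁, hg₂, hf₁, hf₂, hζ⟩ := hζ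
  rw [← pairVal_eq_gVal hS hT hQ hg₂.ne_zero hg₁.ne_zero h1 h2 h3 h4, pairVal, evDiv_dDiv,
    evDiv_dDiv]
  apply Units.ext
  rw [hζ, Units.val_div_eq_div_val]
  congr 1
  · exact hg.div_eq_ev (notMem_zsmul_dDiv _ h1 h2) (notMem_zsmul_dDiv _ h3 h4) hg₁ hg₂
  · exact hf.div_eq_ev (notMem_zsmul_dDiv _ h1.symm h3.symm) (notMem_zsmul_dDiv _ h2.symm h4.symm)
      hf₁ hf₂

lemma exists_isWeilValue {n : ℕ} {S T : V.Point} (hS : n • S = 0) (hT : n • T = 0) :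
    ∃ ζ : Fˣ, IsWeilValue n S T ζ := by
  obtain ⟨B, b1, b2⟩ := ((Filter.eventually_cofinite_ne (0 : V.Point)).and
    (eventually_add_ne T 0)).exists
  obtain ⟨A, hA⟩ := ((Filter.eventually_cofinite_ne (0 : V.Point)).and <|
    (Filter.eventually_cofinite_ne B).and <| (Filter.eventually_cofinite_ne (T + B)).and <|
    (eventually_add_ne S 0).and <| (eventually_add_ne S B).and <|
    (eventually_add_ne S (T + B))).exists
  obtain ⟨a1, a2, a3, a4, a5, a6⟩ := hA
  have hf := isPrin_nsmul_dDiv hS A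
  have hg := isPrin_nsmul_dDiv hT B
  obtain ⟨f, hf₁, hv₁⟩ := hf.exists_ev b2 (notMem_zsmul_dDiv _ a6.symm a3.symm)
  obtain ⟨f', hf₂, hv₂⟩ := hf.exists_ev b1 (notMem_zsmul_dDiv _ a5.symm a2.symm)
  obtain ⟨g, hg₁, hw₁⟩ := hg.exists_ev a4 (notMem_zsmul_dDiv _ a6 a5)
  obtain ⟨g', hg₂, hw₂⟩ := hg.exists_ev a1 (notMem_zsmul_dDiv _ a3 a2)
  obtain rfl := hf₁.unique hf₂
  obtain rfl := hg₁.unique hg₂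
  exact ⟨_, A, B, f, g, _, _, _, _, ⟨a6, a5, a3, a2⟩, hf₁.2, hg₁.2, hw₁, hw₂, hv₁, hv₂,
    by rw [← Units.val_div_eq_div_val, ← Units.val_div_eq_div_val, ← Units.val_div_eq_div_val]⟩

/-- The relation `G_T(Q + S) = e_n(S, T) G_T(Q)`. -/
lemma weilPairing_eq {n : ℕ} {S T Q : V.Point} (hS : n • S = 0) (hT : n • T = 0)
    (hQ : n • n • Q ≠ 0) : weilPairing n S T = gVal n (Q + S) T / gVal n Q T := by
  have h := exists_isWeilValue hS hT
  rw [weilPairing, dif_pos h]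
  exact h.choose_spec.eq_gVal hS hT hQ

lemma weilPairing_add_left {n : ℕ} {S S' T Q : V.Point} (hS : n • S = 0) (hS' : n • S' = 0)
    (hT : n • T = 0) (hQ : n • n • Q ≠ 0) :
    weilPairing n (S + S') T = weilPairing n S T * weilPairing n S' T := by
  have hSS' : n • (S + S') = 0 := by rw [smul_add, hS, hS', add_zero]
  have hQS : n • n • (Q + S) ≠ 0 := by rwa [smul_add, hS, add_zero]
  rw [weilPairing_eq hSS' hT hQ, weilPairing_eq hS hT hQ, weilPairing_eq hS' hT hQS, ← add_assoc,
    mul_comm, div_mul_div_cancel]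

lemma weilPairing_add_right {n : ℕ} {S T T' Q : V.Point} (hS : n • S = 0) (hT : n • T = 0)
    (hT' : n • T' = 0) (hQ : n • n • Q ≠ 0) :
    weilPairing n S (T + T') = weilPairing n S T * weilPairing n S T' := by
  have hTT' : n • (T + T') = 0 := by rw [smul_add, hT, hT', add_zero]
  have hQS : n • n • (Q + S) ≠ 0 := by rwa [smul_add, hS, add_zero]
  have h1 := gVal_mul_div hQ hT hT'
  have h2 := gVal_mul_div hQS hT hT'
  rw [smul_add n Q S, hS, add_zero, ← h1] at h2
  have h3 := Units.ext h2
  rw [weilPairing_eq hS hTT' hQ, weilPairing_eq hS hT hQ, weilPairing_eq hS hT' hQ,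
    div_mul_div_comm, div_eq_div_iff_mul_eq_mul]
  rw [div_eq_div_iff_mul_eq_mul] at h3
  rw [h3, mul_comm]

end WeilPairing

/-! ### Zeros of functions -/

section Zeros

open Polynomial

variable {F : Type*} [Field F] {V : WeierstrassCurve.Affine F}

lemma evalEval_smul_add {x y : F} (h : V.Equation x y) (p q : F[X]) :
    AdjoinRoot.evalEval h (p • (1 : V.CoordinateRing) + q • CoordinateRing.mk V X) =
      p.eval x + q.eval x * y := by
  rw [CoordinateRing.smul, CoordinateRing.smul, mul_one, ← map_mul, ← map_add, evalEval_mk]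
  simp [evalEval]

lemma exists_dvd_polynomial {z : V.CoordinateRing} (hz : z ≠ 0) :
    ∃ m : F[X], m ≠ 0 ∧ z ∣ algebraMap F[X] V.CoordinateRing m := by
  have : Module.Finite F[X] V.CoordinateRing := .of_basis (CoordinateRing.basis V)
  have h : IsAlgebraic F[X] z := (Algebra.IsIntegral.isIntegral z).isAlgebraic
  exact h.exists_nonzero_dvd (mem_nonZeroDivisors_of_ne_zero hz)

lemma eventually_xc_ne [DecidableEq F] (x₀ : F) :
    ∀ᶠ P : V.Point in Filter.cofinite, xc P ≠ x₀ := by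
  by_cases hex : ∃ Q : V.Point, Q ≠ 0 ∧ xc Q = x₀
  · obtain ⟨Q, hQ, rfl⟩ := hex
    filter_upwards [Filter.eventually_cofinite_ne Q, Filter.eventually_cofinite_ne (-Q),
      Filter.eventually_cofinite_ne 0] with P h1 h2 h3
    rcases P with _ | ⟨x, y, h⟩
    · exact (h3 rfl).elim
    rcases Q with _ | ⟨x', y', h'⟩
    · exact (hQ rfl).elim
    refine xc_ne_of_ne (h₁ := h) (h₂ := h') h1 fun h => h2 ?_
    rwa [add_eq_zero_iff_eq_neg] at h
  · push Not at hex
    filter_upwards [Filter.eventually_cofinite_ne 0] with P hP using hex P hP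

/-- A nonzero polynomial function vanishes at only finitely many points. -/
lemma eventually_evalEval_ne_zero [DecidableEq F] {z : V.CoordinateRing} (hz : z ≠ 0) :
    ∀ᶠ P : V.Point in Filter.cofinite, ∀ x y h, P = .some x y h →
      AdjoinRoot.evalEval h.1 z ≠ 0 := by
  obtain ⟨m, hm, w, hw⟩ := exists_dvd_polynomial hz
  have key : ∀ᶠ P : V.Point in Filter.cofinite, ∀ r ∈ m.roots.toFinset, xc P ≠ r :=
    (Filter.eventually_all_finset _).mpr fun r _ => eventually_xc_ne r
  filter_upwards [key] with P hP x y h hPxy h0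
  have h1 := congrArg (AdjoinRoot.evalEval h.1) hw
  rw [map_mul, h0, zero_mul, Algebra.algebraMap_eq_smul_one] at h1
  have h2 := evalEval_smul_add h.1 m 0
  rw [zero_smul, add_zero, h1] at h2
  refine hP x ?_ (by rw [hPxy]; rfl)
  rw [Multiset.mem_toFinset, mem_roots hm, IsRoot, h2]
  simp

lemma eq_zero_of_eventually [DecidableEq F] [Infinite V.Point] {z : V.CoordinateRing}
    (hz : ∀ᶠ P : V.Point in Filter.cofinite, ∀ x y h, P = .some x y h →
      AdjoinRoot.evalEval h.1 z = 0) : z = 0 := by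
  by_contra h0
  obtain ⟨P, h1, h2, h3⟩ := (hz.and ((eventually_evalEval_ne_zero h0).and
    (Filter.eventually_cofinite_ne 0))).exists
  rcases P with _ | ⟨x, y, h⟩
  · exact h3 rfl
  · exact h2 x y h rfl (h1 x y h rfl)

end Zeros

/-! ### Galois equivariance -/

section Equivariance

variable {K : Type*} [Field K] {W : WeierstrassCurve K} {Ω : Type*} [Field Ω] [Algebra K Ω]
  [DecidableEq Ω]

lemma xc_gal (σ : Ω ≃ₐ[K] Ω) (P : (W⁄Ω).Point) : xc (gal W σ P) = σ (xc P) := by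
  rcases P with _ | ⟨x, y, h⟩
  · exact (map_zero σ).symm
  · rfl

lemma yc_gal (σ : Ω ≃ₐ[K] Ω) (P : (W⁄Ω).Point) : yc (gal W σ P) = σ (yc P) := by
  rcases P with _ | ⟨x, y, h⟩
  · exact (map_zero σ).symm
  · rfl

lemma gal_injective (σ : Ω ≃ₐ[K] Ω) : Function.Injective (gal W σ) :=
  Point.map_injective _

lemma gal_mul (σ τ : Ω ≃ₐ[K] Ω) (P : (W⁄Ω).Point) : gal W (σ * τ) P = gal W σ (gal W τ P) := by
  rcases P with _ | ⟨x, y, h⟩ <;> rfl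

lemma gal_one (P : (W⁄Ω).Point) : gal W (1 : Ω ≃ₐ[K] Ω) P = P := by
  rcases P with _ | ⟨x, y, h⟩ <;> rfl

lemma gal_inv_gal (σ : Ω ≃ₐ[K] Ω) (P : (W⁄Ω).Point) : gal W σ⁻¹ (gal W σ P) = P := by
  rw [← gal_mul, inv_mul_cancel, gal_one]

lemma gal_gal_inv (σ : Ω ≃ₐ[K] Ω) (P : (W⁄Ω).Point) : gal W σ (gal W σ⁻¹ P) = P := by
  rw [← gal_mul, mul_inv_cancel, gal_one]

lemma rVal_gal (σ : Ω ≃ₐ[K] Ω) (A B P : (W⁄Ω).Point) :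
    rVal (gal W σ A) (gal W σ B) (gal W σ P) = σ (rVal A B P) := by
  have h0 (Q : (W⁄Ω).Point) : gal W σ Q = 0 ↔ Q = 0 := map_eq_zero_iff _ (gal_injective σ)
  have hs := baseChange_slope (W' := W) (σ : Ω →ₐ[K] Ω) (xc A) (xc B) (yc A) (yc B)
  simp only [AlgEquiv.coe_toAlgHom] at hs
  simp only [rVal, ← map_add, ← map_neg, h0, xc_gal, yc_gal, hs]
  split_ifs <;> simp

/-- The action of `σ` on divisors. -/
def galDiv (W : WeierstrassCurve K) (σ : Ω ≃ₐ[K] Ω) :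
    ((W⁄Ω).Point →₀ ℤ) →+ ((W⁄Ω).Point →₀ ℤ) :=
  Finsupp.mapDomain.addMonoidHom (gal W σ)

@[simp] lemma galDiv_single (σ : Ω ≃ₐ[K] Ω) (P : (W⁄Ω).Point) (m : ℤ) :
    galDiv W σ (Finsupp.single P m) = Finsupp.single (gal W σ P) m :=
  Finsupp.mapDomain_single

lemma galDiv_apply_gal (σ : Ω ≃ₐ[K] Ω) (D : (W⁄Ω).Point →₀ ℤ) (P : (W⁄Ω).Point) :
    galDiv W σ D (gal W σ P) = D P :=
  Finsupp.mapDomain_apply (gal_injective σ) D P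

lemma gal_notMem_support (σ : Ω ≃ₐ[K] Ω) {D : (W⁄Ω).Point →₀ ℤ} {P : (W⁄Ω).Point}
    (h : P ∉ D.support) : gal W σ P ∉ (galDiv W σ D).support := by
  rwa [Finsupp.notMem_support_iff, galDiv_apply_gal, ← Finsupp.notMem_support_iff]

lemma galDiv_eq_self {D : (W⁄Ω).Point →₀ ℤ} (hD : D ∈ DivK W Ω) (σ : Ω ≃ₐ[K] Ω) :
    galDiv W σ D = D := by
  ext P
  rw [← gal_gal_inv σ P, galDiv_apply_gal, hD σ]

lemma degHom_galDiv (σ : Ω ≃ₐ[K] Ω) (D : (W⁄Ω).Point →₀ ℤ) : degHom (galDiv W σ D) = degHom D := by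
  have h : degHom.comp (galDiv W σ) = degHom := by
    ext P
    simp
  exact DFunLike.congr_fun h D

lemma ptSum_galDiv (σ : Ω ≃ₐ[K] Ω) (D : (W⁄Ω).Point →₀ ℤ) :
    ptSum (galDiv W σ D) = gal W σ (ptSum D) := by
  have h : ptSum.comp (galDiv W σ) = (gal W σ).comp ptSum := by
    ext P
    simp
  exact DFunLike.congr_fun h D

lemma IsPrin.galDiv {D : (W⁄Ω).Point →₀ ℤ} (hD : IsPrin D) (σ : Ω ≃ₐ[K] Ω) :
    IsPrin (galDiv W σ D) :=
  ⟨by rw [degHom_galDiv, hD.1], by rw [ptSum_galDiv, hD.2, map_zero]⟩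

lemma galDiv_rDiv (σ : Ω ≃ₐ[K] Ω) (A B : (W⁄Ω).Point) :
    galDiv W σ (rDiv A B) = rDiv (gal W σ A) (gal W σ B) := by
  simp [rDiv]

variable [Infinite (W⁄Ω).Point]

/-- Galois equivariance of the values of monic functions: by additivity it is enough to consider
the functions `r_{A,B}`, for which there is an explicit formula. -/
lemma ev_galDiv (σ : Ω ≃ₐ[K] Ω) {D : (W⁄Ω).Point →₀ ℤ} (hD : IsPrin D) {P : (W⁄Ω).Point}
    (hP : P ∉ D.support) : (ev (galDiv W σ D) (gal W σ P) : Ω) = σ (ev D P) := by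
  by_cases hP0 : P = 0
  · simp [hP0]
  have key : ∀ᶠ Z in Filter.cofinite, P ∉ (chain D Z).support ∧
      (ev (galDiv W σ (chain D Z)) (gal W σ P) : Ω) = σ (ev (chain D Z) P) := by
    refine div_induction (p := fun D => ∀ᶠ Z in Filter.cofinite, P ∉ (chain D Z).support ∧
      (ev (galDiv W σ (chain D Z)) (gal W σ P) : Ω) = σ (ev (chain D Z) P)) D ?_ ?_ ?_ ?_
    · simp [chain_zero]
    · intro D E h h'
      filter_upwards [h, eventually_add_right h' (ptSum D)] with Z h1 h2
      have h3 : P ∉ (chain D Z + chain E (Z + ptSum D)).support := by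
        simp only [Finsupp.notMem_support_iff, Finsupp.add_apply] at h1 h2 ⊢
        rw [h1.1, h2.1, add_zero]
      rw [chain_add]
      refine ⟨h3, ?_⟩
      rw [map_add, ev_add ((isPrin_chain _ _).galDiv σ) ((isPrin_chain _ _).galDiv σ)
        (gal_notMem_support σ h1.1) (gal_notMem_support σ h2.1),
        ev_add (isPrin_chain _ _) (isPrin_chain _ _) h1.1 h2.1, Units.val_mul, Units.val_mul,
        map_mul, h1.2, h2.2]
    · intro D h
      filter_upwards [eventually_add_right h (-ptSum D)] with Z h1
      rw [← sub_eq_add_neg] at h1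
      rw [chain_neg, Finsupp.support_neg]
      refine ⟨h1.1, ?_⟩
      rw [map_neg, ev_neg ((isPrin_chain _ _).galDiv σ) (gal_notMem_support σ h1.1),
        ev_neg (isPrin_chain _ _) h1.1, Units.val_inv_eq_inv_val, Units.val_inv_eq_inv_val,
        map_inv₀, h1.2]
    · intro R hR
      have hRP : P ≠ R := by
        rintro rfl
        exact hP hR
      by_cases hR0 : R = 0
      · simp [chain_single, hR0]
      filter_upwards [Filter.eventually_cofinite_ne P, eventually_add_ne R P,
        eventually_add_ne R (-P)] with Z h1 h2 h3
      have h3' : P ≠ -(R + Z) := fun h => h3 (by rw [h, neg_neg])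
      have hne {A B : (W⁄Ω).Point} (h : A ≠ B) : gal W σ A ≠ gal W σ B :=
        (gal_injective σ).ne h
      rw [chain_single]
      refine ⟨notMem_support_rDiv hP0 hRP h1.symm h2.symm, ?_⟩
      rw [galDiv_rDiv, ev_rDiv hP0 hRP h1.symm h2.symm h3',
        ev_rDiv (by simpa using hne hP0) (hne hRP) (hne h1.symm) (by simpa using hne h2.symm)
          (by simpa using hne h3'), rVal_gal]
  simp only [hD.chain_eq] at key
  exact (Filter.eventually_const.mp key).2

omit [Infinite (W⁄Ω).Point] in
lemma galDiv_tDiv (σ : Ω ≃ₐ[K] Ω) (n : ℕ) (T : (W⁄Ω).Point) :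
    galDiv W σ (tDiv n T) = tDiv n (gal W σ T) := by
  simp [tDiv]

omit [Infinite (W⁄Ω).Point] in
lemma galDiv_qDiv (σ : Ω ≃ₐ[K] Ω) (n : ℕ) (Q : (W⁄Ω).Point) :
    galDiv W σ (qDiv n Q) = qDiv n (gal W σ Q) := by
  simp [qDiv]

lemma gVal_gal (σ : Ω ≃ₐ[K] Ω) {n : ℕ} {Q T : (W⁄Ω).Point} (hQ : n • n • Q ≠ 0)
    (hT : n • T = 0) : (gVal n (gal W σ Q) (gal W σ T) : Ω) = σ (gVal n Q T) := by
  have hnQ : n • Q ≠ 0 := by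
    intro h
    rw [h, smul_zero] at hQ
    exact hQ rfl
  have hQ0 : Q ≠ 0 := by
    rintro rfl
    simp at hQ
  have h0 : gal W σ T = 0 ↔ T = 0 := map_eq_zero_iff _ (gal_injective σ)
  by_cases hT0 : T = 0
  · simp [gVal, hT0, tDiv]
  have h1 := ev_galDiv σ (isPrin_tDiv hT)
    (notMem_support_tDiv (n := n) hQ0 (ne_of_nsmul_ne_zero' hnQ hT))
  have h2 := ev_galDiv σ (isPrin_qDiv n Q)
    (notMem_support_qDiv (n := n) hT0 (ne_of_nsmul_ne_zero' hnQ hT).symm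
      (ne_of_nsmul_ne_zero' hQ hT).symm)
  rw [galDiv_tDiv] at h1
  rw [galDiv_qDiv] at h2
  rw [gVal, gVal, if_neg hT0, if_neg (mt h0.mp hT0), Units.val_div_eq_div_val,
    Units.val_div_eq_div_val, Units.val_mul, Units.val_mul, h1, h2, map_div₀, map_mul]
  congr 2
  rw [Units.val_zpow_eq_zpow_val, map_zpow₀]
  simp

/-- Galois equivariance of the Weil pairing. -/
lemma weilPairing_gal (σ : Ω ≃ₐ[K] Ω) {n : ℕ} {S T Q : (W⁄Ω).Point} (hS : n • S = 0)
    (hT : n • T = 0) (hQ : n • n • Q ≠ 0) :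
    (weilPairing n (gal W σ S) (gal W σ T) : Ω) = σ (weilPairing n S T) := by
  have hS' : n • gal W σ S = 0 := by rw [← map_nsmul, hS, map_zero]
  have hT' : n • gal W σ T = 0 := by rw [← map_nsmul, hT, map_zero]
  have hQ' : n • n • gal W σ Q ≠ 0 := by
    rw [← map_nsmul, ← map_nsmul]
    exact fun h => hQ ((map_eq_zero_iff _ (gal_injective σ)).mp h)
  have hQS : n • n • (Q + S) ≠ 0 := by rwa [smul_add, hS, add_zero]
  rw [weilPairing_eq hS' hT' hQ', weilPairing_eq hS hT hQ, Units.val_div_eq_div_val,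
    Units.val_div_eq_div_val, ← map_add, gVal_gal σ hQS hT, gVal_gal σ hQ hT, map_div₀]

end Equivariance

/-! ### Descent of functions with rational divisor -/

section Descent

open Polynomial

variable {K : Type*} [Field K] {W : WeierstrassCurve K} {Ω : Type*} [Field Ω] [Algebra K Ω]
  [DecidableEq Ω] [IsSepClosure K Ω]

omit [DecidableEq Ω] in
lemma exists_algebraMap_eq_of_fixed {a : Ω} (h : ∀ σ : Ω ≃ₐ[K] Ω, σ a = a) :
    ∃ b : K, algebraMap K Ω b = a := by
  have : a ∈ (⊥ : IntermediateField K Ω) := (InfiniteGalois.mem_bot_iff_fixed a).mpr h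
  exact IntermediateField.mem_bot.mp this

omit [DecidableEq Ω] in
lemma exists_map_eq_of_fixed {p : Polynomial Ω} (h : ∀ σ : Ω ≃ₐ[K] Ω, p.map (σ : Ω →+* Ω) = p) :
    ∃ q : Polynomial K, q.map (algebraMap K Ω) = p := by
  have : p ∈ lifts (algebraMap K Ω) := by
    rw [lifts_iff_coeff_lifts]
    intro i
    refine exists_algebraMap_eq_of_fixed fun σ => ?_
    have := congrArg (fun q => coeff q i) (h σ)
    simpa using this
  exact this

omit [DecidableEq Ω] [IsSepClosure K Ω] in
lemma eval_map_gal (σ : Ω ≃ₐ[K] Ω) (p : Polynomial Ω) (x : Ω) :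
    (p.map (σ : Ω →+* Ω)).eval (σ x) = σ (p.eval x) := by
  simpa using eval_map_apply (σ : Ω →+* Ω) x (p := p)

/-- The monic function of a Galois invariant principal divisor is rational over `K`: written as
`(p + qY) / m` with `m` monic of minimal degree, its coefficients are Galois invariant, since
the values of the function are. -/
lemma isRationalOver_of_isFn [Infinite (W⁄Ω).Point] {D : (W⁄Ω).Point →₀ ℤ} (hD : D ∈ DivK W Ω)
    {f : (W⁄Ω).FunctionField} (hf : IsFn f D) : IsRationalOver W Ω f := by
  classical
  have hDp : IsPrin D := ⟨hf.2.1, hf.2.ptSum_eq_zero⟩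
  -- the possible monic denominators of `f`; the one of least degree is unique
  let J : Set (Polynomial Ω) := {m | m.Monic ∧ ∃ a : (W⁄Ω).CoordinateRing,
    f * algebraMap _ (W⁄Ω).FunctionField (algebraMap (Polynomial Ω) (W⁄Ω).CoordinateRing m) =
      algebraMap _ _ a}
  have hJ : J.Nonempty := by
    obtain ⟨a, b, ha, hb, hab, -⟩ := hf.1
    obtain ⟨m, hm, w, hw⟩ := exists_dvd_polynomial hb
    refine ⟨m * C m.leadingCoeff⁻¹, monic_mul_leadingCoeff_inv hm,
      a * w * algebraMap (Polynomial Ω) _ (C m.leadingCoeff⁻¹), ?_⟩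
    rw [map_mul, hw, map_mul, map_mul, map_mul, map_mul, ← hab]
    ring
  obtain ⟨m, ⟨hm1, a, ha⟩, hmin⟩ := exists_minimalFor_of_wellFoundedLT (· ∈ J) natDegree hJ
  have huniq : ∀ m' ∈ J, m'.natDegree = m.natDegree → m' = m := by
    rintro m' ⟨hm', a', ha'⟩ hdeg
    by_contra hne
    have hd : m' - m ≠ 0 := sub_ne_zero.mpr hne
    have hdJ : (m' - m) * C (m' - m).leadingCoeff⁻¹ ∈ J := by
      refine ⟨monic_mul_leadingCoeff_inv hd,
        (a' - a) * algebraMap (Polynomial Ω) _ (C (m' - m).leadingCoeff⁻¹), ?_⟩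
      rw [map_mul, map_sub, map_mul, map_mul, map_sub, map_sub, ← ha, ← ha']
      ring
    have hlt : ((m' - m) * C (m' - m).leadingCoeff⁻¹).natDegree < m.natDegree := by
      rw [natDegree_mul_leadingCoeff_inv _ hd]
      refine natDegree_lt_natDegree hd ?_
      have hdeg' : m'.degree = m.degree := by
        rw [degree_eq_natDegree hm'.ne_zero, degree_eq_natDegree hm1.ne_zero, hdeg]
      rw [← hdeg']
      exact degree_sub_lt_left hdeg' hm'.ne_zero (by rw [hm'.leadingCoeff, hm1.leadingCoeff])
    exact (hmin hdJ hlt.le).not_gt hlt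
  have hinj := IsFractionRing.injective (W⁄Ω).CoordinateRing (W⁄Ω).FunctionField
  -- off the support of `D`, the values of `f` are those of `(p + qY) / m`
  have hval (P : (W⁄Ω).Point) (hP : P ∉ D.support) (x y : Ω) (h : (W⁄Ω).Nonsingular x y)
      (hPxy : P = .some x y h) : (ev D P : Ω) * m.eval x =
        (coordP a).eval x + (coordQ a).eval x * y := by
    subst hPxy
    obtain ⟨g, hg, hv⟩ := hDp.exists_ev (by rintro ⟨⟩) hP
    obtain rfl := hg.unique hf
    have h1 := hv.mul (hasValueAt_algebraMap h (algebraMap (Polynomial Ω) _ m))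
    rw [ha] at h1
    have h2 := h1.unique (hasValueAt_algebraMap h a)
    have h3 := evalEval_smul_add h.1 m 0
    rw [zero_smul, add_zero, ← Algebra.algebraMap_eq_smul_one] at h3
    rw [h3, ← coord_eq a, evalEval_smul_add] at h2
    simpa using h2
  -- the conjugate of `(p + qY) / m` has the same values, hence is the same function, and its
  -- denominator has the same degree
  have hfix (σ : Ω ≃ₐ[K] Ω) : m.map (σ : Ω →+* Ω) = m ∧ (coordP a).map (σ : Ω →+* Ω) = coordP a ∧
      (coordQ a).map (σ : Ω →+* Ω) = coordQ a := by
    let a' : (W⁄Ω).CoordinateRing := (coordP a).map (σ : Ω →+* Ω) • 1 +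
      (coordQ a).map (σ : Ω →+* Ω) • CoordinateRing.mk (W⁄Ω) X
    have h1 : (coordP a * m.map (σ : Ω →+* Ω) - (coordP a).map (σ : Ω →+* Ω) * m) •
        (1 : (W⁄Ω).CoordinateRing) + (coordQ a * m.map (σ : Ω →+* Ω) -
          (coordQ a).map (σ : Ω →+* Ω) * m) • CoordinateRing.mk (W⁄Ω) X = 0 := by
      apply eq_zero_of_eventually
      have hsupp : ∀ᶠ P in Filter.cofinite, P ∉ D.support :=
        D.support.eventually_cofinite_notMem
      filter_upwards [hsupp] with P hP x y h hPxy
      have hP' : gal W σ⁻¹ P ∉ D.support := by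
        rw [Finsupp.notMem_support_iff] at hP ⊢
        rwa [hD]
      rw [evalEval_smul_add]
      have e1 := hval P hP x y h hPxy
      have e2 := hval _ hP' (σ⁻¹ x) (σ⁻¹ y)
        ((W.toAffine.baseChange_nonsingular (f := ((σ⁻¹ : Ω ≃ₐ[K] Ω) : Ω →ₐ[K] Ω))
          (σ⁻¹ : Ω ≃ₐ[K] Ω).injective ..).mpr h) (by rw [hPxy]; rfl)
      have e3 := ev_galDiv σ hDp hP'
      rw [galDiv_eq_self hD, gal_gal_inv] at e3
      have e4 := congrArg σ e2
      have hσ (u : Ω) : σ (σ⁻¹ u) = u := σ.apply_symm_apply u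
      rw [map_mul, ← e3, map_add, map_mul, ← eval_map_gal, ← eval_map_gal, ← eval_map_gal, hσ,
        hσ] at e4
      rw [eval_sub, eval_sub, eval_mul, eval_mul, eval_mul, eval_mul]
      linear_combination (m.eval x) * e4 - (m.map (σ : Ω →+* Ω)).eval x * e1
    have h2 := CoordinateRing.smul_basis_eq_zero h1
    have h3 : f * algebraMap _ (W⁄Ω).FunctionField
        (algebraMap (Polynomial Ω) (W⁄Ω).CoordinateRing (m.map (σ : Ω →+* Ω))) =
          algebraMap _ _ a' := by
      have hm0 : algebraMap (W⁄Ω).CoordinateRing (W⁄Ω).FunctionField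
          (algebraMap (Polynomial Ω) (W⁄Ω).CoordinateRing m) ≠ 0 := by
        rw [Ne, map_eq_zero_iff _ hinj, map_eq_zero_iff _ (FaithfulSMul.algebraMap_injective _ _)]
        exact hm1.ne_zero
      apply mul_right_cancel₀ hm0
      rw [mul_right_comm, ha, ← map_mul, ← map_mul]
      congr 1
      rw [mul_comm, mul_comm a', ← Algebra.smul_def, ← Algebra.smul_def]
      conv_lhs => rw [← coord_eq a]
      simp only [a', smul_add, smul_smul]
      rw [mul_comm _ (coordP a), mul_comm _ (coordQ a), sub_eq_zero.mp h2.1, sub_eq_zero.mp h2.2,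
        mul_comm m, mul_comm m]
    have h4 : m.map (σ : Ω →+* Ω) = m := by
      refine huniq _ ⟨hm1.map _, a', h3⟩ ?_
      rw [natDegree_map]
    rw [h4, ha] at h3
    have h5 := hinj h3
    refine ⟨h4, ?_, ?_⟩
    · conv_rhs => rw [h5, coordP_smul_add]
    · conv_rhs => rw [h5, coordQ_smul_add]
  obtain ⟨m₀, hm₀⟩ := exists_map_eq_of_fixed fun σ => (hfix σ).1
  obtain ⟨p₀, hp₀⟩ := exists_map_eq_of_fixed fun σ => (hfix σ).2.1
  obtain ⟨q₀, hq₀⟩ := exists_map_eq_of_fixed fun σ => (hfix σ).2.2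
  refine ⟨p₀ • 1 + q₀ • CoordinateRing.mk W X, algebraMap (Polynomial K) _ m₀, ?_, ?_⟩
  · rw [Ne, map_eq_zero_iff _ (FaithfulSMul.algebraMap_injective _ _)]
    rintro rfl
    rw [Polynomial.map_zero] at hm₀
    exact hm1.ne_zero hm₀.symm
  · have e1 : CoordinateRing.map W (algebraMap K Ω) (algebraMap (Polynomial K) _ m₀) =
        algebraMap (Polynomial Ω) (W⁄Ω).CoordinateRing m := by
      rw [Algebra.algebraMap_eq_smul_one, CoordinateRing.map_smul, map_one, hm₀,
        Algebra.algebraMap_eq_smul_one]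
      rfl
    have e2 : CoordinateRing.map W (algebraMap K Ω) (p₀ • 1 + q₀ • CoordinateRing.mk W X) = a := by
      rw [map_add, CoordinateRing.map_smul, CoordinateRing.map_smul, map_one,
        CoordinateRing.map_mk, map_X, hp₀, hq₀]
      exact coord_eq a
    rw [e1, e2]
    exact ha

/-- A Galois invariant divisor of degree zero and sum zero is the divisor of a function over
`K`. -/
lemma mem_prinK [Infinite (W⁄Ω).Point] {D : Div0K W Ω} (hD : ptSum D.1 = 0) : D ∈ PrinK W Ω := by
  have hDp : IsPrin D.1 := ⟨D.2.2, hD⟩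
  obtain ⟨f, hf⟩ := hDp.exists_isFn
  exact AddSubgroup.subset_closure ⟨f, isRationalOver_of_isFn D.2.1 hf, hf.2⟩

omit [IsSepClosure K Ω] in
lemma ptSum_eq_zero_of_mem_prinK {D : Div0K W Ω} (hD : D ∈ PrinK W Ω) : ptSum D.1 = 0 := by
  have h : PrinK W Ω ≤ (ptSum.comp (AddSubgroup.subtype (Div0K W Ω))).ker := by
    rw [PrinK, AddSubgroup.closure_le]
    rintro E ⟨f, -, hf⟩
    exact hf.ptSum_eq_zero
  exact h hD

end Descent

/-! ### The invariant differential -/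

section Omega

variable {L : Type*} [Field L] {U : WeierstrassCurve.Affine L}

/-- The invariant differential `ω = dx / (2y + a₁x + a₃) = dy / (3x² + 2a₂x + a₄ - a₁y)` takes the
value `u` at the derivation `d` of the field `L` and the point `P` with coordinates in `L`. -/
def IsOmega (d : Derivation ℤ L L) : U.Point → L → Prop
  | .zero, u => u = 0
  | .some x y _, u => d x = u * (2 * y + U.a₁ * x + U.a₃) ∧
      d y = u * (3 * x ^ 2 + 2 * U.a₂ * x + U.a₄ - U.a₁ * y)

/-- The derivation `d` vanishes on the coefficients of the curve. -/
def KillsCoeffs (U : WeierstrassCurve.Affine L) (d : Derivation ℤ L L) : Prop :=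
  d U.a₁ = 0 ∧ d U.a₂ = 0 ∧ d U.a₃ = 0 ∧ d U.a₄ = 0

variable [DecidableEq L]

/-- The relations between the abscissas of three collinear points. -/
lemma slope_relation {x₁ x₂ y₁ y₂ : L} (h₁ : U.Equation x₁ y₁) (h₂ : U.Equation x₂ y₂)
    (hxy : ¬(x₁ = x₂ ∧ y₁ = U.negY x₂ y₂)) {l x₃ : L} (hl : l = U.slope x₁ x₂ y₁ y₂)
    (hx₃ : x₃ = U.addX x₁ x₂ l) :
    x₁ * x₂ + x₁ * x₃ + x₂ * x₃ =
      2 * x₁ * l ^ 2 + (U.a₁ * x₁ - 2 * y₁ - U.a₃) * l + (-U.a₁ * y₁ + U.a₄) := by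
  have h := addPolynomial_slope h₁ h₂ hxy
  rw [← hl, ← hx₃, addPolynomial_eq, neg_inj, Cubic.prod_X_sub_C_eq, Cubic.toPoly_injective] at h
  have := congrArg Cubic.c h
  simpa using this.symm

lemma slope_mul {x₁ x₂ y₁ y₂ : L} (h₁ : U.Equation x₁ y₁) (h₂ : U.Equation x₂ y₂)
    (hxy : ¬(x₁ = x₂ ∧ y₁ = U.negY x₂ y₂)) :
    U.slope x₁ x₂ y₁ y₂ * (x₁ - x₂) = y₁ - y₂ := by
  by_cases hx : x₁ = x₂
  · rw [Y_eq_of_Y_ne h₁ h₂ hx fun h => hxy ⟨hx, h⟩, hx, sub_self, sub_self, mul_zero]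
  · rw [slope_of_X_ne hx, div_mul_cancel₀ _ (sub_ne_zero.mpr hx)]

/-- The differential of the slope of the line through two points. -/
lemma deriv_slope {d : Derivation ℤ L L} (hd : KillsCoeffs U d) {x₁ x₂ y₁ y₂ u₁ u₂ : L}
    (h₁ : U.Nonsingular x₁ y₁) (h₂ : U.Nonsingular x₂ y₂) (hxy : ¬(x₁ = x₂ ∧ y₁ = U.negY x₂ y₂))
    (hu₁ : IsOmega d (.some x₁ y₁ h₁) u₁) (hu₂ : IsOmega d (.some x₂ y₂ h₂) u₂) {l x₃ : L}
    (hl : l = U.slope x₁ x₂ y₁ y₂) (hx₃ : x₃ = U.addX x₁ x₂ l) :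
    d l = u₁ * (x₁ - x₃) + u₂ * (x₂ - x₃) := by
  obtain ⟨d1, d2, d3, d4⟩ := hd
  obtain ⟨p1, q1⟩ := hu₁
  obtain ⟨p2, q2⟩ := hu₂
  have hr := slope_relation h₁.1 h₂.1 hxy hl hx₃
  have hm := slope_mul h₁.1 h₂.1 hxy
  rw [← hl] at hm
  rw [addX] at hx₃
  by_cases hx : x₁ = x₂
  · have hy : y₁ ≠ U.negY x₂ y₂ := fun h => hxy ⟨hx, h⟩
    have hyy := Y_eq_of_Y_ne h₁.1 h₂.1 hx hy
    subst hx hyy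
    have he : 2 * y₁ + U.a₁ * x₁ + U.a₃ ≠ 0 := by
      intro h
      apply hy
      rw [negY]
      linear_combination h
    rw [slope_of_Y_ne rfl hy, negY] at hl
    have hle : l * (2 * y₁ + U.a₁ * x₁ + U.a₃) =
        3 * x₁ ^ 2 + 2 * U.a₂ * x₁ + U.a₄ - U.a₁ * y₁ := by
      rw [hl, div_mul_eq_mul_div, div_eq_iff (by convert he using 1; ring)]
      ring
    have hdl := congrArg d hle
    have huu : u₁ = u₂ := by
      rw [p1] at p2
      exact mul_right_cancel₀ he p2
    subst huu
    have two : d (2 : L) = 0 := by exact_mod_cast d.map_natCast 2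
    have three : d (3 : L) = 0 := by exact_mod_cast d.map_natCast 3
    simp only [map_add, map_sub, Derivation.leibniz, Derivation.leibniz_pow, smul_eq_mul, d1, d2,
      d3, d4, two, three, p1, q1] at hdl
    apply mul_right_cancel₀ he
    simp only [nsmul_eq_mul] at hdl
    push_cast at hdl
    subst hx₃
    linear_combination hdl + (2 * u₁ * l + u₁ * U.a₁) * hle
  · have hx' : x₁ - x₂ ≠ 0 := sub_ne_zero.mpr hx
    have hdl := congrArg d hm
    simp only [map_sub, Derivation.leibniz, smul_eq_mul, p1, p2, q1, q2] at hdl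
    apply mul_right_cancel₀ hx'
    have hy2 : y₂ = y₁ - l * (x₁ - x₂) := by rw [hm]; ring
    subst hy2
    have ha4 : U.a₄ = x₁ * x₂ + x₁ * x₃ + x₂ * x₃ -
      (2 * x₁ * l ^ 2 + (U.a₁ * x₁ - 2 * y₁ - U.a₃) * l - U.a₁ * y₁) := by
      linear_combination -hr
    rw [ha4] at hdl
    subst hx₃
    linear_combination hdl

/-- The invariant differential is additive. -/
lemma IsOmega.add {d : Derivation ℤ L L} (hd : KillsCoeffs U d) {P₁ P₂ : U.Point} {u₁ u₂ : L}
    (hu₁ : IsOmega d P₁ u₁) (hu₂ : IsOmega d P₂ u₂) : IsOmega d (P₁ + P₂) (u₁ + u₂) := by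
  rcases P₁ with _ | ⟨x₁, y₁, h₁⟩
  · have h0 : u₁ = 0 := hu₁
    rw [h0, zero_add]
    exact (zero_add P₂).symm ▸ hu₂
  rcases P₂ with _ | ⟨x₂, y₂, h₂⟩
  · have h0 : u₂ = 0 := hu₂
    rw [h0, add_zero]
    exact (add_zero (Point.some x₁ y₁ h₁)).symm ▸ hu₁
  by_cases hxy : x₁ = x₂ ∧ y₁ = U.negY x₂ y₂
  · rw [Point.add_of_Y_eq hxy.1 hxy.2]
    obtain ⟨p1, q1⟩ := hu₁
    obtain ⟨p2, q2⟩ := hu₂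
    obtain ⟨d1, d2, d3, d4⟩ := hd
    obtain ⟨hx, hy⟩ := hxy
    subst hx
    rw [negY] at hy
    have hdy := congrArg d hy
    simp only [map_sub, map_neg, Derivation.leibniz, smul_eq_mul, d1, d3, p2, q1, q2] at hdy
    -- the sum is `O`; one of the two partial derivatives does not vanish, which forces `u₁ + u₂ = 0`
    have e1 : (u₁ + u₂) * (2 * y₂ + U.a₁ * x₁ + U.a₃) = 0 := by
      rw [p1, hy] at p2
      linear_combination -p2
    have e2 : (u₁ + u₂) * (U.a₁ * y₂ - (3 * x₁ ^ 2 + 2 * U.a₂ * x₁ + U.a₄)) = 0 := by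
      rw [hy] at hdy
      linear_combination -hdy + U.a₁ * e1
    change u₁ + u₂ = 0
    rcases ((nonsingular_iff' x₁ y₂).mp h₂).2 with h | h
    · exact (mul_eq_zero.mp e2).resolve_right h
    · exact (mul_eq_zero.mp e1).resolve_right h
  · have hdl := deriv_slope hd h₁ h₂ hxy hu₁ hu₂ rfl rfl
    have hr := slope_relation h₁.1 h₂.1 hxy rfl rfl
    have hm := slope_mul h₁.1 h₂.1 hxy
    rw [Point.add_some hxy]
    obtain ⟨p1, q1⟩ := hu₁
    obtain ⟨p2, q2⟩ := hu₂
    obtain ⟨d1, d2, d3, d4⟩ := hd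
    change d (U.addX x₁ x₂ (U.slope x₁ x₂ y₁ y₂)) = _ * (_ + U.a₁ * _ + U.a₃) ∧
      d (U.addY x₁ x₂ y₁ (U.slope x₁ x₂ y₁ y₂)) = _ * (_ + U.a₄ - U.a₁ * _)
    generalize U.slope x₁ x₂ y₁ y₂ = l at *
    have hx₃ : U.addX x₁ x₂ l = l ^ 2 + U.a₁ * l - U.a₂ - x₁ - x₂ := rfl
    have hy₃ : U.addY x₁ x₂ y₁ l = -(l * (U.addX x₁ x₂ l - x₁) + y₁) - U.a₁ * U.addX x₁ x₂ l -
      U.a₃ := rfl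
    generalize U.addX x₁ x₂ l = x₃ at *
    generalize U.addY x₁ x₂ y₁ l = y₃ at *
    have hy2 : y₂ = y₁ - l * (x₁ - x₂) := by rw [hm]; ring
    have hdx : d x₃ = (u₁ + u₂) * (2 * y₃ + U.a₁ * x₃ + U.a₃) := by
      have := congrArg d hx₃
      simp only [map_sub, map_add, Derivation.leibniz, Derivation.leibniz_pow, smul_eq_mul,
        nsmul_eq_mul, d1, d2, p1, p2, hdl] at this
      push_cast at this
      rw [this, hy2, hy₃]
      ring
    refine ⟨hdx, ?_⟩
    have := congrArg d hy₃
    simp only [map_sub, map_add, map_neg, Derivation.leibniz, smul_eq_mul, d1, d3, p1, q1, hdl,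
      hdx] at this
    rw [this, hy₃]
    have ha4 : U.a₄ = x₁ * x₂ + x₁ * x₃ + x₂ * x₃ -
      (2 * x₁ * l ^ 2 + (U.a₁ * x₁ - 2 * y₁ - U.a₃) * l - U.a₁ * y₁) := by
      linear_combination -hr
    have ha2 : U.a₂ = l ^ 2 + U.a₁ * l - x₃ - x₁ - x₂ := by linear_combination hx₃
    rw [ha4, ha2]
    ring

lemma IsOmega.nsmul {d : Derivation ℤ L L} (hd : KillsCoeffs U d) {P : U.Point} {u : L}
    (hu : IsOmega d P u) (n : ℕ) : IsOmega d (n • P) (n * u) := by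
  induction n with
  | zero =>
    rw [zero_smul, Nat.cast_zero, zero_mul]
    exact rfl
  | succ n ih =>
    rw [succ_nsmul, Nat.cast_succ, add_mul, one_mul]
    exact ih.add hd hu

end Omega

/-! ### The generic point and its specializations -/

section GenericPoint

open Polynomial

variable {F : Type*} [Field F] (V : WeierstrassCurve.Affine F)

/-- The coordinate function `x`. -/
def xFn : V.FunctionField :=
  algebraMap V.CoordinateRing V.FunctionField (CoordinateRing.mk V (C X))

/-- The coordinate function `y`. -/
def yFn : V.FunctionField :=
  algebraMap V.CoordinateRing V.FunctionField (CoordinateRing.mk V X)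

lemma algebraMap_mk_C_C (c : F) :
    algebraMap V.CoordinateRing V.FunctionField (CoordinateRing.mk V (C (C c))) =
      algebraMap F V.FunctionField c := by
  rw [IsScalarTower.algebraMap_apply F V.CoordinateRing V.FunctionField]
  rfl

lemma equation_generic : (V⁄V.FunctionField).Equation (xFn V) (yFn V) := by
  have h : CoordinateRing.mk V (X ^ 2 + C (C V.a₁ * X + C V.a₃) * X -
      C (X ^ 3 + C V.a₂ * X ^ 2 + C V.a₄ * X + C V.a₆)) = 0 := AdjoinRoot.mk_self
  have h1 := congrArg (algebraMap V.CoordinateRing V.FunctionField) h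
  simp only [map_sub, map_add, map_mul, map_pow, map_zero, algebraMap_mk_C_C] at h1
  rw [equation_iff']
  change _ ^ 2 + algebraMap F _ V.a₁ * _ * _ + algebraMap F _ V.a₃ * _ - (_ ^ 3 +
    algebraMap F _ V.a₂ * _ ^ 2 + algebraMap F _ V.a₄ * _ + algebraMap F _ V.a₆) = _
  rw [← h1, xFn, yFn]
  ring

/-- The generic point, with coordinates in the function field. -/
def genericPoint [V.IsElliptic] : (V⁄V.FunctionField).Point :=
  have : (V⁄V.FunctionField).IsElliptic :=
    inferInstanceAs (V.map (algebraMap F V.FunctionField)).IsElliptic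
  .some (xFn V) (yFn V) (equation_iff_nonsingular.mp (equation_generic V))

/-- The projection from the dual numbers. -/
def fstRingHom (L : Type*) [Field L] : DualNumber L →+* L where
  toFun := TrivSqZeroExt.fst
  map_one' := TrivSqZeroExt.fst_one
  map_mul' := TrivSqZeroExt.fst_mul
  map_zero' := TrivSqZeroExt.fst_zero
  map_add' := TrivSqZeroExt.fst_add

/-- A homomorphism from a domain to the dual numbers over its fraction field, which lifts the
inclusion, defines a derivation of the fraction field. -/
lemma exists_derivation_of_lift {A L : Type*} [CommRing A] [IsDomain A] [Field L] [Algebra A L]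
    [IsFractionRing A L] (θ₀ : A →+* DualNumber L)
    (h : (fstRingHom L).comp θ₀ = algebraMap A L) :
    ∃ d : Derivation ℤ L L, ∀ a, d (algebraMap A L a) = (θ₀ a).snd := by
  have hunit (z : A⁰) : IsUnit (θ₀ z) := by
    rw [TrivSqZeroExt.isUnit_iff_isUnit_fst]
    have h1 : (θ₀ z).fst = algebraMap A L z := RingHom.congr_fun h z
    rw [h1]
    exact IsLocalization.map_units L z
  let θ : L →+* DualNumber L := IsLocalization.lift hunit
  have hθ (z : A) : θ (algebraMap A L z) = θ₀ z := IsLocalization.lift_eq hunit z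
  have hfst (f : L) : (θ f).fst = f := by
    have h' : (fstRingHom L).comp θ = RingHom.id L := by
      apply IsLocalization.ringHom_ext A⁰
      refine RingHom.ext fun z => ?_
      rw [RingHom.comp_apply, RingHom.comp_apply, hθ, ← RingHom.comp_apply, h]
      rfl
    exact RingHom.congr_fun h' f
  let snd : L →+ L := AddMonoidHom.mk' (fun f => (θ f).snd) fun a b => by
    rw [map_add, TrivSqZeroExt.snd_add]
  refine ⟨Derivation.mk' snd.toIntLinearMap fun a b => ?_, fun a => ?_⟩
  · change (θ (a * b)).snd = a • (θ b).snd + b • (θ a).snd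
    rw [map_mul, TrivSqZeroExt.snd_mul, hfst, hfst, op_smul_eq_smul]
  · change (θ _).snd = _
    rw [hθ]

/-- The derivation `d` of the function field with `ω(d) = 1`, obtained from the homomorphism into
the dual numbers with `x ↦ x + ε(2y + a₁x + a₃)`, `y ↦ y + ε(3x² + 2a₂x + a₄ - a₁y)`. -/
lemma exists_derivation [V.IsElliptic] : ∃ d, IsOmega d (genericPoint V) 1 ∧
    KillsCoeffs (V⁄V.FunctionField) d ∧ ∀ c : F, d (algebraMap F V.FunctionField c) = 0 := by
  let L := V.FunctionField
  let η : L := 2 * yFn V + algebraMap F _ V.a₁ * xFn V + algebraMap F _ V.a₃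
  let ξ : L := 3 * xFn V ^ 2 + 2 * algebraMap F _ V.a₂ * xFn V + algebraMap F _ V.a₄ -
      algebraMap F _ V.a₁ * yFn V
  let ι : F →+* DualNumber L := (TrivSqZeroExt.inlHom L L).comp (algebraMap F L)
  let x' : DualNumber L := TrivSqZeroExt.inl (xFn V) + TrivSqZeroExt.inr η
  let y' : DualNumber L := TrivSqZeroExt.inl (yFn V) + TrivSqZeroExt.inr ξ
  have hE := equation_generic V
  rw [equation_iff'] at hE
  change _ ^ 2 + algebraMap F _ V.a₁ * _ * _ + algebraMap F _ V.a₃ * _ - (_ ^ 3 +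
    algebraMap F _ V.a₂ * _ ^ 2 + algebraMap F _ V.a₄ * _ + algebraMap F _ V.a₆) = _ at hE
  -- the `ε`-part of the Weierstrass equation is the relation between `dx` and `dy`
  have hroot : V.polynomial.eval₂ (eval₂RingHom ι x') y' = 0 := by
    change eval₂ _ _ (X ^ 2 + C (C V.a₁ * X + C V.a₃) * X -
      C (X ^ 3 + C V.a₂ * X ^ 2 + C V.a₄ * X + C V.a₆)) = 0
    simp only [eval₂_sub, eval₂_add, eval₂_mul, eval₂_pow, eval₂_X, eval₂_C, coe_eval₂RingHom]
    apply TrivSqZeroExt.ext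
    · simp only [ι, x', y', TrivSqZeroExt.fst_sub, TrivSqZeroExt.fst_add, TrivSqZeroExt.fst_mul,
        TrivSqZeroExt.fst_pow, TrivSqZeroExt.fst_inl, TrivSqZeroExt.fst_inr, RingHom.comp_apply,
        TrivSqZeroExt.inlHom_apply, TrivSqZeroExt.fst_zero, add_zero]
      linear_combination hE
    · simp only [ι, x', y', pow_succ, pow_zero, one_mul, TrivSqZeroExt.snd_sub,
        TrivSqZeroExt.snd_add, TrivSqZeroExt.snd_mul, TrivSqZeroExt.fst_mul, TrivSqZeroExt.fst_add,
        TrivSqZeroExt.fst_inl, TrivSqZeroExt.fst_inr, TrivSqZeroExt.snd_inl, TrivSqZeroExt.snd_inr,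
        RingHom.comp_apply, TrivSqZeroExt.inlHom_apply, TrivSqZeroExt.snd_zero, add_zero, zero_add,
        smul_eq_mul, MulOpposite.smul_eq_mul_unop, MulOpposite.unop_op, zero_mul]
      simp only [η, ξ]
      ring
  let θ₀ : V.CoordinateRing →+* DualNumber L := AdjoinRoot.lift (eval₂RingHom ι x') y' hroot
  have hθ (g : Polynomial (Polynomial F)) :
      θ₀ (CoordinateRing.mk V g) = g.eval₂ (eval₂RingHom ι x') y' := AdjoinRoot.lift_mk _ _
  have hθx : θ₀ (CoordinateRing.mk V (C X)) = x' := by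
    rw [hθ]
    simp
  have hθy : θ₀ (CoordinateRing.mk V X) = y' := by
    rw [hθ]
    simp
  have hθc (c : F) : θ₀ (CoordinateRing.mk V (C (C c))) = ι c := by
    rw [hθ]
    simp
  have hfst : (fstRingHom L).comp θ₀ = algebraMap V.CoordinateRing L := by
    have h : ((fstRingHom L).comp θ₀).comp (CoordinateRing.mk V) =
        (algebraMap V.CoordinateRing L).comp (CoordinateRing.mk V) := by
      refine Polynomial.ringHom_ext (fun p => ?_) ?_
      · refine RingHom.congr_fun (f := (((fstRingHom L).comp θ₀).comp (CoordinateRing.mk V)).comp C)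
          (g := ((algebraMap V.CoordinateRing L).comp (CoordinateRing.mk V)).comp C)
          (Polynomial.ringHom_ext (fun c => ?_) ?_) p
        · simp only [RingHom.comp_apply, hθc]
          exact (algebraMap_mk_C_C V c).symm
        · simp only [RingHom.comp_apply, hθx]
          exact add_zero _
      · simp only [RingHom.comp_apply, hθy]
        exact add_zero _
    refine RingHom.ext fun z => ?_
    obtain ⟨g, rfl⟩ := AdjoinRoot.mk_surjective z
    exact RingHom.congr_fun h g
  obtain ⟨d, hd⟩ := exists_derivation_of_lift θ₀ hfst
  have hc (c : F) : d (algebraMap F V.FunctionField c) = 0 := by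
    rw [← algebraMap_mk_C_C, hd, hθc]
    exact TrivSqZeroExt.snd_inl _ _
  refine ⟨d, ⟨?_, ?_⟩, ⟨hc _, hc _, hc _, hc _⟩, hc⟩
  · rw [xFn, hd, hθx, one_mul]
    exact zero_add _
  · rw [yFn, hd, hθy, one_mul]
    exact zero_add _

variable {V}

lemma hasValueAt_xFn {P : V.Point} (hP : P ≠ 0) : HasValueAt (xFn V) P (xc P) := by
  rcases P with _ | ⟨x, y, h⟩
  · exact (hP rfl).elim
  have := hasValueAt_algebraMap h (CoordinateRing.mk V (C X))
  rw [evalEval_mk] at this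
  simpa [xFn, xc, evalEval] using this

lemma hasValueAt_yFn {P : V.Point} (hP : P ≠ 0) : HasValueAt (yFn V) P (yc P) := by
  rcases P with _ | ⟨x, y, h⟩
  · exact (hP rfl).elim
  have := hasValueAt_algebraMap h (CoordinateRing.mk V X)
  rw [evalEval_mk] at this
  simpa [yFn, yc, evalEval] using this

lemma hasValueAt_coeff {P : V.Point} (hP : P ≠ 0) (c : F) :
    HasValueAt (algebraMap F V.FunctionField c) P c := by
  rw [IsScalarTower.algebraMap_apply F V.CoordinateRing V.FunctionField]
  exact hasValueAt_const hP c

variable [DecidableEq F]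

/-- A nonzero function has at most finitely many zeros. -/
lemma eventually_value_ne_zero {f : V.FunctionField} (hf : f ≠ 0) :
    ∀ᶠ P : V.Point in Filter.cofinite, ∀ v, HasValueAt f P v → v ≠ 0 := by
  obtain ⟨a, b, hb, rfl⟩ := IsFractionRing.div_surjective (A := V.CoordinateRing) f
  have hb0 : algebraMap V.CoordinateRing V.FunctionField b ≠ 0 :=
    IsFractionRing.to_map_ne_zero_of_mem_nonZeroDivisors hb
  have ha : a ≠ 0 := by
    rintro rfl
    simp at hf
  filter_upwards [eventually_evalEval_ne_zero ha] with P hP v hv h0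
  subst h0
  rcases P with _ | ⟨x, y, h⟩
  · exact hv
  have h1 := hv.mul (hasValueAt_algebraMap h b)
  rw [div_mul_cancel₀ _ hb0, zero_mul] at h1
  exact hP x y h rfl (h1.unique (hasValueAt_algebraMap h a)).symm

/-- The point `𝒬` with coordinates in the function field specializes to `Q` at `P`. -/
def Spec : (V⁄V.FunctionField).Point → V.Point → V.Point → Prop
  | .zero, _, Q => Q = 0
  | .some x y _, P, Q => Q ≠ 0 ∧ HasValueAt x P (xc Q) ∧ HasValueAt y P (yc Q)

omit [DecidableEq F] in
lemma spec_genericPoint [V.IsElliptic] {P : V.Point} (hP : P ≠ 0) : Spec (genericPoint V) P P :=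
  show _ ∧ _ ∧ _ from ⟨hP, hasValueAt_xFn hP, hasValueAt_yFn hP⟩

variable [DecidableEq V.FunctionField]

/-- Specialization is compatible with addition, away from finitely many points. -/
lemma Spec.add {𝒬 ℛ : (V⁄V.FunctionField).Point} {f g : V.Point → V.Point}
    (hf : ∀ᶠ P in Filter.cofinite, Spec 𝒬 P (f P))
    (hg : ∀ᶠ P in Filter.cofinite, Spec ℛ P (g P)) :
    ∀ᶠ P in Filter.cofinite, Spec (𝒬 + ℛ) P (f P + g P) := by
  rcases 𝒬 with _ | ⟨x₁, y₁, h₁⟩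
  · filter_upwards [hf, hg] with P h h'
    have h0 : f P = 0 := h
    rw [h0, zero_add]
    exact (zero_add ℛ).symm ▸ h'
  rcases ℛ with _ | ⟨x₂, y₂, h₂⟩
  · filter_upwards [hf, hg] with P h h'
    have h0 : g P = 0 := h'
    rw [h0, add_zero]
    exact (add_zero (Point.some x₁ y₁ h₁)).symm ▸ h
  by_cases hxy : x₁ = x₂ ∧ y₁ = (V⁄V.FunctionField).negY x₂ y₂
  · rw [Point.add_of_Y_eq hxy.1 hxy.2]
    filter_upwards [hf, hg, Filter.eventually_cofinite_ne 0] with P h h' hP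
    obtain ⟨f0, fx, fy⟩ := h
    obtain ⟨g0, gx, gy⟩ := h'
    have ha₁ := hasValueAt_coeff hP V.a₁
    have ha₃ := hasValueAt_coeff hP V.a₃
    generalize f P = Q at *
    generalize g P = R at *
    rcases Q with _ | ⟨x, y, hQ⟩
    · exact (f0 rfl).elim
    rcases R with _ | ⟨x', y', hR⟩
    · exact (g0 rfl).elim
    refine Point.add_of_Y_eq ?_ ?_
    · rw [hxy.1] at fx
      exact fx.unique gx
    · rw [hxy.2] at fy
      exact fy.unique ((gy.neg.sub (ha₁.mul gx)).sub ha₃)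
  · -- outside finitely many points the slope specializes to the slope
    have hslope : ∀ᶠ P in Filter.cofinite, ¬ (xc (f P) = xc (g P) ∧
        yc (f P) = V.negY (xc (g P)) (yc (g P))) ∧
        HasValueAt ((V⁄V.FunctionField).slope x₁ x₂ y₁ y₂) P
          (V.slope (xc (f P)) (xc (g P)) (yc (f P)) (yc (g P))) := by
      by_cases hx : x₁ = x₂
      · have hy : y₁ ≠ (V⁄V.FunctionField).negY x₂ y₂ := fun h => hxy ⟨hx, h⟩
        have hyy := Y_eq_of_Y_ne h₁.1 h₂.1 hx hy
        filter_upwards [hf, hg, Filter.eventually_cofinite_ne 0,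
          eventually_value_ne_zero (sub_ne_zero.mpr hy)] with P h h' hP hne
        obtain ⟨f0, fx, fy⟩ := h
        obtain ⟨g0, gx, gy⟩ := h'
        have ha₁ := hasValueAt_coeff hP V.a₁
        have ha₂ := hasValueAt_coeff hP V.a₂
        have ha₃ := hasValueAt_coeff hP V.a₃
        have ha₄ := hasValueAt_coeff hP V.a₄
        have h2 : HasValueAt (2 : V.FunctionField) P 2 := by
          have := hasValueAt_coeff hP (2 : F)
          rwa [map_ofNat] at this
        have h3 : HasValueAt (3 : V.FunctionField) P 3 := by
          have := hasValueAt_coeff hP (3 : F)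
          rwa [map_ofNat] at this
        have hex : xc (f P) = xc (g P) := by
          rw [hx] at fx
          exact fx.unique gx
        have hey : yc (f P) = yc (g P) := by
          rw [hyy] at fy
          exact fy.unique gy
        have hv : HasValueAt (y₁ - (V⁄V.FunctionField).negY x₂ y₂) P
            (yc (f P) - V.negY (xc (g P)) (yc (g P))) :=
          fy.sub ((gy.neg.sub (ha₁.mul gx)).sub ha₃)
        have hne' := hne _ hv
        refine ⟨fun h => hne' (sub_eq_zero.mpr h.2), ?_⟩
        rw [slope_of_Y_ne hx hy, slope_of_Y_ne hex (sub_ne_zero.mp hne')]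
        have hv' := hv
        have hn' := hne'
        rw [← hex, ← hey] at hv' hn'
        rw [← hx, ← hyy] at hv'
        refine HasValueAt.div ?_ hv' hn'
        rw [pow_two, pow_two]
        exact (((h3.mul (fx.mul fx)).add ((h2.mul ha₂).mul fx)).add ha₄).sub (ha₁.mul fy)
      · filter_upwards [hf, hg, eventually_value_ne_zero (sub_ne_zero.mpr hx)] with P h h' hne
        obtain ⟨f0, fx, fy⟩ := h
        obtain ⟨g0, gx, gy⟩ := h'
        have hne' := hne _ (fx.sub gx)
        refine ⟨fun h => hne' (sub_eq_zero.mpr h.1), ?_⟩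
        rw [slope_of_X_ne hx, slope_of_X_ne (sub_ne_zero.mp hne')]
        exact (fy.sub gy).div (fx.sub gx) hne'
    rw [Point.add_some hxy]
    filter_upwards [hf, hg, hslope, Filter.eventually_cofinite_ne 0] with P h h' hs hP
    obtain ⟨f0, fx, fy⟩ := h
    obtain ⟨g0, gx, gy⟩ := h'
    have ha₁ := hasValueAt_coeff hP V.a₁
    have ha₂ := hasValueAt_coeff hP V.a₂
    have ha₃ := hasValueAt_coeff hP V.a₃
    generalize f P = Q at *
    generalize g P = R at *
    rcases Q with _ | ⟨x, y, hQ⟩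
    · exact (f0 rfl).elim
    rcases R with _ | ⟨x', y', hR⟩
    · exact (g0 rfl).elim
    obtain ⟨hs1, hs⟩ := hs
    change ¬ (x = x' ∧ y = V.negY x' y') at hs1
    rw [Point.add_some hs1]
    have hX : HasValueAt ((V⁄V.FunctionField).addX x₁ x₂
        ((V⁄V.FunctionField).slope x₁ x₂ y₁ y₂)) P (V.addX x x' (V.slope x x' y y')) := by
      rw [addX, addX, pow_two, pow_two]
      exact ((((hs.mul hs).add (ha₁.mul hs)).sub ha₂).sub fx).sub gx
    refine ⟨by rintro ⟨⟩, hX, ?_⟩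
    exact (((hs.mul (hX.sub fx)).add fy).neg.sub (ha₁.mul hX)).sub ha₃

lemma eventually_spec_nsmul [V.IsElliptic] (n : ℕ) :
    ∀ᶠ P in Filter.cofinite, Spec (n • genericPoint V) P (n • P) := by
  induction n with
  | zero =>
    refine .of_forall fun P => ?_
    rw [zero_nsmul, zero_nsmul]
    exact rfl
  | succ n ih =>
    simp only [succ_nsmul]
    refine Spec.add ih ?_
    filter_upwards [Filter.eventually_cofinite_ne 0] with P hP using spec_genericPoint hP

end GenericPoint

/-! ### Points over a separably closed field -/

section SepClosed

open Polynomial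

variable {F : Type*} [Field F] {V : WeierstrassCurve.Affine F}

lemma infinite_of_isSepClosed (F : Type*) [Field F] [IsSepClosed F] : Infinite F := by
  by_contra h
  rw [not_infinite_iff_finite] at h
  have := IsAlgClosed.instInfinite (K := F)
  exact not_finite F

/-- The polynomial `4x³ + b₂x² + 2b₄x + b₆`, the square of `2y + a₁x + a₃`, is not zero. -/
lemma twoTorsionPolynomial_ne_zero [V.IsElliptic] : V.twoTorsionPolynomial.toPoly ≠ 0 := by
  intro h
  have ha : (4 : F) = 0 := by
    have := Cubic.coeff_eq_a (P := V.twoTorsionPolynomial)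
    rw [h, coeff_zero] at this
    exact this.symm
  have hb : V.b₂ = 0 := by
    have := Cubic.coeff_eq_b (P := V.twoTorsionPolynomial)
    rw [h, coeff_zero] at this
    exact this.symm
  have hd : V.b₆ = 0 := by
    have := Cubic.coeff_eq_d (P := V.twoTorsionPolynomial)
    rw [h, coeff_zero] at this
    exact this.symm
  refine V.isUnit_Δ.ne_zero ?_
  rw [Δ, hb, hd]
  linear_combination -2 * V.b₄ ^ 3 * ha

lemma eval_twoTorsionPolynomial {x y : F} (h : V.Equation x y) :
    V.twoTorsionPolynomial.toPoly.eval x = (2 * y + V.a₁ * x + V.a₃) ^ 2 := by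
  rw [equation_iff'] at h
  simp only [twoTorsionPolynomial, Cubic.toPoly, b₂, b₄, b₆, eval_add, eval_mul, eval_C, eval_pow,
    eval_X]
  linear_combination (-4) * h

/-- Over a separably closed field there is a point with a given abscissa, unless this is the
abscissa of a `2`-torsion point. -/
lemma exists_equation [IsSepClosed F] {x : F} (hx : V.twoTorsionPolynomial.toPoly.eval x ≠ 0) :
    ∃ y, V.Equation x y := by
  let b := V.a₁ * x + V.a₃
  let c := x ^ 3 + V.a₂ * x ^ 2 + V.a₄ * x + V.a₆
  let q : F[X] := X ^ 2 + C b * X - C c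
  have hD : V.twoTorsionPolynomial.toPoly.eval x = b ^ 2 + 4 * c := by
    simp only [twoTorsionPolynomial, Cubic.toPoly, b₂, b₄, b₆, eval_add, eval_mul, eval_C,
      eval_pow, eval_X, b, c]
    ring
  rw [hD] at hx
  have hq : q.degree = 2 := by
    have : q = C 1 * X ^ 2 + C b * X + C (-c) := by
      simp only [q, map_one, map_neg]
      ring
    rw [this, degree_quadratic one_ne_zero]
  have hsep : q.Separable := by
    refine ⟨C (-4 / (b ^ 2 + 4 * c)), C (1 / (b ^ 2 + 4 * c)) * (C 2 * X + C b), ?_⟩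
    have h1 : derivative q = C 2 * X + C b := by
      simp [q, one_add_one_eq_two]
    have h2 : C (b ^ 2 + 4 * c) * C (1 / (b ^ 2 + 4 * c)) = (1 : F[X]) := by
      rw [← C_mul, mul_one_div_cancel hx, C_1]
    rw [h1, neg_div, C_neg, ← mul_one_div, C_mul, ← h2]
    simp only [q, C_add, C_mul, C_pow, map_ofNat]
    ring
  obtain ⟨y, hy⟩ := IsSepClosed.exists_root q (by rw [hq]; norm_num) hsep
  refine ⟨y, (equation_iff' x y).mpr ?_⟩
  simp only [q, b, c, IsRoot, eval_sub, eval_add, eval_mul, eval_pow, eval_X, eval_C] at hy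
  linear_combination hy

lemma exists_point [IsSepClosed F] [V.IsElliptic] {x : F}
    (hx : V.twoTorsionPolynomial.toPoly.eval x ≠ 0) : ∃ P : V.Point, P ≠ 0 ∧ xc P = x := by
  obtain ⟨y, hy⟩ := exists_equation hx
  exact ⟨.some x y (equation_iff_nonsingular.mp hy), by rintro ⟨⟩, rfl⟩

lemma infinite_point [IsSepClosed F] [V.IsElliptic] : Infinite V.Point := by
  have := infinite_of_isSepClosed F
  by_contra h
  rw [not_infinite_iff_finite] at h
  have h1 : (Set.range (xc : V.Point → F)).Finite := Set.finite_range _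
  have h2 : {x : F | V.twoTorsionPolynomial.toPoly.IsRoot x}.Finite :=
    Polynomial.finite_setOfPred_isRoot twoTorsionPolynomial_ne_zero
  obtain ⟨x, hx⟩ := (h1.union h2).infinite_compl.nonempty
  simp only [Set.mem_compl_iff, Set.mem_union, not_or] at hx
  obtain ⟨P, -, hP⟩ := exists_point (V := V) hx.2
  exact hx.1 ⟨P, hP⟩

end SepClosed

/-! ### Divisibility of the group of points -/

section Divisibility

open Polynomial

variable {F : Type*} [Field F] {V : WeierstrassCurve.Affine F}

/-- Two polynomials are proportional to coprime ones. -/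
lemma exists_isCoprime (p m : F[X]) (hm : m ≠ 0) : ∃ g p₁ m₁ : F[X], g ≠ 0 ∧ IsCoprime p₁ m₁ ∧
    p = g * p₁ ∧ m = g * m₁ := by
  classical
  have hg : EuclideanDomain.gcd p m ≠ 0 := fun h => hm (EuclideanDomain.gcd_eq_zero_iff.mp h).2
  obtain ⟨p₁, hp₁⟩ := EuclideanDomain.gcd_dvd_left p m
  obtain ⟨m₁, hm₁⟩ := EuclideanDomain.gcd_dvd_right p m
  refine ⟨_, p₁, m₁, hg, ?_, hp₁, hm₁⟩
  have h := EuclideanDomain.gcd_eq_gcd_ab p m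
  refine ⟨EuclideanDomain.gcdA p m, EuclideanDomain.gcdB p m, ?_⟩
  apply mul_left_cancel₀ hg
  linear_combination -h - EuclideanDomain.gcdA p m * hp₁ - EuclideanDomain.gcdB p m * hm₁

/-- If the fraction `p / m` in lowest terms has nonzero derivative, then over a separably closed
field `p - c m` has a root for all but finitely many `c`: an inseparable irreducible factor of
`p - c m` divides `p' m - p m'`, and no polynomial divides `p - c m` for two values of `c`. -/
lemma finite_setOf_no_root [IsSepClosed F] {p m : F[X]} (hpm : IsCoprime p m)
    (hw : derivative p * m - p * derivative m ≠ 0) :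
    {c : F | ∀ x, ¬ (p - C c * m).IsRoot x}.Finite := by
  classical
  set w := derivative p * m - p * derivative m with hwdef
  -- a nonunit divides `p - c m` for at most one `c`, as `p` and `m` are coprime
  have huniq (h : F[X]) (hh : ¬ IsUnit h) :
      {c : F | h ∣ p - C c * m}.Subsingleton := by
    intro c hc c' hc'
    by_contra hne
    have h1 : h ∣ C (c' - c) * m := by
      have := dvd_sub hc hc'
      convert this using 1
      rw [C_sub]
      ring
    have hu : IsUnit (C (c' - c)) := isUnit_C.mpr (IsUnit.mk0 _ (sub_ne_zero.mpr (Ne.symm hne)))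
    have h2 : h ∣ m := (hu.dvd_mul_left).mp h1
    have h3 : h ∣ p := by
      have := dvd_add hc (h2.mul_left (C c))
      simpa using this
    exact hh (hpm.isUnit_of_dvd' h3 h2)
  have h1 : {c : F | derivative (p - C c * m) = 0}.Subsingleton := by
    intro c hc c' hc'
    by_contra hne
    simp only [Set.mem_ofPred_eq, derivative_sub, derivative_C_mul] at hc hc'
    have h1 : C (c' - c) * derivative m = 0 := by
      rw [C_sub]
      linear_combination hc - hc'
    have h2 : derivative m = 0 :=
      (mul_eq_zero.mp h1).resolve_left (C_ne_zero.mpr (sub_ne_zero.mpr (Ne.symm hne)))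
    have h3 : derivative p = 0 := by
      rw [h2] at hc
      simpa using hc
    apply hw
    rw [hwdef, h2, h3]
    simp
  have h2 : (⋃ h ∈ (UniqueFactorizationMonoid.normalizedFactors w).toFinset,
      {c : F | h ∣ p - C c * m}).Finite := by
    refine Set.Finite.biUnion (Finset.finite_toSet _) fun h hh => ?_
    refine (huniq h ?_).finite
    exact (UniqueFactorizationMonoid.irreducible_of_normalized_factor h
      (Multiset.mem_toFinset.mp hh)).not_isUnit
  refine (h1.finite.union h2).subset fun c hc => ?_
  by_contra hcon
  simp only [Set.mem_union, Set.mem_ofPred_eq, Set.mem_iUnion, not_or, not_exists] at hcon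
  obtain ⟨hd, hcon⟩ := hcon
  have hg0 : p - C c * m ≠ 0 := fun h => hd (by rw [h, derivative_zero])
  have hgu : ¬ IsUnit (p - C c * m) := by
    intro h
    obtain ⟨r, -, hr⟩ := Polynomial.isUnit_iff.mp h
    exact hd (by rw [← hr, derivative_C])
  obtain ⟨h, hirr, hdvd⟩ := WfDvdMonoid.exists_irreducible_factor hgu hg0
  by_cases hsep : h.Separable
  · obtain ⟨x, hx⟩ := IsSepClosed.exists_root h (degree_pos_of_irreducible hirr).ne' hsep
    exact hc x (hx.dvd hdvd)
  · have hh' : derivative h = 0 := by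
      by_contra h0
      exact hsep ((separable_iff_derivative_ne_zero hirr).mpr h0)
    obtain ⟨s, hs⟩ := hdvd
    have hdvd' : h ∣ derivative (p - C c * m) := by
      rw [hs, derivative_mul, hh', zero_mul, zero_add]
      exact dvd_mul_right _ _
    have hdw : h ∣ w := by
      have : w = derivative (p - C c * m) * m - (p - C c * m) * derivative m := by
        rw [hwdef, derivative_sub, derivative_C_mul]
        ring
      rw [this]
      exact dvd_sub (hdvd'.mul_right _) (Dvd.dvd.mul_right ⟨s, hs⟩ _)
    obtain ⟨q, hq, hqa⟩ := UniqueFactorizationMonoid.exists_mem_normalizedFactors_of_dvd hw hirr hdw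
    exact hcon q (Multiset.mem_toFinset.mpr hq) (hqa.dvd'.trans ⟨s, hs⟩)

lemma derivation_mul {L : Type*} [Field L] (d : Derivation ℤ L L) (a b : L) :
    d (a * b) = a * d b + b * d a := d.leibniz a b

lemma derivation_polynomial {L : Type*} [Field L] (d : Derivation ℤ L L) (ι : F[X] →+* L)
    (hd : ∀ c, d (ι (C c)) = 0) (p : F[X]) : d (ι p) = ι (derivative p) * d (ι X) := by
  induction p using Polynomial.induction_on' with
  | add p q hp hq => rw [map_add, map_add, hp, hq, derivative_add, map_add, add_mul]
  | monomial k a =>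
    rw [← C_mul_X_pow_eq_monomial, map_mul, map_pow, Derivation.leibniz, hd, Derivation.leibniz_pow,
      derivative_C_mul_X_pow, map_mul, map_pow, C_mul, map_mul]
    simp only [smul_eq_mul, nsmul_eq_mul, mul_zero, add_zero, map_natCast]
    ring

variable [DecidableEq F]

/-- A function whose values are roots of a fixed polynomial is constant. -/
lemma eq_const_of_eval_eq_zero [Infinite V.Point] {f : V.FunctionField} {m : F[X]} (hm : m ≠ 0)
    (h : ∀ᶠ P : V.Point in Filter.cofinite, ∃ v, HasValueAt f P v ∧ m.eval v = 0) :
    ∃ c, f = algebraMap F V.FunctionField c := by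
  by_contra! hne
  have h1 : ∀ᶠ P : V.Point in Filter.cofinite, ∀ r ∈ m.roots.toFinset,
      ∀ v, HasValueAt (f - algebraMap F V.FunctionField r) P v → v ≠ 0 :=
    (Filter.eventually_all_finset _).mpr fun r _ =>
      eventually_value_ne_zero (sub_ne_zero.mpr (hne r))
  obtain ⟨P, ⟨v, hv, hmv⟩, h2, hP⟩ :=
    (h.and (h1.and (Filter.eventually_cofinite_ne 0))).exists
  refine h2 v (Multiset.mem_toFinset.mpr ((mem_roots hm).mpr hmv)) (v - v)
    (hv.sub (hasValueAt_coeff hP v)) (sub_self v)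

omit [DecidableEq F] in
lemma two_or_coeff_ne_zero [V.IsElliptic] : (2 : F) ≠ 0 ∨ C V.a₁ * X + C V.a₃ ≠ (0 : F[X]) := by
  by_contra! h
  have h1 : V.a₁ = 0 := by simpa using congrArg (fun p => coeff p 1) h.2
  have h3 : V.a₃ = 0 := by simpa using congrArg (fun p => coeff p 0) h.2
  refine twoTorsionPolynomial_ne_zero (V := V) ?_
  rw [twoTorsionPolynomial, b₂, b₄, b₆, h1, h3, show (4 : F) = 2 * 2 by norm_num, h.1, Cubic.toPoly]
  simp

/-- A function with equal values at `P` and `-P` is a fraction of polynomials in `x`. -/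
lemma exists_polynomial_of_even [Infinite V.Point] [V.IsElliptic] {f : V.FunctionField}
    {v : V.Point → F} (hv : ∀ᶠ P in Filter.cofinite, HasValueAt f P (v P))
    (hneg : ∀ P, v (-P) = v P) :
    ∃ p m : F[X], m ≠ 0 ∧ f * algebraMap V.CoordinateRing _ (algebraMap F[X] _ m) =
      algebraMap V.CoordinateRing _ (algebraMap F[X] _ p) := by
  obtain ⟨a, b, hb, rfl⟩ := IsFractionRing.div_surjective (A := V.CoordinateRing) f
  have hb0 : algebraMap V.CoordinateRing V.FunctionField b ≠ 0 :=
    IsFractionRing.to_map_ne_zero_of_mem_nonZeroDivisors hb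
  obtain ⟨m, hm, w, hw⟩ := exists_dvd_polynomial (nonZeroDivisors.ne_zero hb)
  have hf : algebraMap V.CoordinateRing V.FunctionField a /
      algebraMap V.CoordinateRing V.FunctionField b *
        algebraMap V.CoordinateRing _ (algebraMap F[X] _ m) =
      algebraMap V.CoordinateRing V.FunctionField (a * w) := by
    rw [hw, map_mul, map_mul]
    field_simp
  generalize algebraMap V.CoordinateRing V.FunctionField a /
      algebraMap V.CoordinateRing V.FunctionField b = f at hf hv
  obtain ⟨p, q, hpq⟩ := CoordinateRing.exists_smul_basis_eq (a * w)
  have hval {P : V.Point} (hP : HasValueAt f P (v P)) {x y : F} {h : V.Nonsingular x y}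
      (hPxy : P = .some x y h) : v P * m.eval x = p.eval x + q.eval x * y := by
    subst hPxy
    have h1 := hP.mul (hasValueAt_algebraMap h (algebraMap F[X] _ m))
    rw [hf] at h1
    have h2 := h1.unique (hasValueAt_algebraMap h (a * w))
    have h3 := evalEval_smul_add h.1 m 0
    rw [zero_smul, add_zero, ← Algebra.algebraMap_eq_smul_one] at h3
    rw [h3, ← hpq, evalEval_smul_add] at h2
    simpa using h2
  have hq : (q * (C V.a₁ * X + C V.a₃)) • (1 : V.CoordinateRing) +
      (q * C 2) • CoordinateRing.mk V X = 0 := by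
    apply eq_zero_of_eventually
    filter_upwards [hv, neg_injective.tendsto_cofinite.eventually hv] with P h1 h2 x y h hPxy
    have e1 := hval h1 hPxy
    have e2 := hval (x := x) (y := V.negY x y) (h := (nonsingular_neg x y).mpr h) h2
      (by rw [hPxy]; rfl)
    rw [hneg, negY] at e2
    rw [evalEval_smul_add]
    simp only [eval_mul, eval_add, eval_C, eval_X]
    linear_combination e2 - e1
  have hq0 : q = 0 := by
    obtain ⟨h1, h2⟩ := CoordinateRing.smul_basis_eq_zero hq
    rcases two_or_coeff_ne_zero (V := V) with h | h
    · exact (mul_eq_zero.mp h2).resolve_right (C_ne_zero.mpr h)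
    · exact (mul_eq_zero.mp h1).resolve_right h
  refine ⟨p, m, hm, ?_⟩
  rw [hf, ← hpq, hq0, zero_smul, add_zero, ← Algebra.algebraMap_eq_smul_one]

omit [DecidableEq F] in
lemma xc_neg (P : V.Point) : xc (-P) = xc P := by
  rcases P with _ | ⟨x, y, h⟩ <;> rfl

lemma eq_or_eq_neg_of_xc_eq {P Q : V.Point} (hP : P ≠ 0) (hQ : Q ≠ 0) (h : xc P = xc Q) :
    P = Q ∨ P = -Q := by
  rcases P with _ | ⟨x, y, hP'⟩
  · exact (hP rfl).elim
  rcases Q with _ | ⟨x', y', hQ'⟩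
  · exact (hQ rfl).elim
  by_contra! hne
  exact xc_ne_of_ne (h₁ := hP') (h₂ := hQ') hne.1 (fun h => hne.2 (add_eq_zero_iff_eq_neg.mp h)) h

omit [DecidableEq F] in
/-- The generic point has no `n`-torsion: the invariant differential of its multiple by `n` is
`n ω ≠ 0`. -/
lemma nsmul_genericPoint_ne_zero [V.IsElliptic] [DecidableEq V.FunctionField] {n : ℕ}
    (hn : (n : F) ≠ 0) : n • genericPoint V ≠ 0 := by
  intro h
  obtain ⟨d, hd, hkill, -⟩ := exists_derivation V
  have hω := hd.nsmul hkill n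
  rw [mul_one, h] at hω
  refine hn ?_
  rw [← map_eq_zero_iff _ (algebraMap F V.FunctionField).injective, map_natCast]
  exact hω

/-- Only finitely many points are killed by `n`: all others are points to which the generic point
and its nonzero multiple by `n` specialize. -/
lemma eventually_nsmul_ne_zero [V.IsElliptic] {n : ℕ} (hn : (n : F) ≠ 0) :
    ∀ᶠ P : V.Point in Filter.cofinite, n • P ≠ 0 := by
  classical
  filter_upwards [eventually_spec_nsmul (V := V) n] with P hP
  have h := nsmul_genericPoint_ne_zero (V := V) hn
  rcases h𝒬 : n • genericPoint V with _ | ⟨f, g, hfg⟩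
  · exact (h h𝒬).elim
  · rw [h𝒬] at hP
    exact hP.1

/-- Multiplication by `n` is surjective on the points over a separably closed field in which `n` is
invertible. Its `x`-coordinate is a function of `x` with nonzero derivative, as the invariant
differential is multiplied by `n`, so that all but finitely many of its fibres are nonempty. -/
theorem nsmul_surjective [IsSepClosed F] [V.IsElliptic] {n : ℕ} (hn : (n : F) ≠ 0) :
    Function.Surjective fun P : V.Point => n • P := by
  classical
  have := infinite_point (V := V)
  have hspec := eventually_spec_nsmul (V := V) n
  obtain ⟨d, hd, hkill, hdc⟩ := exists_derivation V
  have hdx : d (xFn V) = 2 * yFn V + algebraMap F _ V.a₁ * xFn V + algebraMap F _ V.a₃ := by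
    rw [← one_mul (2 * yFn V + _ + _)]
    exact hd.1
  have hω := hd.nsmul hkill n
  rw [mul_one] at hω
  have hnL : (n : V.FunctionField) ≠ 0 := by
    rw [← map_natCast (algebraMap F V.FunctionField), Ne,
      map_eq_zero_iff _ (algebraMap F V.FunctionField).injective]
    exact hn
  rcases h𝒬 : n • genericPoint V with _ | ⟨f, g, hfg⟩
  · exact (nsmul_genericPoint_ne_zero hn h𝒬).elim
  rw [h𝒬] at hω hspec
  obtain ⟨hω₁, hω₂⟩ := hω
  change d f = n * (2 * g + algebraMap F _ V.a₁ * f + algebraMap F _ V.a₃) at hω₁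
  change d g = n * (3 * f ^ 2 + 2 * algebraMap F _ V.a₂ * f + algebraMap F _ V.a₄ -
    algebraMap F _ V.a₁ * g) at hω₂
  -- otherwise `n` times the generic point would be a point of order two, so its coordinates would
  -- be constant, and the invariant differential would vanish on it
  have hη : 2 * g + algebraMap F _ V.a₁ * f + algebraMap F _ V.a₃ ≠ 0 := by
    intro h0
    have hfc : ∃ c, f = algebraMap F V.FunctionField c := by
      refine eq_const_of_eval_eq_zero (twoTorsionPolynomial_ne_zero (V := V)) ?_
      filter_upwards [hspec, Filter.eventually_cofinite_ne 0] with P hP hP0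
      obtain ⟨hQ, hx, hy⟩ := hP
      refine ⟨_, hx, ?_⟩
      have h2 : HasValueAt (2 : V.FunctionField) P 2 := by
        have := hasValueAt_coeff hP0 (2 : F)
        rwa [map_ofNat] at this
      have h3 := ((h2.mul hy).add ((hasValueAt_coeff hP0 V.a₁).mul hx)).add
        (hasValueAt_coeff hP0 V.a₃)
      rw [h0, ← map_zero (algebraMap F V.FunctionField)] at h3
      have h4 := h3.unique (hasValueAt_coeff hP0 0)
      generalize n • P = Q at *
      rcases Q with _ | ⟨x, y, h⟩
      · exact (hQ rfl).elim
      change V.twoTorsionPolynomial.toPoly.eval x = 0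
      rw [eval_twoTorsionPolynomial h.1]
      exact pow_eq_zero_iff two_ne_zero |>.mpr h4
    obtain ⟨c, hc⟩ := hfc
    have hgc : ∃ c, g = algebraMap F V.FunctionField c := by
      have hm : (X ^ 2 + (C (V.a₁ * c + V.a₃) * X +
          C (-(c ^ 3 + V.a₂ * c ^ 2 + V.a₄ * c + V.a₆)))).Monic :=
        monic_X_pow_add (degree_linear_le.trans_lt (by norm_num))
      refine eq_const_of_eval_eq_zero hm.ne_zero ?_
      filter_upwards [hspec, Filter.eventually_cofinite_ne 0] with P hP hP0
      obtain ⟨hQ, hx, hy⟩ := hP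
      refine ⟨_, hy, ?_⟩
      rw [hc] at hx
      have hxc := hx.unique (hasValueAt_coeff hP0 c)
      generalize n • P = Q at *
      rcases Q with _ | ⟨x, y, h⟩
      · exact (hQ rfl).elim
      have hxy := (equation_iff' x y).mp h.1
      subst hxc
      change eval y _ = 0
      simp only [eval_add, eval_mul, eval_pow, eval_X, eval_C, xc]
      linear_combination hxy
    obtain ⟨c', hc'⟩ := hgc
    rw [hc, hdc, ← hc, eq_comm] at hω₁
    rw [hc', hdc, ← hc', eq_comm] at hω₂
    rcases ((nonsingular_iff' f g).mp hfg).2 with h | h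
    · apply h
      have := (mul_eq_zero.mp hω₂).resolve_left hnL
      change algebraMap F _ V.a₁ * g - (3 * f ^ 2 + 2 * algebraMap F _ V.a₂ * f +
        algebraMap F _ V.a₄) = 0
      linear_combination -this
    · exact h ((mul_eq_zero.mp hω₁).resolve_left hnL)
  -- the `x`-coordinate of `n P` is a fraction `p / m` in lowest terms, with nonzero derivative
  have hxv : ∀ᶠ P in Filter.cofinite, HasValueAt f P (xc (n • P)) := by
    filter_upwards [hspec] with P hP using hP.2.1
  obtain ⟨p', m', hm', hfm'⟩ := exists_polynomial_of_even hxv fun P => by rw [smul_neg, xc_neg]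
  obtain ⟨r, p, m, hr, hpm, rfl, rfl⟩ := exists_isCoprime p' m' hm'
  let ι : F[X] →+* V.FunctionField :=
    (algebraMap V.CoordinateRing V.FunctionField).comp (algebraMap F[X] V.CoordinateRing)
  have hι : Function.Injective ι := (IsFractionRing.injective V.CoordinateRing V.FunctionField).comp
    (FaithfulSMul.algebraMap_injective F[X] V.CoordinateRing)
  have hfm : f * ι m = ι p := by
    apply mul_left_cancel₀ ((map_ne_zero_iff ι hι).mpr hr)
    rw [← map_mul, ← mul_assoc, mul_comm (ι r), mul_assoc, ← map_mul]
    exact hfm'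
  have hm : m ≠ 0 := right_ne_zero_of_mul hm'
  have hw : derivative p * m - p * derivative m ≠ 0 := by
    intro h0
    have e0 := congrArg ι h0
    rw [map_sub, map_mul, map_mul, map_zero] at e0
    have hιc (c : F) : d (ι (C c)) = 0 := by
      have : ι (C c) = algebraMap F V.FunctionField c := algebraMap_mk_C_C V c
      rw [this, hdc]
    have e1 := congrArg d hfm
    rw [derivation_mul, derivation_polynomial d ι hιc m, derivation_polynomial d ι hιc p, hω₁] at e1
    change f * (_ * d (xFn V)) + ι m * _ = _ * d (xFn V) at e1
    have e2 : (ι m * ι m) * (n * (2 * g + algebraMap F _ V.a₁ * f + algebraMap F _ V.a₃)) = 0 := by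
      linear_combination (ι m) * e1 - ι (derivative m) * d (xFn V) * hfm + d (xFn V) * e0
    have hιm := (map_ne_zero_iff ι hι).mpr hm
    exact mul_ne_zero (mul_ne_zero hιm hιm) (mul_ne_zero hnL hη) e2
  -- all but finitely many elements of the field are the abscissa of some `n P`
  have hbad : {P : V.Point | ¬ (n • P ≠ 0 ∧ HasValueAt f P (xc (n • P)))}.Finite := by
    refine Filter.eventually_cofinite.mp ?_
    filter_upwards [hspec] with P hP using ⟨hP.1, hP.2.1⟩
  let B : Set F := xc '' {P : V.Point | ¬ (n • P ≠ 0 ∧ HasValueAt f P (xc (n • P)))} ∪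
    {x | V.twoTorsionPolynomial.toPoly.IsRoot x}
  have hB : B.Finite := (hbad.image _).union
    (Polynomial.finite_setOfPred_isRoot twoTorsionPolynomial_ne_zero)
  have hC := (finite_setOf_no_root hpm hw).union (hB.image fun x => p.eval x / m.eval x)
  have himage (c : F) (hc : c ∉ {c : F | ∀ x, ¬ (p - C c * m).IsRoot x} ∪
      (fun x => p.eval x / m.eval x) '' B) : ∃ P : V.Point, n • P ≠ 0 ∧ xc (n • P) = c := by
    simp only [Set.mem_union, Set.mem_ofPred_eq, not_or, not_forall, not_not] at hc
    obtain ⟨⟨x, hx⟩, hcB⟩ := hc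
    rw [IsRoot, eval_sub, eval_mul, eval_C, sub_eq_zero] at hx
    have hmx : m.eval x ≠ 0 := by
      intro h0
      rw [h0, mul_zero] at hx
      obtain ⟨u, v, huv⟩ := hpm
      have := congrArg (eval x) huv
      simp [hx, h0] at this
    have hcx : p.eval x / m.eval x = c := by
      rw [hx, mul_div_cancel_right₀ _ hmx]
    have hxB : x ∉ B := fun h => hcB ⟨x, h, hcx⟩
    simp only [B, Set.mem_union, not_or] at hxB
    obtain ⟨P, hP0, hPx⟩ := exists_point (V := V) hxB.2
    have hPv : n • P ≠ 0 ∧ HasValueAt f P (xc (n • P)) := by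
      by_contra h
      exact hxB.1 ⟨P, h, hPx⟩
    refine ⟨P, hPv.1, ?_⟩
    rcases P with _ | ⟨x', y', h⟩
    · exact (hP0 rfl).elim
    obtain rfl : x' = x := hPx
    have hpoly (q : F[X]) : HasValueAt (ι q) (.some x' y' h) (q.eval x') := by
      have h1 := hasValueAt_algebraMap h (algebraMap F[X] _ q)
      have h3 := evalEval_smul_add h.1 q 0
      rw [zero_smul, add_zero, ← Algebra.algebraMap_eq_smul_one, eval_zero, zero_mul,
        add_zero] at h3
      rwa [h3] at h1
    have h1 := hPv.2.mul (hpoly m)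
    rw [hfm] at h1
    rw [← hcx, h1.unique (hpoly p) |>.symm, mul_div_cancel_right₀ _ hmx]
  have hgood : ∀ᶠ Q : V.Point in Filter.cofinite, ∃ P, n • P = Q := by
    filter_upwards [(Filter.eventually_all_finite hC).mpr fun c _ => eventually_xc_ne (V := V) c,
      Filter.eventually_cofinite_ne 0] with Q hQ hQ0
    obtain ⟨P, hP0, hP⟩ := himage (xc Q) fun h => hQ _ h rfl
    rcases eq_or_eq_neg_of_xc_eq hP0 hQ0 hP with h | h
    · exact ⟨P, h⟩
    · exact ⟨-P, by rw [smul_neg, h, neg_neg]⟩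
  intro Q
  -- a subgroup that contains all but finitely many points is everything: `Q = (Z + Q) - Z`
  obtain ⟨Z, ⟨P, rfl⟩, P', hP'⟩ := (hgood.and (eventually_add_right hgood Q)).exists
  exact ⟨P' - P, by simp only [smul_sub, hP', add_sub_cancel_left]⟩

end Divisibility

/-! ### The Weil pairing as a bilinear map -/

section Bilinear

variable {F : Type*} [Field F] {V : WeierstrassCurve.Affine F} [DecidableEq F]
  [Infinite V.Point] {n : ℕ}

lemma exists_nsmul_nsmul_ne_zero (hs : Function.Surjective fun P : V.Point => n • P) :
    ∃ Q : V.Point, n • n • Q ≠ 0 := by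
  obtain ⟨X, hX⟩ := exists_ne (0 : V.Point)
  obtain ⟨Y, hY⟩ := hs X
  obtain ⟨Q, hQ⟩ := hs Y
  exact ⟨Q, by simpa [hQ, hY] using hX⟩

/-- The Weil pairing with a fixed `n`-torsion point, as a homomorphism. -/
def weilHom (hs : Function.Surjective fun P : V.Point => n • P) {T : V.Point} (hT : n • T = 0) :
    AddSubgroup.torsionBy V.Point (n : ℤ) →+ Additive Fˣ :=
  AddMonoidHom.mk' (fun S => Additive.ofMul (weilPairing n (S : V.Point) T)) fun S S' => by
    obtain ⟨Q, hQ⟩ := exists_nsmul_nsmul_ne_zero hs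
    have h (S : AddSubgroup.torsionBy V.Point (n : ℤ)) : n • (S : V.Point) = 0 := by
      rw [← natCast_zsmul]
      exact S.2
    rw [AddSubgroup.coe_add, weilPairing_add_left (h S) (h S') hT hQ, ofMul_mul]

lemma weilHom_apply (hs : Function.Surjective fun P : V.Point => n • P) {T : V.Point}
    (hT : n • T = 0) (S : AddSubgroup.torsionBy V.Point (n : ℤ)) :
    (weilHom hs hT S).toMul = weilPairing n (S : V.Point) T := rfl

end Bilinear

/-! ### Kummer classes and the map `w₂` -/

section Cohomology

variable {K : Type*} [Field K] {W : WeierstrassCurve K} {Ω : Type*} [Field Ω] [Algebra K Ω]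
  [DecidableEq Ω] {n : ℕ}

lemma Tors.nsmul_eq_zero (T : Tors W Ω n) : n • (T : (W⁄Ω).Point) = 0 := by
  rw [← natCast_zsmul]
  exact T.2

/-- A point killed by `n` as an element of `E[n]`. -/
def toTors {P : (W⁄Ω).Point} (h : n • P = 0) : Tors W Ω n :=
  ⟨P, by
    change (n : ℤ) • P = 0
    rw [natCast_zsmul, h]⟩

lemma coe_galTors (σ : Ω ≃ₐ[K] Ω) (T : Tors W Ω n) :
    (galTors W n σ T : (W⁄Ω).Point) = gal W σ (T : (W⁄Ω).Point) := rfl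

lemma galTors_gal_inv (σ : Ω ≃ₐ[K] Ω) (T : Tors W Ω n) :
    galTors W n σ (galTors W n σ⁻¹ T) = T :=
  Subtype.ext (gal_gal_inv σ _)

lemma galTors_inv_gal (σ : Ω ≃ₐ[K] Ω) (T : Tors W Ω n) :
    galTors W n σ⁻¹ (galTors W n σ T) = T :=
  Subtype.ext (gal_inv_gal σ _)

/-- The Galois orbit map of a point is locally constant, as the point is defined over a finite
extension. -/
lemma isLocallyConstant_gal [Algebra.IsAlgebraic K Ω] (Q : (W⁄Ω).Point) :
    IsLocallyConstant fun σ : Ω ≃ₐ[K] Ω => gal W σ Q := by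
  let E : IntermediateField K Ω := IntermediateField.adjoin K {xc Q, yc Q}
  have : FiniteDimensional K E := IntermediateField.finiteDimensional_adjoin fun a _ =>
    Algebra.IsIntegral.isIntegral a
  rw [IsLocallyConstant.iff_exists_open]
  intro σ
  refine ⟨(fun τ => σ⁻¹ * τ) ⁻¹' (E.fixingSubgroup : Set (Ω ≃ₐ[K] Ω)),
    (IntermediateField.fixingSubgroup_isOpen E).preimage (continuous_const_mul σ⁻¹), ?_, ?_⟩
  · simp only [Set.mem_preimage, inv_mul_cancel]
    exact E.fixingSubgroup.one_mem
  · intro τ hτ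
    have hfix (a : Ω) (ha : a ∈ E) : (σ⁻¹ * τ) a = a := hτ ⟨a, ha⟩
    have hx := hfix (xc Q) (IntermediateField.subset_adjoin K _ (by simp))
    have hy := hfix (yc Q) (IntermediateField.subset_adjoin K _ (by simp))
    have h : gal W (σ⁻¹ * τ) Q = Q := by
      rcases Q with _ | ⟨x, y, h⟩
      · rfl
      · exact (Point.some.injEq ..).mpr ⟨hx, hy⟩
    conv_rhs => rw [← h]
    rw [← gal_mul, mul_inv_cancel_left]

/-- The cocycle `σ ↦ σ Q - Q`, for a point `Q` such that `nQ` is Galois invariant. -/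
def kummerCocycle [Algebra.IsAlgebraic K Ω] (Q : (W⁄Ω).Point)
    (hQ : ∀ σ : Ω ≃ₐ[K] Ω, gal W σ (n • Q) = n • Q) : Z1 W Ω n :=
  ⟨fun σ => toTors (P := gal W σ Q - Q) (by rw [smul_sub, ← map_nsmul, hQ, sub_self]), by
    refine ⟨?_, fun σ τ => ?_⟩
    · have h := (isLocallyConstant_gal Q).comp fun P => P - Q
      exact (IsLocallyConstant.desc _ (fun T : Tors W Ω n => (T : (W⁄Ω).Point)) h
        Subtype.val_injective)
    · apply Subtype.ext
      change gal W (σ * τ) Q - Q = gal W σ Q - Q + gal W σ (gal W τ Q - Q)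
      rw [gal_mul, map_sub]
      abel⟩

variable [DecidableEq K]

lemma gal_baseChange (σ : Ω ≃ₐ[K] Ω) (P : (W⁄K).Point) :
    gal W σ (Point.baseChange K Ω P) = Point.baseChange K Ω P :=
  Point.map_baseChange (σ : Ω →ₐ[K] Ω) P

lemma kummer_eq_mk {P : (W⁄K).Point} {Q : (W⁄Ω).Point} (hQ : n • Q = Point.baseChange K Ω P)
    {c : Z1 W Ω n} (hc : ∀ σ, (c.1 σ : (W⁄Ω).Point) = gal W σ Q - Q) :
    kummer W Ω n P = QuotientAddGroup.mk c := by
  have h : ∃ c : Z1 W Ω n, ∃ Q : (W⁄Ω).Point,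
      n • Q = Point.baseChange K Ω P ∧ ∀ σ, (c.1 σ : (W⁄Ω).Point) = gal W σ Q - Q :=
    ⟨c, Q, hQ, hc⟩
  rw [kummer, dif_pos h]
  obtain ⟨Q', hQ', hc'⟩ := h.choose_spec
  rw [QuotientAddGroup.eq]
  refine ⟨toTors (P := Q - Q') (by rw [smul_sub, hQ, hQ', sub_self]), fun σ => ?_⟩
  apply Subtype.ext
  change -(h.choose.1 σ : (W⁄Ω).Point) + c.1 σ = gal W σ (Q - Q') - (Q - Q')
  rw [hc, hc', map_sub]
  abel

lemma kummer_add [Algebra.IsAlgebraic K Ω] (hs : Function.Surjective fun P : (W⁄Ω).Point => n • P)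
    (P P' : (W⁄K).Point) : kummer W Ω n (P + P') = kummer W Ω n P + kummer W Ω n P' := by
  obtain ⟨Q, hQ⟩ := hs (Point.baseChange K Ω P)
  obtain ⟨Q', hQ'⟩ := hs (Point.baseChange K Ω P')
  have hi (σ : Ω ≃ₐ[K] Ω) : gal W σ (n • Q) = n • Q := by
    simp only [hQ, gal_baseChange]
  have hi' (σ : Ω ≃ₐ[K] Ω) : gal W σ (n • Q') = n • Q' := by
    simp only [hQ', gal_baseChange]
  rw [kummer_eq_mk hQ (c := kummerCocycle Q hi) fun σ => rfl,
    kummer_eq_mk hQ' (c := kummerCocycle Q' hi') fun σ => rfl, ← QuotientAddGroup.mk_add]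
  refine kummer_eq_mk (Q := Q + Q') ?_ fun σ => ?_
  · simp only [smul_add, map_add] at *
    rw [hQ, hQ']
  · change gal W σ Q - Q + (gal W σ Q' - Q') = _
    rw [map_add]
    abel

omit [DecidableEq K] in
lemma mem_RUnits_of_fixed {β : Tors W Ω n → Ωˣ}
    (h : ∀ (σ : Ω ≃ₐ[K] Ω) T, σ (β (galTors W n σ⁻¹ T)) = β T) : β ∈ RUnits W Ω n := by
  intro σ T
  rw [← h σ, galTors_inv_gal]

variable [Infinite (W⁄Ω).Point]

omit [DecidableEq K] in
/-- The class of `ρ` in `H / ∂R^×` is determined by the cohomology class. -/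
lemma IsW2Value.mk_eq (hs : Function.Surjective fun P : (W⁄Ω).Point => n • P) {ξ : H1 W Ω n}
    {ρ ρ' : HGroup W Ω n} (h : IsW2Value W Ω n ξ ρ) (h' : IsW2Value W Ω n ξ ρ') :
    (QuotientGroup.mk ρ : HQuot W Ω n) = QuotientGroup.mk ρ' := by
  obtain ⟨c, hc, γ, hγ, hρ⟩ := h
  obtain ⟨c', rfl, γ', hγ', hρ'⟩ := h'
  rw [QuotientAddGroup.eq] at hc
  obtain ⟨S, hS⟩ := hc
  obtain ⟨Q, hQ⟩ := exists_nsmul_nsmul_ne_zero hs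
  -- the cocycles differ by the coboundary of `S`, so `γ' / γ` is Galois invariant up to `w(S)`,
  -- and `w(S)` is killed by `∂`
  let e : Tors W Ω n → Ωˣ := fun T => weilPairing n (S : (W⁄Ω).Point) (T : (W⁄Ω).Point)
  have he : bd W Ω n e = 1 := by
    funext T₁ T₂
    change weilPairing n _ _ * weilPairing n _ _ / weilPairing n _ ((T₁ + T₂ : Tors W Ω n) :
      (W⁄Ω).Point) = 1
    rw [AddSubgroup.coe_add, weilPairing_add_right S.nsmul_eq_zero T₁.nsmul_eq_zero
      T₂.nsmul_eq_zero hQ, div_self']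
  have hβ : γ' / γ / e ∈ RUnits W Ω n := by
    refine mem_RUnits_of_fixed fun σ T => ?_
    have h1 := hγ σ T
    have h2 := hγ' σ T
    have h3 := weilPairing_gal σ S.nsmul_eq_zero (galTors W n σ⁻¹ T).nsmul_eq_zero hQ
    rw [← coe_galTors, ← coe_galTors, galTors_gal_inv] at h3
    have h4 : c'.1 σ = c.1 σ + (galTors W n σ S - S) := by
      rw [← hS σ]
      change c'.1 σ = c.1 σ + (-c.1 σ + c'.1 σ)
      abel
    have h5 : weilPairing n (c'.1 σ : (W⁄Ω).Point) (T : (W⁄Ω).Point) =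
        weilPairing n (c.1 σ : (W⁄Ω).Point) (T : (W⁄Ω).Point) *
          (weilPairing n (galTors W n σ S : (W⁄Ω).Point) (T : (W⁄Ω).Point) /
            weilPairing n (S : (W⁄Ω).Point) (T : (W⁄Ω).Point)) := by
      have := congrArg (weilHom hs T.nsmul_eq_zero) h4
      rw [map_add, map_sub] at this
      exact congrArg Additive.toMul this
    have h6 : (weilPairing n (c'.1 σ : (W⁄Ω).Point) (T : (W⁄Ω).Point) : Ω) =
        weilPairing n (c.1 σ : (W⁄Ω).Point) (T : (W⁄Ω).Point) *
          (weilPairing n (galTors W n σ S : (W⁄Ω).Point) (T : (W⁄Ω).Point) /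
            weilPairing n (S : (W⁄Ω).Point) (T : (W⁄Ω).Point)) := by
      rw [h5]
      push_cast
      rfl
    rw [← h1, ← h2, h3] at h6
    change σ ((γ' _ / γ _ / weilPairing n _ _ : Ωˣ) : Ω) = ((γ' T / γ T / weilPairing n _ _ : Ωˣ) : Ω)
    push_cast
    rw [map_div₀, map_div₀]
    have z1 := (γ T).ne_zero
    have z2 := (γ' T).ne_zero
    have z3 : σ (γ (galTors W n σ⁻¹ T)) ≠ 0 := by simp
    have z4 : σ (weilPairing n (S : (W⁄Ω).Point) (galTors W n σ⁻¹ T : (W⁄Ω).Point)) ≠ 0 := by simp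
    have z5 := (weilPairing n (S : (W⁄Ω).Point) (T : (W⁄Ω).Point)).ne_zero
    field_simp at h6 ⊢
    linear_combination h6
  rw [QuotientGroup.eq]
  refine ⟨γ' / γ / e, hβ, ?_⟩
  rw [map_div, map_div, he, div_one, ← hρ, ← hρ', div_eq_inv_mul]
  rfl

omit [DecidableEq K] in
lemma w2_eq_mk (hs : Function.Surjective fun P : (W⁄Ω).Point => n • P) {ξ : H1 W Ω n}
    {ρ : HGroup W Ω n} (h : IsW2Value W Ω n ξ ρ) : w2 W Ω n ξ = QuotientGroup.mk ρ := by
  have hex : ∃ ρ : HGroup W Ω n, IsW2Value W Ω n ξ ρ := ⟨ρ, h⟩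
  rw [w2, dif_pos hex]
  exact hex.choose_spec.mk_eq hs h

omit [DecidableEq K] in
lemma IsW2Value.mul (hs : Function.Surjective fun P : (W⁄Ω).Point => n • P) {ξ ξ' : H1 W Ω n}
    {ρ ρ' : HGroup W Ω n} (h : IsW2Value W Ω n ξ ρ) (h' : IsW2Value W Ω n ξ' ρ') :
    IsW2Value W Ω n (ξ + ξ') (ρ * ρ') := by
  obtain ⟨c, rfl, γ, hγ, hρ⟩ := h
  obtain ⟨c', rfl, γ', hγ', hρ'⟩ := h'
  refine ⟨c + c', rfl, γ * γ', fun σ T => ?_, ?_⟩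
  · have h1 : weilPairing n ((c + c').1 σ : (W⁄Ω).Point) (T : (W⁄Ω).Point) =
        weilPairing n (c.1 σ : (W⁄Ω).Point) (T : (W⁄Ω).Point) *
          weilPairing n (c'.1 σ : (W⁄Ω).Point) (T : (W⁄Ω).Point) :=
      congrArg Additive.toMul (map_add (weilHom hs T.nsmul_eq_zero) (c.1 σ) (c'.1 σ))
    rw [h1, Units.val_mul, ← hγ, ← hγ', div_mul_div_comm, ← map_mul, Pi.mul_apply, Pi.mul_apply,
      Units.val_mul, Units.val_mul]
  · rw [map_mul, ← hρ, ← hρ']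
    rfl

end Cohomology

/-! ### The image of a divisor under `r` -/

section RDivisor

variable {K : Type*} [Field K] {W : WeierstrassCurve K} {Ω : Type*} [Field Ω] [Algebra K Ω]
  [DecidableEq Ω] {n : ℕ}

/-- The map `T ↦ ∏ G_T(q(P)) ^ (n_P)` for a divisor `∑ n_P (P)` and a section `q` of
multiplication by `n`. -/
def gammaDiv (n : ℕ) (q : (W⁄Ω).Point → (W⁄Ω).Point) (D : (W⁄Ω).Point →₀ ℤ) :
    Tors W Ω n → Ωˣ :=
  fun T => D.prod fun P m => gVal n (q P) (T : (W⁄Ω).Point) ^ m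

lemma prod_gal {M : Type*} [CommMonoid M] {D : (W⁄Ω).Point →₀ ℤ} (hD : D ∈ DivK W Ω)
    (σ : Ω ≃ₐ[K] Ω) (f : (W⁄Ω).Point → ℤ → M) :
    (D.prod fun P m => f (gal W σ P) m) = D.prod f := by
  conv_rhs => rw [← galDiv_eq_self hD σ]
  exact (Finsupp.prod_mapDomain_index_inj (gal_injective σ)).symm

lemma sum_gal {M : Type*} [AddCommMonoid M] {D : (W⁄Ω).Point →₀ ℤ} (hD : D ∈ DivK W Ω)
    (σ : Ω ≃ₐ[K] Ω) (f : (W⁄Ω).Point → ℤ → M) :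
    (D.sum fun P m => f (gal W σ P) m) = D.sum f := by
  conv_rhs => rw [← galDiv_eq_self hD σ]
  exact (Finsupp.sum_mapDomain_index_inj (gal_injective σ)).symm

lemma ptSum_eq_sum (D : (W⁄Ω).Point →₀ ℤ) : ptSum D = D.sum fun P m => m • P := by
  rw [ptSum, Finsupp.liftAddHom_apply]
  rfl

lemma bd_apply (α : Tors W Ω n → Ωˣ) (T₁ T₂ : Tors W Ω n) :
    bd W Ω n α T₁ T₂ = α T₁ * α T₂ / α (T₁ + T₂) := rfl

variable [Infinite (W⁄Ω).Point] {q : (W⁄Ω).Point → (W⁄Ω).Point}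

lemma bd_gammaDiv (hq : ∀ P, n • q P = P) {D : (W⁄Ω).Point →₀ ℤ} (hav : AvoidsTors W Ω n D)
    (T₁ T₂ : Tors W Ω n) : (bd W Ω n (gammaDiv n q D) T₁ T₂ : Ω) =
      D.prod fun P m => rVal (T₁ : (W⁄Ω).Point) (T₂ : (W⁄Ω).Point) P ^ m := by
  change ((_ * _ / _ : Ωˣ) : Ω) = _
  simp only [gammaDiv, Finsupp.prod]
  rw [← Finset.prod_mul_distrib, ← Finset.prod_div_distrib, Units.coe_prod]
  refine Finset.prod_congr rfl fun P hP => ?_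
  have h := gVal_mul_div (n := n) (Q := q P) (by rw [hq]; exact hav P hP) T₁.nsmul_eq_zero
    T₂.nsmul_eq_zero
  rw [hq] at h
  rw [← mul_zpow, ← div_zpow, Units.val_zpow_eq_zpow_val, ← h, AddSubgroup.coe_add]

lemma exists_isRDiv (hs : Function.Surjective fun P : (W⁄Ω).Point => n • P)
    {D : (W⁄Ω).Point →₀ ℤ} (hD : D ∈ DivK W Ω) (hav : AvoidsTors W Ω n D) :
    ∃ ρ : HGroup W Ω n, IsRDiv W Ω n D ρ := by
  choose q hq using hs
  refine ⟨⟨bd W Ω n (gammaDiv n q D), fun σ T₁ T₂ => ?_, fun T₁ T₂ => ?_, fun T₁ T₂ T₃ => ?_⟩,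
    fun T₁ T₂ => bd_gammaDiv hq hav T₁ T₂⟩
  · rw [bd_gammaDiv hq hav, bd_gammaDiv hq hav, ← prod_gal hD σ, Finsupp.prod, Finsupp.prod,
      map_prod]
    refine Finset.prod_congr rfl fun P _ => ?_
    rw [coe_galTors, coe_galTors, rVal_gal, map_zpow₀]
  · rw [bd_apply, bd_apply, mul_comm, add_comm]
  · rw [bd_apply, bd_apply, bd_apply, bd_apply, add_assoc]
    apply Units.ext
    push_cast
    field_simp

/-- The Galois action on `∏ G_T(q(P)) ^ (n_P)` is given by the Weil pairing with `σ Q - Q`, where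
`Q = ∑ n_P q(P)`. -/
lemma gal_gammaDiv (hs : Function.Surjective fun P : (W⁄Ω).Point => n • P)
    (hq : ∀ P, n • q P = P) {D : (W⁄Ω).Point →₀ ℤ} (hD : D ∈ DivK W Ω)
    (hav : AvoidsTors W Ω n D) (σ : Ω ≃ₐ[K] Ω) (T S : Tors W Ω n)
    (hS : (S : (W⁄Ω).Point) =
      gal W σ (D.sum fun P m => m • q P) - D.sum fun P m => m • q P) :
    σ (gammaDiv n q D (galTors W n σ⁻¹ T)) / (gammaDiv n q D T : Ω) =
      (weilPairing n (S : (W⁄Ω).Point) (T : (W⁄Ω).Point) : Ωˣ) := by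
  -- as `D` is invariant, `σ Q - Q` is the sum of the torsion points `σ (q P) - q (σ P)`
  let s : (W⁄Ω).Point → Tors W Ω n := fun P => toTors (P := gal W σ (q P) - q (gal W σ P))
    (by rw [smul_sub, ← map_nsmul, hq, hq, sub_self])
  have hSs : S = D.sum fun P m => m • s P := by
    apply Subtype.ext
    have h1 : ((D.sum fun P m => m • s P : Tors W Ω n) : (W⁄Ω).Point) =
        D.sum fun P m => m • (gal W σ (q P) - q (gal W σ P)) :=
      map_finsuppSum (AddSubgroup.subtype _) D fun P m => m • s P
    rw [hS, h1]
    nth_rw 2 [← sum_gal hD σ (fun P m => m • q P)]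
    simp only [Finsupp.sum, map_sum, map_zsmul, smul_sub, Finset.sum_sub_distrib]
  have h1 : Units.map (σ : Ω →* Ω) (gammaDiv n q D (galTors W n σ⁻¹ T)) =
      D.prod fun P m => gVal n (gal W σ (q P)) (T : (W⁄Ω).Point) ^ m := by
    simp only [gammaDiv, Finsupp.prod, map_prod, map_zpow]
    refine Finset.prod_congr rfl fun P hP => ?_
    congr 1
    apply Units.ext
    have h := gVal_gal σ (n := n) (Q := q P) (by rw [hq]; exact hav P hP)
      (galTors W n σ⁻¹ T).nsmul_eq_zero
    rw [← coe_galTors, galTors_gal_inv] at h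
    exact h.symm
  have h2 : gammaDiv n q D T =
      D.prod fun P m => gVal n (q (gal W σ P)) (T : (W⁄Ω).Point) ^ m :=
    (prod_gal hD σ fun P m => gVal n (q P) (T : (W⁄Ω).Point) ^ m).symm
  have h3 : weilPairing n (S : (W⁄Ω).Point) (T : (W⁄Ω).Point) =
      D.prod fun P m => weilPairing n (s P : (W⁄Ω).Point) (T : (W⁄Ω).Point) ^ m := by
    rw [← weilHom_apply hs T.nsmul_eq_zero, hSs, Finsupp.sum, map_sum, toMul_sum]
    refine Finset.prod_congr rfl fun P _ => ?_
    rw [map_zsmul, toMul_zsmul, weilHom_apply]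
  have h4 : Units.map (σ : Ω →* Ω) (gammaDiv n q D (galTors W n σ⁻¹ T)) / gammaDiv n q D T =
      weilPairing n (S : (W⁄Ω).Point) (T : (W⁄Ω).Point) := by
    rw [h1, h2, h3]
    simp only [Finsupp.prod]
    rw [← Finset.prod_div_distrib]
    refine Finset.prod_congr rfl fun P hP => ?_
    rw [← div_zpow, weilPairing_eq (s P).nsmul_eq_zero T.nsmul_eq_zero (Q := q (gal W σ P))]
    · congr 3
      change _ = q (gal W σ P) + (gal W σ (q P) - q (gal W σ P))
      abel
    · rw [hq, ← map_nsmul]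
      exact fun h => hav P hP ((map_eq_zero_iff _ (gal_injective σ)).mp h)
  rw [← h4]
  push_cast
  rfl

/-- The class `r(D)` is the image under `w₂` of the Kummer class of the sum of `D`. -/
lemma isW2Value_of_isRDiv [Algebra.IsAlgebraic K Ω] [DecidableEq K]
    (hs : Function.Surjective fun P : (W⁄Ω).Point => n • P) {D : (W⁄Ω).Point →₀ ℤ}
    (hD : D ∈ DivK W Ω) (hav : AvoidsTors W Ω n D) {P : (W⁄K).Point}
    (hP : ptSum D = Point.baseChange K Ω P) {ρ : HGroup W Ω n} (hρ : IsRDiv W Ω n D ρ) :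
    IsW2Value W Ω n (kummer W Ω n P) ρ := by
  have hs' := hs
  choose q hq using hs'
  have hQ : n • (D.sum fun P m => m • q P) = Point.baseChange K Ω P := by
    rw [← hP, ptSum_eq_sum, Finsupp.sum, Finset.smul_sum]
    refine Finset.sum_congr rfl fun R _ => ?_
    rw [smul_comm]
    exact congrArg _ (hq R)
  have hi (σ : Ω ≃ₐ[K] Ω) : gal W σ (n • D.sum fun P m => m • q P) =
      n • D.sum fun P m => m • q P := by
    rw [hQ, gal_baseChange]
  refine ⟨kummerCocycle _ hi, (kummer_eq_mk hQ fun σ => rfl).symm, gammaDiv n q D, fun σ T => ?_, ?_⟩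
  · exact gal_gammaDiv hs hq hD hav σ T _ rfl
  · funext T₁ T₂
    apply Units.ext
    rw [hρ, bd_gammaDiv hq hav]

end RDivisor

/-! ### Fibres of the coordinate functions -/

section Fibers

open Polynomial

variable {F : Type*} [Field F] {V : WeierstrassCurve.Affine F}

lemma ncard_xc_fiber [IsSepClosed F] [V.IsElliptic] {c : F}
    (hc : V.twoTorsionPolynomial.toPoly.eval c ≠ 0) :
    {P : V.Point | P ≠ 0 ∧ xc P = c}.ncard = 2 := by
  classical
  obtain ⟨P, hP, rfl⟩ := exists_point hc
  have h : {Q : V.Point | Q ≠ 0 ∧ xc Q = xc P} = {P, -P} := by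
    ext Q
    constructor
    · rintro ⟨h0, h1⟩
      exact eq_or_eq_neg_of_xc_eq h0 hP h1
    · rintro (rfl | rfl)
      · exact ⟨hP, rfl⟩
      · refine ⟨?_, xc_neg P⟩
        rcases P with _ | ⟨x, y, h⟩
        · exact (hP rfl).elim
        · rintro ⟨⟩
  rw [h, Set.ncard_pair]
  intro hneg
  rcases P with _ | ⟨x, y, hxy⟩
  · exact hP rfl
  apply hc
  change eval x _ = 0
  rw [eval_twoTorsionPolynomial hxy.1]
  have hy : y = V.negY x y := ((Point.some.injEq ..).mp hneg).2
  rw [negY] at hy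
  exact pow_eq_zero_iff two_ne_zero |>.mpr (by linear_combination hy)

variable (V) in
/-- The discriminant, as a polynomial in `c`, of the cubic polynomial whose roots are the
`x`-coordinates of the points with `y = c`. -/
def yDisc : F[X] :=
  C (-27) * X ^ 4 + C (4 * V.a₁ ^ 3 - 54 * V.a₃ + 18 * V.a₂ * V.a₁) * X ^ 3 +
    C (V.a₂ ^ 2 * V.a₁ ^ 2 - 12 * V.a₄ * V.a₁ ^ 2 + 4 * V.a₂ ^ 3 - 27 * (V.a₃ ^ 2 - 2 * V.a₆) +
      18 * V.a₂ * (V.a₁ * V.a₃ - V.a₄)) * X ^ 2 +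
    C (-2 * V.a₂ ^ 2 * V.a₄ * V.a₁ + 12 * V.a₄ ^ 2 * V.a₁ + 4 * V.a₂ ^ 3 * V.a₃ +
      54 * V.a₆ * V.a₃ - 18 * V.a₂ * (V.a₄ * V.a₃ + V.a₁ * V.a₆)) * X +
    C (V.a₂ ^ 2 * V.a₄ ^ 2 - 4 * V.a₄ ^ 3 - 4 * V.a₂ ^ 3 * V.a₆ - 27 * V.a₆ ^ 2 +
      18 * V.a₂ * V.a₄ * V.a₆)

lemma eval_yDisc (c : F) {b e : F} (hb : b = V.a₄ - V.a₁ * c) (he : e = V.a₆ - V.a₃ * c - c ^ 2) :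
    (yDisc V).eval c = V.a₂ ^ 2 * b ^ 2 - 4 * b ^ 3 - 4 * V.a₂ ^ 3 * e - 27 * e ^ 2 +
      18 * V.a₂ * b * e := by
  subst hb he
  simp only [yDisc, eval_add, eval_mul, eval_pow, eval_X, eval_C]
  ring

/-- In characteristic different from `3` the leading coefficient is not zero; in characteristic
`3` the vanishing of all coefficients makes the curve singular. -/
lemma yDisc_ne_zero [V.IsElliptic] : yDisc V ≠ 0 := by
  intro h
  have hcoeff (k₄ k₃ k₂ k₁ k₀ : F)
      (hk : C k₄ * X ^ 4 + C k₃ * X ^ 3 + C k₂ * X ^ 2 + C k₁ * X + C k₀ = 0) :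
      k₄ = 0 ∧ k₃ = 0 ∧ k₂ = 0 ∧ k₀ = 0 := by
    refine ⟨?_, ?_, ?_, ?_⟩
    · simpa [coeff_X, coeff_C, coeff_X_pow] using congrArg (coeff · 4) hk
    · simpa [coeff_X, coeff_C, coeff_X_pow] using congrArg (coeff · 3) hk
    · simpa [coeff_X, coeff_C, coeff_X_pow] using congrArg (coeff · 2) hk
    · simpa [coeff_X, coeff_C, coeff_X_pow] using congrArg (coeff · 0) hk
  obtain ⟨h4, h3, h2, h0⟩ := hcoeff _ _ _ _ _ h
  have hthree : (3 : F) = 0 := by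
    have : (3 : F) ^ 3 = 0 := by linear_combination -h4
    exact pow_eq_zero_iff three_ne_zero |>.mp this
  have ha₁ : V.a₁ = 0 := by
    have : V.a₁ ^ 3 = 0 := by
      linear_combination h3 - (V.a₁ ^ 3 - 18 * V.a₃ + 6 * V.a₂ * V.a₁) * hthree
    exact pow_eq_zero_iff three_ne_zero |>.mp this
  rw [ha₁] at h2
  have ha₂ : V.a₂ = 0 := by
    have : V.a₂ ^ 3 = 0 := by
      linear_combination h2 - (V.a₂ ^ 3 - 9 * (V.a₃ ^ 2 - 2 * V.a₆) - 6 * V.a₂ * V.a₄) * hthree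
    exact pow_eq_zero_iff three_ne_zero |>.mp this
  rw [ha₂] at h0
  have ha₄ : V.a₄ = 0 := by
    have : V.a₄ ^ 3 = 0 := by
      linear_combination -h0 - (V.a₄ ^ 3 + 9 * V.a₆ ^ 2) * hthree
    exact pow_eq_zero_iff three_ne_zero |>.mp this
  apply V.isUnit_Δ.ne_zero
  rw [WeierstrassCurve.Δ, b₂, b₄, b₆, b₈, ha₁, ha₂, ha₄]
  linear_combination (-9 * (V.a₃ ^ 2 + 4 * V.a₆) ^ 2) * hthree

lemma ncard_yc_fiber [IsSepClosed F] [V.IsElliptic] {c : F} (hc : (yDisc V).eval c ≠ 0) :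
    {P : V.Point | P ≠ 0 ∧ yc P = c}.ncard = 3 := by
  classical
  obtain ⟨b, hb⟩ : ∃ b, b = V.a₄ - V.a₁ * c := ⟨_, rfl⟩
  obtain ⟨e, he⟩ : ∃ e, e = V.a₆ - V.a₃ * c - c ^ 2 := ⟨_, rfl⟩
  rw [eval_yDisc c hb he] at hc
  set d := V.a₂ ^ 2 * b ^ 2 - 4 * b ^ 3 - 4 * V.a₂ ^ 3 * e - 27 * e ^ 2 + 18 * V.a₂ * b * e with hd
  let f : Cubic F := ⟨1, V.a₂, b, e⟩
  have hf : f.toPoly = X ^ 3 + C V.a₂ * X ^ 2 + C b * X + C e := by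
    simp [f, Cubic.toPoly]
  have hf0 : f.toPoly ≠ 0 := Cubic.ne_zero_of_a_ne_zero one_ne_zero
  -- the discriminant of a cubic `f` is an explicit linear combination of `f` and `f'`
  have hsep : f.toPoly.Separable := by
    refine ⟨C d⁻¹ * (C (-4 * V.a₂ ^ 3 + 15 * V.a₂ * b - 27 * e) + C (-6 * V.a₂ ^ 2 + 18 * b) * X),
      C d⁻¹ * (C (V.a₂ ^ 2 * b - 4 * b ^ 2 + 3 * V.a₂ * e) +
        C (2 * V.a₂ ^ 3 - 7 * V.a₂ * b + 9 * e) * X + C (2 * V.a₂ ^ 2 - 6 * b) * X ^ 2), ?_⟩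
    have h1 : (C d⁻¹ : F[X]) * C d = 1 := by rw [← C_mul, inv_mul_cancel₀ hc, C_1]
    rw [← h1, hf, hd]
    simp only [derivative_add, derivative_mul, derivative_X_pow, derivative_X, derivative_C,
      C_add, C_sub, C_mul, C_pow, C_neg, map_ofNat, Nat.cast_ofNat]
    ring
  have hroots : f.toPoly.roots.toFinset.card = 3 := by
    rw [Multiset.toFinset_card_of_nodup (nodup_roots hsep),
      ← (IsSepClosed.splits_of_separable _ hsep).natDegree_eq_card_roots]
    exact Cubic.natDegree_of_a_ne_zero one_ne_zero
  have hmem (x : F) : x ∈ f.toPoly.roots.toFinset ↔ V.Equation x c := by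
    rw [Multiset.mem_toFinset, mem_roots hf0, IsRoot, hf, equation_iff, hb, he]
    simp only [eval_add, eval_mul, eval_pow, eval_X, eval_C]
    constructor <;> intro h <;> linear_combination -h
  rw [← hroots, ← Set.ncard_coe_finset]
  refine Set.ncard_congr (fun P _ => xc P) ?_ ?_ ?_
  · rintro (_ | ⟨x, y, h⟩) ⟨h0, h1⟩
    · exact (h0 rfl).elim
    · change y = c at h1
      subst h1
      exact (hmem x).mpr h.1
  · rintro (_ | ⟨x, y, h⟩) (_ | ⟨x', y', h'⟩) ⟨h0, h1⟩ ⟨h0', h1'⟩ hx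
    · exact (h0 rfl).elim
    · exact (h0 rfl).elim
    · exact (h0' rfl).elim
    · exact (Point.some.injEq ..).mpr ⟨hx, h1.trans h1'.symm⟩
  · intro x hx
    exact ⟨.some x c (equation_iff_nonsingular.mp ((hmem x).mp hx)), ⟨by rintro ⟨⟩, rfl⟩, rfl⟩

end Fibers

/-! ### Rational divisors of degree one -/

section PrimePower

open Polynomial

/-- Over any field there are infinitely many separable elements of degree a power of a given prime:
the elements of the field if it is infinite, and those of a tower of finite fields otherwise. -/
lemma infinite_setOf_natDegree_minpoly (K Ω : Type*) [Field K] [Field Ω] [Algebra K Ω]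
    [IsSepClosure K Ω] {p : ℕ} (hp : p.Prime) :
    {c : Ω | ∃ j, (minpoly K c).natDegree = p ^ j}.Infinite := by
  classical
  have := IsSepClosure.sep_closed K (K := Ω)
  rcases finite_or_infinite K with hfin | hinf
  · intro hS
    have := Fintype.ofFinite K
    obtain ⟨ℓ, hℓ⟩ := CharP.exists K
    set k := hS.toFinset.card with hk
    set q := Nat.card K with hq
    have hq1 : 1 < q := Finite.one_lt_card
    set g : K[X] := X ^ q ^ p ^ k - X with hg
    have hpk : p ^ k ≠ 0 := pow_ne_zero _ hp.ne_zero
    have hg0 : g ≠ 0 := FiniteField.X_pow_card_pow_sub_X_ne_zero _ hpk hq1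
    have hℓq : ℓ ∣ q := by
      rw [← CharP.cast_eq_zero_iff K ℓ, hq, Nat.card_eq_fintype_card, Nat.cast_card_eq_zero]
    have hsep : g.Separable := galois_poly_separable ℓ _ (hℓq.trans (dvd_pow_self q hpk))
    have hcard := card_rootSet_eq_natDegree hsep (IsSepClosed.splits_codomain (K := Ω) g hsep)
    rw [FiniteField.X_pow_card_pow_sub_X_natDegree_eq _ hpk hq1] at hcard
    have hsub : (g.rootSet Ω).toFinset ⊆ hS.toFinset := by
      intro c hc
      rw [Set.mem_toFinset, mem_rootSet] at hc
      have hdvd := minpoly.dvd K c hc.2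
      have hint : IsIntegral K c := Algebra.IsIntegral.isIntegral c
      have := (minpoly.irreducible hint).natDegree_dvd_of_dvd_X_pow_card_pow_sub_X hdvd
      obtain ⟨j, -, hj⟩ := (Nat.dvd_prime_pow hp).mp this
      exact hS.mem_toFinset.mpr ⟨j, hj⟩
    have h1 := Finset.card_le_card hsub
    rw [Set.toFinset_card, hcard] at h1
    have h2 : k < p ^ k := Nat.lt_pow_self hp.one_lt
    have h3 : p ^ k < q ^ p ^ k := Nat.lt_pow_self hq1
    omega
  · refine (Set.infinite_range_of_injective (algebraMap K Ω).injective).mono ?_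
    rintro _ ⟨a, rfl⟩
    exact ⟨0, by rw [minpoly.eq_X_sub_C, natDegree_X_sub_C, pow_zero]⟩

end PrimePower

section DegreeOne

variable {K : Type*} [Field K] {W : WeierstrassCurve K} {Ω : Type*} [Field Ω] [Algebra K Ω]
  [DecidableEq Ω] [IsSepClosure K Ω]

/-- The divisor cut out by the conjugates of a value `c` of an equivariant function `f` all of whose
general fibres have `k` elements has degree `k` times the degree of `c`. -/
lemma exists_divK_of_ncard_fiber {f : (W⁄Ω).Point → Ω}
    (hf : ∀ (σ : Ω ≃ₐ[K] Ω) P, f (gal W σ P) = σ (f P)) {k p : ℕ} (hk : k ≠ 0) (hp : p.Prime)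
    (hfib : {c | {P | P ≠ 0 ∧ f P = c}.ncard ≠ k}.Finite) {B : Set (W⁄Ω).Point} (hB : B.Finite)
    (hBgal : ∀ (σ : Ω ≃ₐ[K] Ω), ∀ P ∈ B, gal W σ P ∈ B) :
    ∃ j, ∃ Z ∈ DivK W Ω, degHom Z = k * p ^ j ∧ ∀ P ∈ Z.support, P ∉ B := by
  classical
  have := IsSepClosure.sep_closed K (K := Ω)
  obtain ⟨c, ⟨⟨j, hj⟩, hc⟩⟩ :=
    ((infinite_setOf_natDegree_minpoly K Ω hp).sdiff (hfib.union (hB.image f))).nonempty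
  simp only [Set.mem_union, Set.mem_ofPred_eq, not_or, not_not, Set.mem_image, not_exists,
    not_and] at hc
  obtain ⟨hck, hcB⟩ := hc
  -- the conjugates of `c`, and the points at which `f` takes one of them as its value
  let S : Finset Ω := ((minpoly K c).rootSet Ω).toFinset
  have hSc (c' : Ω) : c' ∈ S ↔ ∃ σ : Ω ≃ₐ[K] Ω, σ c = c' := by
    rw [Set.mem_toFinset, ← isConjRoot_iff_exists_algEquiv, IsConjRoot.comm,
      isConjRoot_iff_mem_minpoly_rootSet (Algebra.IsIntegral.isIntegral c)]
  have hScard : S.card = p ^ j := by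
    have hsep : (minpoly K c).Separable := Algebra.IsSeparable.isSeparable K c
    rw [Set.toFinset_card,
      Polynomial.card_rootSet_eq_natDegree hsep (IsSepClosed.splits_codomain _ hsep), hj]
  have hfibS (c' : Ω) (hc' : c' ∈ S) : {P | P ≠ 0 ∧ f P = c'}.ncard = k := by
    obtain ⟨σ, rfl⟩ := (hSc c').mp hc'
    rw [← hck, ← Set.ncard_image_of_injective {P | P ≠ 0 ∧ f P = c} (gal_injective σ)]
    congr 1
    ext P
    constructor
    · rintro ⟨h0, h1⟩
      refine ⟨gal W σ⁻¹ P, ⟨fun h => h0 ((map_eq_zero_iff _ (gal_injective σ⁻¹)).mp h), ?_⟩,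
        gal_gal_inv σ P⟩
      rw [hf, h1]
      exact σ.symm_apply_apply c
    · rintro ⟨Q, ⟨h0, h1⟩, rfl⟩
      exact ⟨fun h => h0 ((map_eq_zero_iff _ (gal_injective σ)).mp h), by rw [hf, h1]⟩
  have hTfin : {P | P ≠ 0 ∧ f P ∈ S}.Finite := by
    have h : {P | P ≠ 0 ∧ f P ∈ S} = ⋃ c' ∈ S, {P | P ≠ 0 ∧ f P = c'} := by
      ext P
      simp
    rw [h]
    exact S.finite_toSet.biUnion fun c' hc' =>
      Set.finite_of_ncard_ne_zero (by rw [hfibS c' hc']; exact hk)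
  let T := hTfin.toFinset
  have hT (P : (W⁄Ω).Point) : P ∈ T ↔ P ≠ 0 ∧ f P ∈ S := hTfin.mem_toFinset
  have hTgal (σ : Ω ≃ₐ[K] Ω) (P : (W⁄Ω).Point) : gal W σ P ∈ T ↔ P ∈ T := by
    have h (σ : Ω ≃ₐ[K] Ω) (P : (W⁄Ω).Point) (hP : P ∈ T) : gal W σ P ∈ T := by
      obtain ⟨h0, h1⟩ := (hT P).mp hP
      obtain ⟨τ, hτ⟩ := (hSc _).mp h1
      refine (hT _).mpr ⟨fun h => h0 ((map_eq_zero_iff _ (gal_injective σ)).mp h), (hSc _).mpr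
        ⟨σ * τ, ?_⟩⟩
      rw [hf, ← hτ]
      rfl
    exact ⟨fun hP => by simpa [gal_inv_gal] using h σ⁻¹ _ hP, h σ P⟩
  have hZ (P : (W⁄Ω).Point) : (∑ Q ∈ T, Finsupp.single Q (1 : ℤ)) P = if P ∈ T then 1 else 0 := by
    simp [Finsupp.finsetSum_apply, Finsupp.single_apply]
  refine ⟨j, ∑ Q ∈ T, Finsupp.single Q 1, fun σ P => by simp only [hZ, hTgal], ?_, ?_⟩
  · have hcard : T.card = k * p ^ j := by
      rw [Finset.card_eq_sum_card_fiberwise (f := f) (t := S) fun P hP => ((hT P).mp hP).2,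
        ← hScard, mul_comm]
      refine Finset.sum_const_nat fun c' hc' => ?_
      rw [← hfibS c' hc', ← Set.ncard_coe_finset]
      congr 1
      ext P
      simp only [Finset.coe_filter, hT, Set.mem_ofPred_eq]
      exact ⟨fun h => ⟨h.1.1, h.2⟩, fun h => ⟨⟨h.1, h.2 ▸ hc'⟩, h.2⟩⟩
    simp only [map_sum, degHom_single, Finset.sum_const, hcard]
    simp
  · intro P hP hPB
    have hPT : P ∈ T := by
      by_contra h
      rw [Finsupp.mem_support_iff, hZ, if_neg h] at hP
      exact hP rfl
    obtain ⟨σ, hσ⟩ := (hSc _).mp ((hT P).mp hPT).2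
    refine hcB (gal W σ⁻¹ P) (hBgal _ _ hPB) ?_
    rw [hf, ← hσ]
    exact σ.symm_apply_apply c

/-- There is a rational divisor of degree `1` that avoids a given finite Galois stable set: general
fibres of the coordinate functions `x` and `y` give divisors of degree a power of `2`, respectively
of `3`. -/
lemma exists_divK_degHom_eq_one [W.IsElliptic] {B : Set (W⁄Ω).Point} (hB : B.Finite)
    (hBgal : ∀ (σ : Ω ≃ₐ[K] Ω), ∀ P ∈ B, gal W σ P ∈ B) :
    ∃ Z ∈ DivK W Ω, degHom Z = 1 ∧ ∀ P ∈ Z.support, P ∉ B := by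
  have := IsSepClosure.sep_closed K (K := Ω)
  have : (W⁄Ω).IsElliptic := inferInstanceAs (W.map (algebraMap K Ω)).IsElliptic
  obtain ⟨i, Z₁, hZ₁, hd₁, hB₁⟩ := exists_divK_of_ncard_fiber xc_gal two_ne_zero Nat.prime_two
    ((Polynomial.finite_setOfPred_isRoot (twoTorsionPolynomial_ne_zero (V := W⁄Ω))).subset
      fun c hc => by_contra fun h => hc (ncard_xc_fiber h)) hB hBgal
  obtain ⟨j, Z₂, hZ₂, hd₂, hB₂⟩ := exists_divK_of_ncard_fiber yc_gal three_ne_zero Nat.prime_three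
    ((Polynomial.finite_setOfPred_isRoot (yDisc_ne_zero (V := W⁄Ω))).subset
      fun c hc => by_contra fun h => hc (ncard_yc_fiber h)) hB hBgal
  have hco : IsCoprime ((2 : ℤ) * 2 ^ i) (3 * 3 ^ j) := by
    rw [← pow_succ', ← pow_succ']
    exact IsCoprime.pow (by norm_num)
  obtain ⟨a, b, hab⟩ := hco
  refine ⟨a • Z₁ + b • Z₂, add_mem (zsmul_mem hZ₁ a) (zsmul_mem hZ₂ b), ?_, fun P hP hPB => ?_⟩
  · rw [map_add, map_zsmul, map_zsmul, hd₁, hd₂]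
    exact_mod_cast hab
  · have h₁ := Finsupp.notMem_support_iff.mp fun h => hB₁ P h hPB
    have h₂ := Finsupp.notMem_support_iff.mp fun h => hB₂ P h hPB
    rw [Finsupp.mem_support_iff] at hP
    exact hP (by simp [h₁, h₂])

end DegreeOne

/-! ### Rational points and the Picard group -/

section Picard

section Translation

variable {F : Type*} [Field F] {V : WeierstrassCurve.Affine F} [DecidableEq F]

/-- Translation of divisors by the point `A`. -/
def translate (A : V.Point) : (V.Point →₀ ℤ) →+ (V.Point →₀ ℤ) :=
  Finsupp.mapDomain.addMonoidHom (· + A)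

@[simp] lemma translate_single (A P : V.Point) (m : ℤ) :
    translate A (Finsupp.single P m) = Finsupp.single (P + A) m :=
  Finsupp.mapDomain_single

lemma translate_apply (A : V.Point) (D : V.Point →₀ ℤ) (P : V.Point) :
    translate A D P = D (P - A) := by
  conv_lhs => rw [← sub_add_cancel P A]
  exact Finsupp.mapDomain_apply (add_left_injective A) D _

lemma degHom_translate (A : V.Point) (D : V.Point →₀ ℤ) : degHom (translate A D) = degHom D := by
  have h : degHom.comp (translate A) = degHom := by
    ext P
    simp
  exact DFunLike.congr_fun h D

lemma ptSum_translate (A : V.Point) (D : V.Point →₀ ℤ) :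
    ptSum (translate A D) = ptSum D + degHom D • A := by
  have h : ptSum.comp (translate A) = ptSum + (zmultiplesHom _ A).comp degHom := by
    ext P
    simp
  exact DFunLike.congr_fun h D

end Translation

variable {K : Type*} [Field K] {W : WeierstrassCurve K} {Ω : Type*} [Field Ω] [Algebra K Ω]
  [DecidableEq Ω] [IsSepClosure K Ω]

omit [IsSepClosure K Ω] in
lemma translate_mem_divK {A : (W⁄Ω).Point} (hA : ∀ σ : Ω ≃ₐ[K] Ω, gal W σ A = A)
    {D : (W⁄Ω).Point →₀ ℤ} (hD : D ∈ DivK W Ω) : translate A D ∈ DivK W Ω := by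
  intro σ P
  rw [translate_apply, translate_apply, ← hD σ (P - A), map_sub (gal W σ), hA]

/-- Every Galois invariant point is the sum of a rational divisor of degree `0` that avoids the
`n`-torsion: the difference of a divisor of degree `1` and its translate. -/
lemma exists_div0K_ptSum_eq [W.IsElliptic] {n : ℕ} (hn : (n : Ω) ≠ 0) {A : (W⁄Ω).Point}
    (hA : ∀ σ : Ω ≃ₐ[K] Ω, gal W σ A = A) :
    ∃ D : Div0K W Ω, AvoidsTors W Ω n D.1 ∧ ptSum D.1 = A := by
  have : (W⁄Ω).IsElliptic := inferInstanceAs (W.map (algebraMap K Ω)).IsElliptic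
  have htors := eventually_nsmul_ne_zero (V := W⁄Ω) hn
  have hfin : {P : (W⁄Ω).Point | ¬ (n • P ≠ 0 ∧ n • (P + A) ≠ 0)}.Finite :=
    htors.and (eventually_add_right htors A)
  have h0 (σ : Ω ≃ₐ[K] Ω) (P : (W⁄Ω).Point) : n • gal W σ P ≠ 0 ↔ n • P ≠ 0 := by
    rw [← map_nsmul, Ne, map_eq_zero_iff _ (gal_injective σ)]
  obtain ⟨Z, hZ, hdeg, hav⟩ := exists_divK_degHom_eq_one (K := K) hfin fun σ P hP => by
    change ¬ (_ ∧ _)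
    rwa [h0, show gal W σ P + A = gal W σ (P + A) by rw [map_add, hA], h0]
  replace hav (P : (W⁄Ω).Point) (hP : Z P ≠ 0) : n • P ≠ 0 ∧ n • (P + A) ≠ 0 :=
    not_not.mp (hav P (Finsupp.mem_support_iff.mpr hP))
  refine ⟨⟨translate A Z - Z, sub_mem (translate_mem_divK hA hZ) hZ, ?_⟩, fun P hP => ?_, ?_⟩
  · rw [deg_eq_degHom, map_sub, degHom_translate, sub_self]
  · rw [Finsupp.mem_support_iff, Finsupp.sub_apply, translate_apply] at hP
    by_cases h : Z P = 0
    · have h' := (hav (P - A) (by rwa [h, sub_zero] at hP)).2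
      rwa [sub_add_cancel] at h'
    · exact (hav P h).1
  · rw [map_sub, ptSum_translate, hdeg, one_zsmul, add_sub_cancel_left]

/-- Galois invariant points are rational. -/
lemma exists_baseChange_eq [DecidableEq K] {A : (W⁄Ω).Point}
    (hA : ∀ σ : Ω ≃ₐ[K] Ω, gal W σ A = A) : ∃ P : (W⁄K).Point, Point.baseChange K Ω P = A := by
  rcases A with _ | ⟨x, y, h⟩
  · exact ⟨0, rfl⟩
  obtain ⟨a, ha⟩ := exists_algebraMap_eq_of_fixed (K := K) (a := x) fun σ =>
    (xc_gal σ _).symm.trans (congrArg xc (hA σ))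
  obtain ⟨b, hb⟩ := exists_algebraMap_eq_of_fixed (K := K) (a := y) fun σ =>
    (yc_gal σ _).symm.trans (congrArg yc (hA σ))
  subst ha hb
  exact ⟨.some a b ((W.toAffine.baseChange_nonsingular
    (f := Algebra.ofId K Ω) (algebraMap K Ω).injective a b).mp h), rfl⟩

omit [IsSepClosure K Ω] in
lemma ptSum_fixed {D : (W⁄Ω).Point →₀ ℤ} (hD : D ∈ DivK W Ω) (σ : Ω ≃ₐ[K] Ω) :
    gal W σ (ptSum D) = ptSum D := by
  rw [← ptSum_galDiv, galDiv_eq_self hD]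

variable [DecidableEq K]

omit [IsSepClosure K Ω] in
lemma single_baseChange_mem_divK (P : (W⁄K).Point) :
    Finsupp.single (Point.baseChange K Ω P) (1 : ℤ) ∈ DivK W Ω := by
  intro σ Q
  nth_rw 1 [← gal_baseChange σ P]
  simp only [Finsupp.single_apply, (gal_injective σ).eq_iff]

variable (W Ω) in
/-- The rational divisor `(P) - (O)`. -/
def pointDiv (P : (W⁄K).Point) : Div0K W Ω :=
  ⟨Finsupp.single (Point.baseChange K Ω P) 1 - Finsupp.single 0 1,
    sub_mem (single_baseChange_mem_divK P) (single_baseChange_mem_divK 0),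
    by simp [deg_eq_degHom]⟩

omit [IsSepClosure K Ω] in
lemma ptSum_pointDiv (P : (W⁄K).Point) : ptSum (pointDiv W Ω P).1 = Point.baseChange K Ω P := by
  simp [pointDiv]

variable [Infinite (W⁄Ω).Point]

omit [DecidableEq K] in
/-- Two rational divisors of degree `0` are linearly equivalent over `K` if and only if their sums
agree. -/
lemma pic0_mk_eq_iff {D D' : Div0K W Ω} :
    (QuotientAddGroup.mk D : Pic0 W Ω) = QuotientAddGroup.mk D' ↔ ptSum D.1 = ptSum D'.1 := by
  have h : ptSum (-D + D').1 = -ptSum D.1 + ptSum D'.1 := by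
    rw [← map_neg, ← map_add]
    rfl
  rw [QuotientAddGroup.eq, ← neg_add_eq_zero, ← h]
  exact ⟨ptSum_eq_zero_of_mem_prinK, mem_prinK⟩

variable (W Ω) in
/-- The isomorphism `E(K) ≅ Pic⁰(E/K)`, `P ↦ [(P) - (O)]`. -/
def picEquiv : (W⁄K).Point ≃+ Pic0 W Ω :=
  AddEquiv.ofBijective
    (AddMonoidHom.mk' (fun P => (QuotientAddGroup.mk (pointDiv W Ω P) : Pic0 W Ω)) fun P Q => by
      rw [← QuotientAddGroup.mk_add, pic0_mk_eq_iff]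
      change _ = ptSum ((pointDiv W Ω P).1 + (pointDiv W Ω Q).1)
      simp only [map_add, ptSum_pointDiv]) <| by
    refine ⟨fun P Q h => ?_, fun c => ?_⟩
    · have h' := pic0_mk_eq_iff.mp h
      rw [ptSum_pointDiv, ptSum_pointDiv] at h'
      exact Point.map_injective _ h'
    · obtain ⟨D, rfl⟩ := QuotientAddGroup.mk_surjective c
      obtain ⟨P, hP⟩ := exists_baseChange_eq (ptSum_fixed D.2.1)
      exact ⟨P, pic0_mk_eq_iff.mpr (by rw [ptSum_pointDiv, hP])⟩

lemma picEquiv_apply (P : (W⁄K).Point) :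
    picEquiv W Ω P = QuotientAddGroup.mk (pointDiv W Ω P) := rfl

lemma baseChange_picEquiv_symm (D : Div0K W Ω) :
    Point.baseChange K Ω ((picEquiv W Ω).symm (QuotientAddGroup.mk D)) = ptSum D.1 := by
  rw [← ptSum_pointDiv, ← pic0_mk_eq_iff, ← picEquiv_apply, AddEquiv.apply_symm_apply]

omit [DecidableEq K] in
/-- Every class of degree `0` contains a rational divisor that avoids the `n`-torsion. -/
lemma exists_avoidsTors_mk_eq [W.IsElliptic] {n : ℕ} (hn : (n : Ω) ≠ 0) (c : Pic0 W Ω) :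
    ∃ D : Div0K W Ω, AvoidsTors W Ω n D.1 ∧ QuotientAddGroup.mk D = c := by
  obtain ⟨D, rfl⟩ := QuotientAddGroup.mk_surjective c
  obtain ⟨D', hav, hD'⟩ := exists_div0K_ptSum_eq hn (ptSum_fixed D.2.1)
  exact ⟨D', hav, pic0_mk_eq_iff.mpr hD'⟩

/-- Every Kummer class is in the domain of `w₂`. -/
lemma exists_isW2Value_kummer [W.IsElliptic] {n : ℕ} (hn : (n : Ω) ≠ 0)
    (hs : Function.Surjective fun P : (W⁄Ω).Point => n • P) (P : (W⁄K).Point) :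
    ∃ ρ, IsW2Value W Ω n (kummer W Ω n P) ρ := by
  obtain ⟨D, hav, hD⟩ := exists_div0K_ptSum_eq hn fun σ => gal_baseChange (Ω := Ω) σ P
  obtain ⟨ρ, hρ⟩ := exists_isRDiv hs D.2.1 hav
  exact ⟨ρ, isW2Value_of_isRDiv hs D.2.1 hav hD hρ⟩

variable (W Ω) in
/-- The composite `w₂ ∘ δ` as a homomorphism. -/
def w2Kummer [W.IsElliptic] {n : ℕ} (hn : (n : Ω) ≠ 0)
    (hs : Function.Surjective fun P : (W⁄Ω).Point => n • P) :
    (W⁄K).Point →+ Additive (HQuot W Ω n) :=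
  AddMonoidHom.mk' (fun P => Additive.ofMul (w2 W Ω n (kummer W Ω n P))) fun P Q => by
    obtain ⟨ρ, hρ⟩ := exists_isW2Value_kummer hn hs P
    obtain ⟨ρ', hρ'⟩ := exists_isW2Value_kummer hn hs Q
    rw [kummer_add hs, w2_eq_mk hs hρ, w2_eq_mk hs hρ', w2_eq_mk hs (hρ.mul hs hρ'),
      ← ofMul_mul, QuotientGroup.mk_mul]

end Picard

end EllDescent

end

open EllDescent in
theorem mainTheorem3 {K : Type*} [Field K] [DecidableEq K] (W : WeierstrassCurve K)
    [W.IsElliptic] (Ω : Type*) [Field Ω] [DecidableEq Ω] [Algebra K Ω] [IsSepClosure K Ω]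
    (n : ℕ) (hn : 2 ≤ n) (hK : (n : K) ≠ 0) :
    (∀ P : (W⁄K).Point, n • P ≠ 0 →
      ∃ ρ : EllDescent.HGroup W Ω n,
        (∀ T₁ T₂ : EllDescent.Tors W Ω n,
          (ρ.1 T₁ T₂ : Ω) = EllDescent.rVal (T₁ : (W⁄Ω).Point) (T₂ : (W⁄Ω).Point)
            (Point.baseChange K Ω P)) ∧
        EllDescent.w2 W Ω n (EllDescent.kummer W Ω n P) = QuotientGroup.mk ρ) ∧
    (∀ D ∈ EllDescent.DivK W Ω, EllDescent.AvoidsTors W Ω n D →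
      ∃ ρ : EllDescent.HGroup W Ω n, EllDescent.IsRDiv W Ω n D ρ) ∧
    ∃ φ : (W⁄K).Point ≃+ EllDescent.Pic0 W Ω,
      (∀ P : (W⁄K).Point, ∃ D : EllDescent.Div0K W Ω,
        D.1 = Finsupp.single (Point.baseChange K Ω P) 1 - Finsupp.single 0 1 ∧
          φ P = QuotientAddGroup.mk D) ∧
      (∀ c : EllDescent.Pic0 W Ω, ∃ D : EllDescent.Div0K W Ω,
        EllDescent.AvoidsTors W Ω n D.1 ∧ QuotientAddGroup.mk D = c) ∧
      ∃ rt : EllDescent.Pic0 W Ω →+ Additive (EllDescent.HQuot W Ω n),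
        (∀ (D : EllDescent.Div0K W Ω) (ρ : EllDescent.HGroup W Ω n),
          EllDescent.AvoidsTors W Ω n D.1 → EllDescent.IsRDiv W Ω n D.1 ρ →
            rt (QuotientAddGroup.mk D) = Additive.ofMul (QuotientGroup.mk ρ)) ∧
        ∀ P : (W⁄K).Point,
          EllDescent.w2 W Ω n (EllDescent.kummer W Ω n P) = (rt (φ P)).toMul := by
  have := IsSepClosure.sep_closed K (K := Ω)
  have : (W⁄Ω).IsElliptic := inferInstanceAs (W.map (algebraMap K Ω)).IsElliptic
  have : Infinite (W⁄Ω).Point := infinite_point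
  have hΩ : (n : Ω) ≠ 0 := by
    rwa [← map_natCast (algebraMap K Ω), Ne, map_eq_zero_iff _ (algebraMap K Ω).injective]
  have hs : Function.Surjective fun P : (W⁄Ω).Point => n • P := nsmul_surjective hΩ
  refine ⟨fun P hP => ?_, fun D hD hav => exists_isRDiv hs hD hav, picEquiv W Ω,
    fun P => ⟨pointDiv W Ω P, rfl, rfl⟩, exists_avoidsTors_mk_eq hΩ,
    (w2Kummer W Ω hΩ hs).comp (picEquiv W Ω).symm.toAddMonoidHom, fun D ρ hav hρ => ?_,
    fun P => ?_⟩
  · have hD := single_baseChange_mem_divK (Ω := Ω) P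
    have hav : AvoidsTors W Ω n (Finsupp.single (Point.baseChange K Ω P) 1) := by
      intro Q hQ
      rw [Finset.mem_singleton.mp (Finsupp.support_single_subset hQ), ← map_nsmul, Ne, map_eq_zero_iff _ (Point.map_injective _)]
      exact hP
    obtain ⟨ρ, hρ⟩ := exists_isRDiv hs hD hav
    refine ⟨ρ, fun T₁ T₂ => ?_, w2_eq_mk hs (isW2Value_of_isRDiv hs hD hav (by simp) hρ)⟩
    rw [hρ, Finsupp.prod_single_index (zpow_zero _), zpow_one]
  · exact congrArg Additive.ofMul (w2_eq_mk hs (isW2Value_of_isRDiv hs D.2.1 hav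
      (baseChange_picEquiv_symm D).symm hρ))
  · change _ = w2 W Ω n (kummer W Ω n ((picEquiv W Ω).symm (picEquiv W Ω P)))
    rw [AddEquiv.symm_apply_apply]
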